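/- **Corollary 11.7 (quadratic norms).** *Setting.* Let $k_0,k_1,u_0,u_1,q\in\mathbb C\setminus\{0\}$ with $0<|q|<1$, fix a square root $q^{1/2}$, write $\underline t=(k_0,k_1,u_0,u_1)$ and $\underline{\tilde t}=(u_1,k_1,u_0,k_0)$ (the dual parameters), and put $$a=k_1u_1,\quad b=-k_1u_1^{-1},\quad c=q^{1/2}k_0u_0,\quad d=-q^{1/2}k_0u_0^{-1}.$$ Assume $k_0^2,k_1^2,u_1^2\notin\pm q^{\mathbb Z}$ and $ef\notin q^{\mathbb Z}$ for all $e,f\in\{a,b,c,d\}$ (including $e=f$), and the same last condition for the four numbers formed in this way from $\underline{\tilde t}$. *Polynomials.* On $\mathcal A=\mathbb C[x^{\pm1}]$ let $(s_0f)(x)=f(qx^{-1})$, $(s_1f)(x)=f(x^{-1})$, $$T_0=k_0s_0+\frac{(k_0-k_0^{-1})+(u_0-u_0^{-1})q^{1/2}x^{-1}}{1-qx^{-2}}(1-s_0),\qquad T_1=k_1s_1+\frac{(k_1-k_1^{-1})+(u_1-u_1^{-1})x}{1-x^{2}}(1-s_1),$$ and $Y=T_1T_0$. Let $\epsilon(m)=1$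 for $m\ge0$, $\epsilon(m)=-1$ for $m<0$, $\gamma_m=(k_0k_1)^{\epsilon(m)}q^m$ and $\sigma=\{\gamma_m\}_{m\in\mathbb Z}$. Order the monomials by $1\prec x^{-1}\prec x\prec x^{-2}\prec x^2\prec\cdots$. For $m\in\mathbb Z$ let $P_m$ be the unique element of $\mathcal A$ of the form $x^m+$ lower order terms with $YP_m=\gamma_mP_m$. For $m\ge0$ let $P_m^+$ be the unique element of $C_+(\mathrm{span}\{P_m,P_{-m}\})$, $C_+=(1+k_1^2)^{-1}(1+k_1T_1)$, of the form $x^m+$ lower order terms (the monic symmetric Askey-Wilson polynomial). With $x_0=k_1u_1$ and $s(\gamma)=\gamma+\gamma^{-1}$ put $E^+_{s(\gamma_m)}=P_m^+/P_m^+(x_0)$ for $m\geq 0$; since $s(\gamma_{-m})=s(\gamma_m)$, this defines $E^+_{s(\gamma)}$ for all $\gamma\in\sigma$. *Bilinear form.* Let $(z;q)_\infty=\prod_{k\ge0}(1-zq^k)$, write $(z_1,\ldots,z_r;q)_\infty=\prod_i(z_i;q)_\infty$, and put $$\Delta_+(x)=\Delta_+(x;\underline t;q)=\frac{(x^2,x^{-2};q)_\infty}{(ax,ax^{-1},bx,bx^{-1},cx,cx^{-1},dx,dx^{-1};q)_\infty}.$$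 Let $C$ be any counterclockwise oriented rectifiable Jordan curve not passing through $0$ such that for all $e\in\{a,b,c,d\}$ and $k\in\mathbb Z_{\ge0}$ the point $eq^k$ lies in the interior and $e^{-1}q^{-k}$ in the exterior of $C$, and put $(f,g)=\frac1{2\pi i}\int_Cf(x)g(x^{-1})\Delta_+(x)\frac{dx}x$ for $f,g\in\mathcal A$. *Dual weights.* For $m\in\mathbb Z$ let $$w_+(\gamma_m^{-1})=\epsilon(m)\,\operatorname*{Res}_{y=\gamma_m^{-1}}\left(\frac{\Delta_+(y;\underline{\tilde t};q)}{y}\right).$$ *Claim.* For all $\gamma\in\sigma$, $$\frac{\bigl(E^+_{s(\gamma)},E^+_{s(\gamma)}\bigr)}{(1,1)}=\frac{w_+(\gamma_0^{-1})}{w_+(\gamma^{-1})},$$ where all denominators involved, $P_m^+(x_0)$ ($m\ge0$), $(1,1)$ and $w_+(\gamma^{-1})$ ($\gamma\in\sigma$), are non-zero. -/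

import Mathlib

open scoped LaurentPolynomial

namespace AskeyWilson

open LaurentPolynomial (T C)

noncomputable section

/-- The parameters: a multiplicity function `(k₀, k₁, u₀, u₁)` together with a fixed square
root `rq` of the deformation parameter `q`. -/
structure Param where
  k₀ : ℂ
  k₁ : ℂ
  u₀ : ℂ
  u₁ : ℂ
  rq : ℂ

namespace Param

/-- The deformation parameter; `rq` plays the role of `q^{1/2}`. -/
def q (t : Param) : ℂ := t.rq ^ 2

/-- The Askey-Wilson parameters `a, b, c, d`. -/
def a (t : Param) : ℂ := t.k₁ * t.u₁
def b (t : Param) : ℂ := -(t.k₁ * t.u₁⁻¹)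
def c (t : Param) : ℂ := t.rq * t.k₀ * t.u₀
def d (t : Param) : ℂ := -(t.rq * t.k₀ * t.u₀⁻¹)

/-- The dual multiplicity function: `k₀` and `u₁` are interchanged. -/
def dual (t : Param) : Param where
  k₀ := t.u₁
  k₁ := t.k₁
  u₀ := t.u₀
  u₁ := t.k₀
  rq := t.rq

/-- `ef ∉ q^ℤ` for all `e, f ∈ {a, b, c, d}` (the case `e = f` included). -/
def Separated (t : Param) : Prop :=
  ∀ e ∈ ({t.a, t.b, t.c, t.d} : Set ℂ), ∀ f ∈ ({t.a, t.b, t.c, t.d} : Set ℂ),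
    ∀ n : ℤ, e * f ≠ t.q ^ n

/-- The genericity conditions on the parameters. -/
structure Generic (t : Param) : Prop where
  k₀_ne : t.k₀ ≠ 0
  k₁_ne : t.k₁ ≠ 0
  u₀_ne : t.u₀ ≠ 0
  u₁_ne : t.u₁ ≠ 0
  q_ne : t.q ≠ 0
  q_lt : ‖t.q‖ < 1
  k₀_sq : ∀ n : ℤ, t.k₀ ^ 2 ≠ t.q ^ n ∧ t.k₀ ^ 2 ≠ -t.q ^ n
  k₁_sq : ∀ n : ℤ, t.k₁ ^ 2 ≠ t.q ^ n ∧ t.k₁ ^ 2 ≠ -t.q ^ n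
  u₁_sq : ∀ n : ℤ, t.u₁ ^ 2 ≠ t.q ^ n ∧ t.u₁ ^ 2 ≠ -t.q ^ n
  sep : t.Separated
  sep_dual : t.dual.Separated

end Param

/-! ### Difference-reflection operators on Laurent polynomials -/

/-- Linear extension of a map given on the monomials `x^m`. -/
def linExt (F : ℤ → ℂ[T;T⁻¹]) : ℂ[T;T⁻¹] →ₗ[ℂ] ℂ[T;T⁻¹] :=
  (AddMonoidAlgebra.basis ℤ ℂ).constr ℂ F

lemma linExt_T (F : ℤ → ℂ[T;T⁻¹]) (m : ℤ) : linExt F (T m) = F m := by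
  have h : (T m : ℂ[T;T⁻¹]) = AddMonoidAlgebra.basis ℤ ℂ m := by
    rw [AddMonoidAlgebra.basis_apply]; rfl
  rw [linExt, h, Module.Basis.constr_basis]

/-- The simple reflections: `(s₀ f)(x) = f(q x⁻¹)` and `(s₁ f)(x) = f(x⁻¹)`. -/
def s₀ (t : Param) : ℂ[T;T⁻¹] →ₗ[ℂ] ℂ[T;T⁻¹] := linExt fun m => C (t.q ^ m) * T (-m)
def s₁ : ℂ[T;T⁻¹] →ₗ[ℂ] ℂ[T;T⁻¹] := linExt fun m => T (-m)

/-- The divided difference `f ↦ (f - s₀ f) / (1 - q x⁻²)`, see `divDiff₀_spec`. -/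
def divDiff₀ (t : Param) : ℂ[T;T⁻¹] →ₗ[ℂ] ℂ[T;T⁻¹] := linExt fun m =>
  if 0 ≤ m then ∑ j ∈ Finset.range m.toNat, C (t.q ^ j) * T (m - 2 * j)
  else -∑ j ∈ Finset.range (-m).toNat, C (t.q ^ (m + j)) * T (-m - 2 * j)

/-- The divided difference `f ↦ (f - s₁ f) / (1 - x²)`, see `divDiff₁_spec`. -/
def divDiff₁ : ℂ[T;T⁻¹] →ₗ[ℂ] ℂ[T;T⁻¹] := linExt fun m =>
  if 0 ≤ m then -∑ j ∈ Finset.range m.toNat, T (-m + 2 * j)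
  else ∑ j ∈ Finset.range (-m).toNat, T (m + 2 * j)

lemma ext_T {F G : ℂ[T;T⁻¹] →ₗ[ℂ] ℂ[T;T⁻¹]} (h : ∀ m, F (T m) = G (T m)) : F = G := by
  refine (AddMonoidAlgebra.basis ℤ ℂ).ext fun m => ?_
  rw [AddMonoidAlgebra.basis_apply]
  exact h m

lemma divDiff₁_spec (f : ℂ[T;T⁻¹]) : (1 - T 2) * divDiff₁ f = f - s₁ f := by
  suffices h : (LinearMap.mulLeft ℂ (1 - T 2 : ℂ[T;T⁻¹])).comp divDiff₁ = LinearMap.id - s₁ from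
    congrArg (fun F => F f) h
  refine ext_T fun m => ?_
  have key : ∀ (k : ℤ) (n : ℕ), (1 - T 2 : ℂ[T;T⁻¹]) * ∑ j ∈ Finset.range n, T (k + 2 * j)
      = T k - T (k + 2 * n) := by
    intro k n
    induction n with
    | zero => simp
    | succ n ih =>
      rw [Finset.sum_range_succ, mul_add, ih, sub_mul, one_mul, ← LaurentPolynomial.T_add]
      have : (2 : ℤ) + (k + 2 * n) = k + 2 * ((n + 1 : ℕ) : ℤ) := by push_cast; ring
      rw [this]; ring
  simp only [LinearMap.comp_apply, LinearMap.mulLeft_apply, LinearMap.sub_apply,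
    LinearMap.id_apply, divDiff₁, s₁, linExt_T]
  split_ifs with hm
  · rw [mul_neg, key, Int.toNat_of_nonneg hm]
    have : -m + 2 * m = m := by ring
    rw [this]; ring
  · rw [key, Int.toNat_of_nonneg (by omega)]
    have : m + 2 * -m = -m := by ring
    rw [this]

lemma divDiff₀_spec (t : Param) (hq : t.q ≠ 0) (f : ℂ[T;T⁻¹]) :
    (1 - C t.q * T (-2)) * divDiff₀ t f = f - s₀ t f := by
  suffices h : (LinearMap.mulLeft ℂ (1 - C t.q * T (-2) : ℂ[T;T⁻¹])).comp (divDiff₀ t)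
      = LinearMap.id - s₀ t from congrArg (fun F => F f) h
  refine ext_T fun m => ?_
  have key : ∀ (l k : ℤ) (n : ℕ), (1 - C t.q * T (-2) : ℂ[T;T⁻¹]) *
      ∑ j ∈ Finset.range n, C (t.q ^ (l + j)) * T (k - 2 * j)
      = C (t.q ^ l) * T k - C (t.q ^ (l + n)) * T (k - 2 * n) := by
    intro l k n
    induction n with
    | zero => simp
    | succ n ih =>
      rw [Finset.sum_range_succ, mul_add, ih]
      have e1 : k - 2 * ((n + 1 : ℕ) : ℤ) = -2 + (k - 2 * n) := by push_cast; ring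
      have e2 : t.q ^ (l + ((n + 1 : ℕ) : ℤ)) = t.q * t.q ^ (l + n) := by
        rw [← zpow_one_add₀ hq]; congr 1; push_cast; ring
      rw [e1, e2, LaurentPolynomial.T_add, map_mul]
      ring
  simp only [LinearMap.comp_apply, LinearMap.mulLeft_apply, LinearMap.sub_apply,
    LinearMap.id_apply, divDiff₀, s₀, linExt_T]
  split_ifs with hm
  · have := key 0 m m.toNat
    simp only [zero_add, zpow_natCast, zpow_zero, map_one, one_mul] at this
    rw [this, ← zpow_natCast, Int.toNat_of_nonneg hm]
    have : m - 2 * m = -m := by ring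
    rw [this]
  · rw [mul_neg, key, Int.toNat_of_nonneg (by omega)]
    have : -m - 2 * -m = m := by ring
    rw [this, add_neg_cancel]
    simp

/-- `T₀ = k₀ s₀ + ((k₀ - k₀⁻¹) + (u₀ - u₀⁻¹) q^{1/2} x⁻¹) (1 - q x⁻²)⁻¹ (id - s₀)`. -/
def T₀ (t : Param) : ℂ[T;T⁻¹] →ₗ[ℂ] ℂ[T;T⁻¹] :=
  t.k₀ • s₀ t + (LinearMap.mulLeft ℂ
    (C (t.k₀ - t.k₀⁻¹) + C ((t.u₀ - t.u₀⁻¹) * t.rq) * T (-1))).comp (divDiff₀ t)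

/-- `T₁ = k₁ s₁ + ((k₁ - k₁⁻¹) + (u₁ - u₁⁻¹) x) (1 - x²)⁻¹ (id - s₁)`. -/
def T₁ (t : Param) : ℂ[T;T⁻¹] →ₗ[ℂ] ℂ[T;T⁻¹] :=
  t.k₁ • s₁ + (LinearMap.mulLeft ℂ
    (C (t.k₁ - t.k₁⁻¹) + C (t.u₁ - t.u₁⁻¹) * T 1)).comp divDiff₁

/-- The Cherednik-Dunkl operator `Y = T₁ T₀`. -/
def Y (t : Param) : ℂ[T;T⁻¹] →ₗ[ℂ] ℂ[T;T⁻¹] := (T₁ t).comp (T₀ t)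

/-! ### Non-symmetric and symmetric Askey-Wilson polynomials -/

/-- The position of `x^m` in the total order `1 ≺ x⁻¹ ≺ x ≺ x⁻² ≺ x² ≺ ⋯`. -/
def rank (m : ℤ) : ℤ := if 0 ≤ m then 2 * m else -2 * m - 1

/-- `P = x^m +` lower order terms with respect to `≺`. -/
def IsMonicOfDegree (m : ℤ) (P : ℂ[T;T⁻¹]) : Prop :=
  P - T m ∈ Submodule.span ℂ (T '' {n : ℤ | rank n < rank m})

/-- `ε(m) = 1` for `m ≥ 0` and `ε(m) = -1` for `m < 0`. -/
def eps (m : ℤ) : ℤ := if 0 ≤ m then 1 else -1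

/-- The spectral points `γ_m = k₀^{ε(m)} k₁^{ε(m)} q^m`, the eigenvalues of `Y`. -/
def spec (t : Param) (m : ℤ) : ℂ := t.k₀ ^ eps m * t.k₁ ^ eps m * t.q ^ m

/-- `P` is a monic non-symmetric Askey-Wilson polynomial of degree `m`. -/
def IsNonsym (t : Param) (m : ℤ) (P : ℂ[T;T⁻¹]) : Prop :=
  IsMonicOfDegree m P ∧ Y t P = spec t m • P

/-- The monic non-symmetric Askey-Wilson polynomial `P_m` (unique for generic parameters). -/
def nonsym (t : Param) (m : ℤ) : ℂ[T;T⁻¹] := Classical.epsilon (IsNonsym t m)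

/-- The idempotent `C₊ = (1 + k₁²)⁻¹ (1 + k₁ T₁)`. -/
def Cplus (t : Param) : ℂ[T;T⁻¹] →ₗ[ℂ] ℂ[T;T⁻¹] :=
  (1 + t.k₁ ^ 2)⁻¹ • (LinearMap.id + t.k₁ • T₁ t)

/-- `A₊(m) = C₊ (span {P_m, P_{-m}})`. -/
def Aplus (t : Param) (m : ℕ) : Submodule ℂ ℂ[T;T⁻¹] :=
  (Submodule.span ℂ {nonsym t m, nonsym t (-m)}).map (Cplus t)

/-- The monic symmetric Askey-Wilson polynomial `P_m⁺`: the element of `A₊(m)` of the form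
`x^m +` lower order terms (unique for generic parameters). -/
def sym (t : Param) (m : ℕ) : ℂ[T;T⁻¹] :=
  Classical.epsilon fun P => P ∈ Aplus t m ∧ IsMonicOfDegree m P

/-- The value of a Laurent polynomial at a point. -/
def evalAt (f : ℂ[T;T⁻¹]) (x : ℂ) : ℂ := f.coeff.sum fun n c => c * x ^ n

/-- The normalization point `x₀ = k₁ u₁`. -/
def x₀ (t : Param) : ℂ := t.k₁ * t.u₁

/-- The renormalized symmetric Askey-Wilson polynomial `E⁺_{s(γ_m)} = P_m⁺ / P_m⁺(x₀)`. -/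
def symE (t : Param) (m : ℕ) : ℂ[T;T⁻¹] := (evalAt (sym t m) (x₀ t))⁻¹ • sym t m

/-- `s(γ) = γ + γ⁻¹` satisfies `s(γ_{-m}) = s(γ_m)`. Hence for every integer `m` the symmetric
polynomial labelled by `s(γ_m)` is `symE t |m|`. -/
lemma spec_add_inv (t : Param) (m : ℤ) :
    spec t m + (spec t m)⁻¹ = spec t m.natAbs + (spec t m.natAbs)⁻¹ := by
  rcases le_or_gt 0 m with h | h
  · rw [Int.natAbs_of_nonneg h]
  · have e : (m.natAbs : ℤ) = -m := by omega
    have h1 : ¬ 0 ≤ m := by omega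
    have h2 : 0 ≤ -m := by omega
    rw [e]
    simp only [spec, eps, h1, h2, if_true, if_false, zpow_neg, zpow_one, mul_inv, inv_inv]
    ring

/-! ### The weight function and the bilinear form -/

/-- The infinite `q`-shifted factorial `(z; q)_∞`. -/
def qPoch (q z : ℂ) : ℂ := ∏' k : ℕ, (1 - z * q ^ k)

/-- `Δ₊(x) = (x², x⁻²; q)_∞ / (ax, ax⁻¹, bx, bx⁻¹, cx, cx⁻¹, dx, dx⁻¹; q)_∞`. -/
def weightPlus (t : Param) (x : ℂ) : ℂ :=
  qPoch t.q (x ^ 2) * qPoch t.q (x⁻¹ ^ 2) /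
    (qPoch t.q (t.a * x) * qPoch t.q (t.a * x⁻¹) * qPoch t.q (t.b * x) * qPoch t.q (t.b * x⁻¹) *
      qPoch t.q (t.c * x) * qPoch t.q (t.c * x⁻¹) * qPoch t.q (t.d * x) * qPoch t.q (t.d * x⁻¹))

/-- `(2πi)⁻¹ ∫_Γ f(x) dx` for a closed curve `Γ` parametrized by `[0, 1]`. -/
def contourIntegral (Γ : ℝ → ℂ) (f : ℂ → ℂ) : ℂ :=
  (2 * Real.pi * Complex.I)⁻¹ * ∫ s in (0 : ℝ)..1, f (Γ s) * deriv Γ s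

/-- The image of the curve. -/
def trace (Γ : ℝ → ℂ) : Set ℂ := Γ '' Set.Icc 0 1

/-- A rectifiable Jordan curve, given by a Lipschitz parametrization (such as the one with
constant speed). -/
structure IsRectifiableJordan (Γ : ℝ → ℂ) : Prop where
  lipschitz : ∃ K, LipschitzOnWith K Γ (Set.Icc 0 1)
  closed : Γ 0 = Γ 1
  injOn : Set.InjOn Γ (Set.Ico 0 1)

/-- The interior: the points in the bounded component of the complement of the curve. -/
def inside (Γ : ℝ → ℂ) : Set ℂ :=
  {z | z ∉ trace Γ ∧ Bornology.IsBounded (connectedComponentIn (trace Γ)ᶜ z)}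

/-- The exterior: the points in the unbounded component of the complement of the curve. -/
def outside (Γ : ℝ → ℂ) : Set ℂ :=
  {z | z ∉ trace Γ ∧ ¬ Bornology.IsBounded (connectedComponentIn (trace Γ)ᶜ z)}

/-- Counterclockwise orientation: winding number one around the points of the interior. -/
def IsCounterclockwise (Γ : ℝ → ℂ) : Prop :=
  ∀ z ∈ inside Γ, contourIntegral Γ (fun x => (x - z)⁻¹) = 1

/-- The contours used in the bilinear form. -/
structure IsAdmissible (t : Param) (Γ : ℝ → ℂ) : Prop where
  jordan : IsRectifiableJordan Γ
  ccw : IsCounterclockwise Γ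
  zero_notMem : (0 : ℂ) ∉ trace Γ
  inside_mem : ∀ e ∈ ({t.a, t.b, t.c, t.d} : Set ℂ), ∀ k : ℕ, e * t.q ^ k ∈ inside Γ
  outside_mem : ∀ e ∈ ({t.a, t.b, t.c, t.d} : Set ℂ), ∀ k : ℕ, (e * t.q ^ k)⁻¹ ∈ outside Γ

/-- The bilinear form `(f, g) = (2πi)⁻¹ ∫_Γ f(x) g(x⁻¹) Δ₊(x) dx/x`. -/
def pairing (t : Param) (Γ : ℝ → ℂ) (f g : ℂ[T;T⁻¹]) : ℂ :=
  contourIntegral Γ fun x => evalAt f x * evalAt g x⁻¹ * weightPlus t x / x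

/-! ### Residues and the dual weights -/

/-- The residue at an isolated singularity `z`: the value of `(2πi)⁻¹ ∮_{|y - z| = r} f(y) dy`
for all small `r > 0`. -/
def residue (f : ℂ → ℂ) (z : ℂ) : ℂ :=
  Filter.limUnder (nhdsWithin (0 : ℝ) (Set.Ioi 0)) fun r : ℝ =>
    (2 * Real.pi * Complex.I)⁻¹ * ∮ y in C(z, r), f y

open scoped Classical in
/-- The sign on the inverse spectrum: `sgn(γ_m⁻¹) = ε(m)`. -/
def sgn (t : Param) (γ : ℂ) : ℂ := if ∃ m : ℕ, γ = (spec t m)⁻¹ then 1 else -1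

/-- The dual weight `w₊(γ) = Res_{y = γ} (Δ₊(y; dual parameters) / y) · sgn(γ)`, for `γ` in the
inverse spectrum `{γ_m⁻¹}`. -/
def wPlus (t : Param) (γ : ℂ) : ℂ :=
  residue (fun y => weightPlus t.dual y / y) γ * sgn t γ

end

end AskeyWilson

open scoped LaurentPolynomial

namespace AskeyWilson

open LaurentPolynomial (T C)
open Set Filter Topology MeasureTheory

/-! The proof computes both sides explicitly and compares them; no orthogonality or duality theorem
is presupposed.

The polynomials. The quadratic relations of `T₀` and `T₁` make `Y + Y⁻¹` (`centralOp`) commute with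
`T₁`, so it acts on `P_m⁺` by `γ_m + γ_m⁻¹`. Since `T₁ P = k₁ P` forces `P` to be invariant under `x
↦ x⁻¹`, this becomes the Askey-Wilson second order `q`-difference equation (`evalLin_sym_eigen`),
with `κ = (k₀ k₁)² = abcd / q`. On `φ_j = (ax, a/x; q)_j` the operator is bidiagonal, so `P_m⁺ = ∑
A_j φ_j` with a two-term recurrence for `A_j` (`exists_expansion`). At `x₀ = a` only `φ_0` survives,
hence `P_m⁺(x₀) = A_0`, and the recurrence together with the nonzero leading coefficient gives `A_0
≠ 0`. Exchanging `a` and `b` gives a second expansion, in `ψ_k = (bx, b/x; q)_k`.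

The functional. The integrand is treated as a uniform limit of rational functions, whose integrals
depend only on winding numbers around the poles. This permits replacing `Γ` by `qΓ` in a suitable
integral, which yields the first moment (`awInt_first_moment`). Replacing `a` by `aq` inserts the
factor `(1 - ax)(1 - a/x)` into the integrand, so the first moment becomes a contiguous relation for
the total mass (`awMass_mul`), and every mixed moment of `φ_i ψ_k` is a total mass with shifted
parameters. The contiguous relation also shows that the suitably normalized mass does not depend on
the parameters (`awRatio_eq`); one choice of parameters with an elementary integral shows that it is
not zero.

The norm. The moments satisfy the self-adjointness relation of the Askey-Wilson operator
(`moment_adjoint`), so `I_k = (P, ψ_k)` vanishes for `k < m` and `(P, P) = B_m I_m`. To find `I_m`,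
observe that `I_k` is an explicit factor times `N(q^k)`, where `N` is a polynomial of degree at most
`m`. Its zeros `1, q, …, q^(m-1)` and its value at `(ab)⁻¹` determine it
(`exists_polynomial_moment`, `awInt_sq`). The result is `awNorm`.

The weights. The pole of the dual weight at `γ_0⁻¹` comes from one vanishing factor; dilation by `q`
carries it to all `γ_m⁻¹` with `m ≥ 0`, multiplying the residue by an explicit ratio. After
interchanging `k₀` and `u₁`, this ratio is the inverse of the ratio of consecutive `awNorm`s
(`dualResidue_mul_awNorm`). Negative `m` follows from the symmetry of the weight under inversion,
the sign `ε` absorbing the change of orientation (`wPlus_spec`). -/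

/-- A closed Lipschitz curve parametrized by `[0, 1]`. -/
structure IsClosedLipschitz (Γ : ℝ → ℂ) : Prop where
  lipschitz : ∃ K, LipschitzOnWith K Γ (Icc 0 1)
  closed : Γ 0 = Γ 1

/-! ### Contour integrals along closed Lipschitz curves -/

lemma norm_deriv_le_of_lipschitzOn_Icc {f : ℝ → ℂ} {K : NNReal}
    (hf : LipschitzOnWith K f (Icc 0 1)) {s : ℝ} (hs : s ∈ Ioo (0 : ℝ) 1) : ‖deriv f s‖ ≤ K :=
  norm_deriv_le_of_lipschitzOn (Icc_mem_nhds hs.1 hs.2) hf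

lemma ae_differentiableAt_of_lipschitzOn_Icc {f : ℝ → ℂ} {K : NNReal}
    (hf : LipschitzOnWith K f (Icc 0 1)) : ∀ᵐ s, s ∈ Ioo (0 : ℝ) 1 → DifferentiableAt ℝ f s := by
  filter_upwards [hf.ae_differentiableWithinAt_of_mem_real] with s h hs
  exact (h (Ioo_subset_Icc_self hs)).differentiableAt (Icc_mem_nhds hs.1 hs.2)

lemma ae_mem_Ioo_of_mem_uIoc : ∀ᵐ s : ℝ, s ∈ Set.uIoc (0 : ℝ) 1 → s ∈ Ioo (0 : ℝ) 1 := by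
  filter_upwards [compl_mem_ae_iff.mpr (measure_singleton (1 : ℝ))] with s h hs
  rw [uIoc_of_le zero_le_one] at hs
  exact ⟨hs.1, lt_of_le_of_ne hs.2 h⟩

lemma intervalIntegrable_mul_deriv {f g : ℝ → ℂ} {K : NNReal}
    (hf : LipschitzOnWith K f (Icc 0 1)) (hg : ContinuousOn g (Icc 0 1)) :
    IntervalIntegrable (fun s => g s * deriv f s) volume 0 1 := by
  have hd : IntervalIntegrable (deriv f) volume 0 1 := by
    refine (intervalIntegrable_const (c := (K : ℝ))).mono_fun
      (measurable_deriv f).aestronglyMeasurable ?_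
    filter_upwards [ae_restrict_of_ae ae_mem_Ioo_of_mem_uIoc,
      ae_restrict_mem measurableSet_uIoc] with s h hs
    simpa using norm_deriv_le_of_lipschitzOn_Icc hf (h hs)
  refine hd.continuousOn_mul ?_
  rwa [uIcc_of_le zero_le_one]

/-- The fundamental theorem of calculus for complex valued Lipschitz functions. -/
lemma integral_deriv_eq_sub_of_lipschitzOn {f : ℝ → ℂ} {K : NNReal}
    (hf : LipschitzOnWith K f (Icc 0 1)) : ∫ s in (0 : ℝ)..1, deriv f s = f 1 - f 0 := by
  have hi : IntervalIntegrable (deriv f) volume 0 1 := by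
    simpa using intervalIntegrable_mul_deriv hf (g := fun _ => 1) continuousOn_const
  have hsub : ∀ x ∈ Icc (0 : ℝ) 1, ∀ y ∈ Icc (0 : ℝ) 1,
      IntervalIntegrable (deriv f) volume x y := by
    intro x hx y hy
    refine hi.mono_set ?_
    rw [uIcc_of_le zero_le_one]
    exact uIcc_subset_Icc hx hy
  set F : ℝ → ℂ := fun x => ∫ s in (0 : ℝ)..x, deriv f s with hF
  have hFL : LipschitzOnWith K F (Icc 0 1) := by
    refine LipschitzOnWith.of_dist_le_mul fun x hx y hy => ?_
    have h0 : (0 : ℝ) ∈ Icc (0 : ℝ) 1 := by simp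
    rw [dist_comm, dist_eq_norm, hF]
    simp only
    rw [intervalIntegral.integral_interval_sub_left (hsub 0 h0 y hy) (hsub 0 h0 x hx),
      dist_comm, Real.dist_eq]
    refine intervalIntegral.norm_integral_le_of_norm_le_const_ae ?_
    filter_upwards [ae_mem_Ioo_of_mem_uIoc] with s hs hs'
    refine norm_deriv_le_of_lipschitzOn_Icc hf (hs ?_)
    rw [uIoc_of_le zero_le_one]
    rcases le_total x y with hxy | hxy
    · rw [uIoc_of_le hxy] at hs'
      exact ⟨hx.1.trans_lt hs'.1, hs'.2.trans hy.2⟩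
    · rw [uIoc_of_ge hxy] at hs'
      exact ⟨hy.1.trans_lt hs'.1, hs'.2.trans hx.2⟩
  -- `f - F` is absolutely continuous with derivative zero almost everywhere, hence constant;
  -- comparing the values at `0` and `1` gives the claim.
  have hG : LipschitzOnWith (K + K) (fun x => f x - F x) (uIcc 0 1) := by
    rw [uIcc_of_le zero_le_one]; exact hf.sub hFL
  obtain ⟨c, hc⟩ := hG.absolutelyContinuousOnInterval.const_of_ae_hasDerivAt_zero (by
    filter_upwards [ae_differentiableAt_of_lipschitzOn_Icc hf,
      hi.ae_hasDerivAt_integral, compl_mem_ae_iff.mpr (measure_singleton (1 : ℝ)),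
      compl_mem_ae_iff.mpr (measure_singleton (0 : ℝ))] with s h1 h2 h3 h4 hs
    have hs' : s ∈ Ioo (0 : ℝ) 1 := by
      rw [uIcc_of_le zero_le_one] at hs
      exact ⟨lt_of_le_of_ne hs.1 (Ne.symm h4), lt_of_le_of_ne hs.2 h3⟩
    have := (h1 hs').hasDerivAt.sub (h2 hs 0 (by simp))
    rwa [sub_self] at this)
  have e0 := hc 0 (by simp)
  have e1 := hc 1 (by simp)
  simp only [hF, intervalIntegral.integral_same] at e0 e1
  linear_combination e0 - e1

lemma isCompact_trace {Γ : ℝ → ℂ} (h : IsClosedLipschitz Γ) : IsCompact (trace Γ) :=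
  isCompact_Icc.image_of_continuousOn h.lipschitz.choose_spec.continuousOn

lemma isOpen_compl_trace {Γ : ℝ → ℂ} (h : IsClosedLipschitz Γ) : IsOpen (trace Γ)ᶜ :=
  (isCompact_trace h).isClosed.isOpen_compl

lemma mem_trace {Γ : ℝ → ℂ} {s : ℝ} (hs : s ∈ Icc (0 : ℝ) 1) : Γ s ∈ trace Γ := ⟨s, hs, rfl⟩

lemma continuousOn_comp_curve {Γ : ℝ → ℂ} (h : IsClosedLipschitz Γ) {f : ℂ → ℂ}
    (hf : ContinuousOn f (trace Γ)) : ContinuousOn (fun s => f (Γ s)) (Icc 0 1) :=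
  hf.comp h.lipschitz.choose_spec.continuousOn fun _ hs => mem_trace hs

lemma contourIntegral_integrable {Γ : ℝ → ℂ} (h : IsClosedLipschitz Γ) {f : ℂ → ℂ}
    (hf : ContinuousOn f (trace Γ)) :
    IntervalIntegrable (fun s => f (Γ s) * deriv Γ s) volume 0 1 :=
  intervalIntegrable_mul_deriv h.lipschitz.choose_spec (continuousOn_comp_curve h hf)

lemma contourIntegral_add {Γ : ℝ → ℂ} (h : IsClosedLipschitz Γ) {f g : ℂ → ℂ}
    (hf : ContinuousOn f (trace Γ)) (hg : ContinuousOn g (trace Γ)) :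
    contourIntegral Γ (fun x => f x + g x) = contourIntegral Γ f + contourIntegral Γ g := by
  simp only [contourIntegral, add_mul]
  rw [intervalIntegral.integral_add (contourIntegral_integrable h hf)
    (contourIntegral_integrable h hg), mul_add]

lemma contourIntegral_const_mul (Γ : ℝ → ℂ) (c : ℂ) (f : ℂ → ℂ) :
    contourIntegral Γ (fun x => c * f x) = c * contourIntegral Γ f := by
  simp only [contourIntegral, mul_assoc, intervalIntegral.integral_const_mul]
  ring

lemma contourIntegral_congr {Γ : ℝ → ℂ} {f g : ℂ → ℂ} (hfg : EqOn f g (trace Γ)) :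
    contourIntegral Γ f = contourIntegral Γ g := by
  simp only [contourIntegral]
  congr 1
  refine intervalIntegral.integral_congr fun s hs => ?_
  rw [uIcc_of_le zero_le_one] at hs
  simp only [hfg (mem_trace hs)]

lemma contourIntegral_sum {Γ : ℝ → ℂ} (h : IsClosedLipschitz Γ) {ι : Type*} (s : Finset ι)
    {f : ι → ℂ → ℂ} (hf : ∀ i ∈ s, ContinuousOn (f i) (trace Γ)) :
    contourIntegral Γ (fun x => ∑ i ∈ s, f i x) = ∑ i ∈ s, contourIntegral Γ (f i) := by
  classical
  induction s using Finset.induction_on with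
  | empty => simp [contourIntegral]
  | insert a s ha ih =>
    simp only [Finset.sum_insert ha]
    rw [contourIntegral_add h (hf a (by simp))
      (continuousOn_finsetSum _ fun i hi => hf i (by simp [hi])),
      ih fun i hi => hf i (by simp [hi])]

/-- The integral of a bound over a curve. -/
lemma norm_contourIntegral_le {Γ : ℝ → ℂ} {K : NNReal} (h : LipschitzOnWith K Γ (Icc 0 1))
    {f : ℂ → ℂ} {M : ℝ} (hf : ∀ x ∈ trace Γ, ‖f x‖ ≤ M) :
    ‖contourIntegral Γ f‖ ≤ M * K := by
  have hM : 0 ≤ M := (norm_nonneg _).trans (hf (Γ 0) (mem_trace (by simp)))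
  rw [contourIntegral, norm_mul]
  have h1 : ‖∫ s in (0 : ℝ)..1, f (Γ s) * deriv Γ s‖ ≤ M * K * |1 - 0| := by
    refine intervalIntegral.norm_integral_le_of_norm_le_const_ae ?_
    filter_upwards [ae_mem_Ioo_of_mem_uIoc] with s hs hs'
    rw [norm_mul]
    exact mul_le_mul (hf _ (mem_trace (Ioo_subset_Icc_self (hs hs'))))
      (norm_deriv_le_of_lipschitzOn_Icc h (hs hs')) (norm_nonneg _) hM
  have h2 : ‖(2 * (Real.pi : ℂ) * Complex.I)⁻¹‖ ≤ 1 := by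
    rw [norm_inv]
    refine inv_le_one_of_one_le₀ ?_
    simp only [norm_mul, Complex.norm_ofNat, Complex.norm_real, Complex.norm_I, mul_one,
      Real.norm_eq_abs, abs_of_pos Real.pi_pos]
    linarith [Real.pi_gt_three]
  calc _ ≤ 1 * (M * K * |1 - 0|) := mul_le_mul h2 h1 (norm_nonneg _) zero_le_one
    _ = M * K := by simp

/-- A primitive on a neighbourhood of a closed curve makes the contour integral vanish. -/
lemma contourIntegral_deriv_eq_zero {Γ : ℝ → ℂ} (h : IsClosedLipschitz Γ) {F : ℂ → ℂ}
    (hF : ∀ x ∈ trace Γ, AnalyticAt ℂ F x) : contourIntegral Γ (deriv F) = 0 := by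
  obtain ⟨K, hK⟩ := h.lipschitz
  -- Compactness of the trace upgrades the local Lipschitz bounds to a global one, so `F ∘ Γ` is
  -- again a closed Lipschitz curve and the fundamental theorem applies to it.
  have hloc : LocallyLipschitzOn (trace Γ) F := fun x hx => by
    obtain ⟨K', t, ht, hK'⟩ := ((hF x hx).contDiffAt (n := 1)).exists_lipschitzOnWith
    exact ⟨K', t, mem_nhdsWithin_of_mem_nhds ht, hK'⟩
  obtain ⟨K', hK'⟩ := hloc.exists_lipschitzOnWith_of_compact (isCompact_trace h)
  have hL : LipschitzOnWith (K' * K) (fun s => F (Γ s)) (Icc 0 1) :=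
    hK'.comp hK fun s hs => mem_trace hs
  have := integral_deriv_eq_sub_of_lipschitzOn hL
  rw [h.closed, sub_self] at this
  rw [contourIntegral, ← mul_zero (2 * (Real.pi : ℂ) * Complex.I)⁻¹, ← this]
  congr 1
  refine intervalIntegral.integral_congr_ae ?_
  filter_upwards [ae_mem_Ioo_of_mem_uIoc, ae_differentiableAt_of_lipschitzOn_Icc hK]
    with s hs hd hs'
  have := (hF _ (mem_trace (Ioo_subset_Icc_self (hs hs')))).differentiableAt.hasDerivAt.comp_of_eq s
    (hd (hs hs')).hasDerivAt rfl
  exact this.deriv.symm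

lemma contourIntegral_eq_zero_of_primitive {Γ : ℝ → ℂ} (h : IsClosedLipschitz Γ) {f F : ℂ → ℂ}
    (hF : ∀ x ∈ trace Γ, AnalyticAt ℂ F x) (hf : ∀ x ∈ trace Γ, deriv F x = f x) :
    contourIntegral Γ f = 0 := by
  rw [← contourIntegral_deriv_eq_zero h hF]
  exact contourIntegral_congr fun x hx => (hf x hx).symm

/-! ### Winding numbers -/

/-- The winding number of a closed curve around a point. -/
noncomputable def winding (Γ : ℝ → ℂ) (z : ℂ) : ℂ := contourIntegral Γ fun x => (x - z)⁻¹

lemma continuousOn_inv_sub {K : Set ℂ} {z : ℂ} (hz : z ∉ K) :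
    ContinuousOn (fun x => (x - z)⁻¹) K :=
  (continuousOn_id.sub continuousOn_const).inv₀ fun x hx h => hz (by
    have : x = z := sub_eq_zero.mp h
    rwa [← this])

/-- The difference of the two integrands has the primitive `log ((x - w) / (x - z))`. The bound
keeps the quotient in the open unit disc around `1`, where the principal logarithm is analytic. -/
lemma winding_eq_of_near {Γ : ℝ → ℂ} (h : IsClosedLipschitz Γ) {z w : ℂ} (hz : z ∉ trace Γ)
    (hw : w ∉ trace Γ) (hzw : ∀ x ∈ trace Γ, ‖w - z‖ < ‖x - z‖) : winding Γ w = winding Γ z := by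
  have hx0 : ∀ x ∈ trace Γ, x - z ≠ 0 := fun x hx h0 => hz (by rwa [← sub_eq_zero.mp h0])
  have hxw : ∀ x ∈ trace Γ, x - w ≠ 0 := fun x hx h0 => hw (by rwa [← sub_eq_zero.mp h0])
  have key : contourIntegral Γ (fun x => (x - w)⁻¹ + (-1) * (x - z)⁻¹) = 0 := by
    have hs : ∀ x ∈ trace Γ, (x - w) / (x - z) ∈ Complex.slitPlane := by
      intro x hx
      have : (x - w) / (x - z) = 1 + -((w - z) / (x - z)) := by
        field_simp [hx0 x hx]; ring
      rw [this]
      refine Complex.mem_slitPlane_of_norm_lt_one ?_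
      rw [norm_neg, norm_div, div_lt_one (norm_pos_iff.mpr (hx0 x hx))]
      exact hzw x hx
    refine contourIntegral_eq_zero_of_primitive h
      (F := fun x => Complex.log ((x - w) / (x - z))) (fun x hx => ?_) (fun x hx => ?_)
    · exact ((analyticAt_id.sub analyticAt_const).div (analyticAt_id.sub analyticAt_const)
        (hx0 x hx)).clog (hs x hx)
    · have := ((((hasDerivAt_id x).sub_const w).div ((hasDerivAt_id x).sub_const z)
        (hx0 x hx)).clog (hs x hx)).deriv
      refine this.trans ?_
      have h1 := hx0 x hx
      have h2 := hxw x hx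
      simp only [id, Pi.div_apply]
      field_simp
      ring
  rw [contourIntegral_add h (g := fun x => (-1) * (x - z)⁻¹) (continuousOn_inv_sub hw)
    (continuousOn_const.mul (continuousOn_inv_sub hz)), contourIntegral_const_mul] at key
  simp only [winding]
  linear_combination key

lemma eventually_winding_eq {Γ : ℝ → ℂ} (h : IsClosedLipschitz Γ) {z : ℂ} (hz : z ∉ trace Γ) :
    ∀ᶠ w in 𝓝 z, w ∉ trace Γ ∧ winding Γ w = winding Γ z := by
  obtain ⟨r, hr, hb⟩ := Metric.isOpen_iff.mp (isOpen_compl_trace h) z hz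
  filter_upwards [Metric.ball_mem_nhds z hr] with w hw
  refine ⟨hb hw, winding_eq_of_near h hz (hb hw) fun x hx => ?_⟩
  by_contra hlt
  refine hb (a := x) ?_ hx
  rw [Metric.mem_ball, dist_eq_norm] at hw ⊢
  exact (not_lt.mp hlt).trans_lt hw

/-- A locally constant function is constant on a connected component. Integrality of winding numbers
plays no role. -/
lemma winding_eq_of_mem_component {Γ : ℝ → ℂ} (h : IsClosedLipschitz Γ) {z w : ℂ}
    (hz : z ∉ trace Γ) (hw : w ∈ connectedComponentIn (trace Γ)ᶜ z) :
    winding Γ w = winding Γ z := by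
  have hsub := connectedComponentIn_subset (trace Γ)ᶜ z
  set U : Set ℂ := {v | v ∉ trace Γ ∧ winding Γ v = winding Γ z}
  set V : Set ℂ := {v | v ∉ trace Γ ∧ winding Γ v ≠ winding Γ z}
  have hU : IsOpen U := isOpen_iff_mem_nhds.mpr fun v hv => by
    filter_upwards [eventually_winding_eq h hv.1] with v' hv'
    exact ⟨hv'.1, hv'.2.trans hv.2⟩
  have hV : IsOpen V := isOpen_iff_mem_nhds.mpr fun v hv => by
    filter_upwards [eventually_winding_eq h hv.1] with v' hv'
    exact ⟨hv'.1, fun h' => hv.2 (hv'.2.symm.trans h')⟩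
  refine (isPreconnected_connectedComponentIn.subset_left_of_subset_union hU hV
    (disjoint_left.mpr fun v h1 h2 => h2.2 h1.2) (fun v hv => ?_)
    ⟨z, mem_connectedComponentIn hz, hz, rfl⟩ hw).2
  by_cases h' : winding Γ v = winding Γ z
  · exact Or.inl ⟨hsub hv, h'⟩
  · exact Or.inr ⟨hsub hv, h'⟩

/-- Here `log (1 - x / z)` is a primitive along the whole curve. -/
lemma winding_eq_zero_of_norm_lt {Γ : ℝ → ℂ} (h : IsClosedLipschitz Γ) {z : ℂ}
    (hz : ∀ x ∈ trace Γ, ‖x‖ < ‖z‖) : winding Γ z = 0 := by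
  have hz0 : z ≠ 0 := norm_pos_iff.mp ((norm_nonneg _).trans_lt (hz (Γ 0) (mem_trace (by simp))))
  have hs : ∀ x ∈ trace Γ, 1 + -(x / z) ∈ Complex.slitPlane := fun x hx => by
    refine Complex.mem_slitPlane_of_norm_lt_one ?_
    rw [norm_neg, norm_div, div_lt_one (norm_pos_iff.mpr hz0)]
    exact hz x hx
  refine contourIntegral_eq_zero_of_primitive h
    (F := fun x => Complex.log (1 + -(x / z))) (fun x hx => ?_) (fun x hx => ?_)
  · exact (analyticAt_const.add (analyticAt_id.div analyticAt_const hz0).neg).clog (hs x hx)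
  · have := ((((hasDerivAt_id x).div_const z).neg.const_add 1).clog (hs x hx)).deriv
    refine this.trans ?_
    have h2 : x - z ≠ 0 := fun h0 => (hz x hx).ne (by rw [sub_eq_zero.mp h0])
    have h3 : z - x ≠ 0 := fun h0 => h2 (by linear_combination -h0)
    have h4 : 1 + -(x / z) = (z - x) / z := by field_simp; ring
    simp only [Pi.neg_apply, id, h4]
    field_simp
    ring

/-- An unbounded component contains points farther from the origin than the entire curve. -/
lemma winding_outside {Γ : ℝ → ℂ} (h : IsClosedLipschitz Γ) {z : ℂ} (hz : z ∈ outside Γ) :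
    winding Γ z = 0 := by
  obtain ⟨R, hR⟩ := (isCompact_trace h).isBounded.exists_norm_le
  have hex : ∃ w ∈ connectedComponentIn (trace Γ)ᶜ z, R < ‖w‖ := by
    by_contra! hcon
    exact hz.2 ((Metric.isBounded_closedBall (x := (0 : ℂ)) (r := R)).subset fun w hw => by
      simpa using hcon w hw)
  obtain ⟨w, hw, hRw⟩ := hex
  rw [← winding_eq_of_mem_component h hz.1 hw]
  exact winding_eq_zero_of_norm_lt h fun x hx => (hR x hx).trans_lt hRw

/-! ### Integrals determined by winding numbers -/

/-- Two closed curves avoid the set `S` and wind equally often around its points. -/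
structure SameWinding (S : Set ℂ) (Γ₁ Γ₂ : ℝ → ℂ) : Prop where
  left : IsClosedLipschitz Γ₁
  right : IsClosedLipschitz Γ₂
  left_notMem : ∀ p ∈ S, p ∉ trace Γ₁
  right_notMem : ∀ p ∈ S, p ∉ trace Γ₂
  winding_eq : ∀ p ∈ S, winding Γ₁ p = winding Γ₂ p

/-- The function `f` has the same contour integral over both curves. -/
def SameIntegral (Γ₁ Γ₂ : ℝ → ℂ) (f : ℂ → ℂ) : Prop :=
  ContinuousOn f (trace Γ₁ ∪ trace Γ₂) ∧ contourIntegral Γ₁ f = contourIntegral Γ₂ f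

namespace SameWinding

variable {S : Set ℂ} {Γ₁ Γ₂ : ℝ → ℂ}

lemma notMem (h : SameWinding S Γ₁ Γ₂) {p : ℂ} (hp : p ∈ S) : p ∉ trace Γ₁ ∪ trace Γ₂ :=
  fun h' => h'.elim (h.left_notMem p hp) (h.right_notMem p hp)

lemma sub_ne (h : SameWinding S Γ₁ Γ₂) {p x : ℂ} (hp : p ∈ S) (hx : x ∈ trace Γ₁ ∪ trace Γ₂) :
    x - p ≠ 0 := fun h0 => h.notMem hp (by rwa [← sub_eq_zero.mp h0])

lemma sameIntegral_add (h : SameWinding S Γ₁ Γ₂) {f g : ℂ → ℂ} (hf : SameIntegral Γ₁ Γ₂ f)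
    (hg : SameIntegral Γ₁ Γ₂ g) : SameIntegral Γ₁ Γ₂ (fun x => f x + g x) := by
  refine ⟨hf.1.add hg.1, ?_⟩
  rw [contourIntegral_add h.left (hf.1.mono subset_union_left) (hg.1.mono subset_union_left),
    contourIntegral_add h.right (hf.1.mono subset_union_right) (hg.1.mono subset_union_right),
    hf.2, hg.2]

lemma sameIntegral_const_mul (c : ℂ) {f : ℂ → ℂ} (hf : SameIntegral Γ₁ Γ₂ f) :
    SameIntegral Γ₁ Γ₂ (fun x => c * f x) :=
  ⟨continuousOn_const.mul hf.1, by rw [contourIntegral_const_mul, contourIntegral_const_mul, hf.2]⟩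

lemma sameIntegral_congr {f g : ℂ → ℂ} (hf : SameIntegral Γ₁ Γ₂ f)
    (hfg : EqOn g f (trace Γ₁ ∪ trace Γ₂)) : SameIntegral Γ₁ Γ₂ g := by
  refine ⟨hf.1.congr hfg, ?_⟩
  rw [contourIntegral_congr (hfg.mono subset_union_left),
    contourIntegral_congr (hfg.mono subset_union_right), hf.2]

lemma sameIntegral_of_primitive (h : SameWinding S Γ₁ Γ₂) {f F : ℂ → ℂ}
    (hF : ∀ x ∈ trace Γ₁ ∪ trace Γ₂, AnalyticAt ℂ F x)
    (hf : ∀ x ∈ trace Γ₁ ∪ trace Γ₂, deriv F x = f x) : SameIntegral Γ₁ Γ₂ f := by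
  refine ⟨?_, ?_⟩
  · refine ContinuousOn.congr (f := deriv F) (fun x hx => ?_) fun x hx => (hf x hx).symm
    exact (hF x hx).deriv.continuousAt.continuousWithinAt
  · rw [contourIntegral_eq_zero_of_primitive h.left (fun x hx => hF x (Or.inl hx))
      (fun x hx => hf x (Or.inl hx)), contourIntegral_eq_zero_of_primitive h.right
      (fun x hx => hF x (Or.inr hx)) (fun x hx => hf x (Or.inr hx))]

lemma sameIntegral_polynomial (h : SameWinding S Γ₁ Γ₂) (N : Polynomial ℂ) :
    SameIntegral Γ₁ Γ₂ (fun x => N.eval x) := by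
  induction N using Polynomial.induction_on' with
  | add p q hp hq => simpa using h.sameIntegral_add hp hq
  | monomial n a =>
    refine h.sameIntegral_of_primitive (F := fun x => a / (n + 1) * x ^ (n + 1))
      (fun x _ => analyticAt_const.mul (analyticAt_id.pow _)) fun x _ => ?_
    have : ((n : ℂ) + 1) ≠ 0 := by exact_mod_cast n.succ_ne_zero
    simp
    field_simp

/-- Winding numbers enter only through the simple poles; a higher power has a single-valued
primitive. -/
lemma sameIntegral_inv_pow (h : SameWinding S Γ₁ Γ₂) {p : ℂ} (hp : p ∈ S) (n : ℕ) :
    SameIntegral Γ₁ Γ₂ (fun x => ((x - p) ^ (n + 1))⁻¹) := by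
  rcases n with _ | n
  · simp only [zero_add, pow_one]
    exact ⟨continuousOn_inv_sub (h.notMem hp), h.winding_eq p hp⟩
  · have hn : ((n : ℂ) + 1) ≠ 0 := by exact_mod_cast n.succ_ne_zero
    refine h.sameIntegral_of_primitive (F := fun x => (-1 / (n + 1)) * ((x - p) ^ (n + 1))⁻¹)
      (fun x hx => ?_) fun x hx => ?_
    · exact analyticAt_const.mul (((analyticAt_id.sub analyticAt_const).pow _).inv
        (pow_ne_zero _ (h.sub_ne hp hx)))
    · have hx0 := h.sub_ne hp hx
      have := ((((hasDerivAt_id x).sub_const p).pow (n + 1)).inv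
        (pow_ne_zero _ hx0)).const_mul (-1 / ((n : ℂ) + 1))
      refine this.deriv.trans ?_
      simp only [Pi.pow_apply, id, Nat.cast_add, Nat.cast_one, Nat.add_sub_cancel]
      field_simp
      ring

/-- Partial fractions, by induction on the number of poles counted with multiplicity. This stands in
for the residue theorem and uses no topology of plane curves. -/
lemma sameIntegral_inv_prod (h : SameWinding S Γ₁ Γ₂) (n : ℕ) : ∀ l : Multiset ℂ,
    l.card = n → (∀ p ∈ l, p ∈ S) → ∀ N : Polynomial ℂ,
    SameIntegral Γ₁ Γ₂ (fun x => N.eval x * ((l.map fun p => x - p).prod)⁻¹) := by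
  induction n using Nat.strong_induction_on with
  | _ n ih =>
  intro l hl hS N
  rcases Multiset.empty_or_exists_mem l with rfl | ⟨p, hp⟩
  · simpa using h.sameIntegral_polynomial N
  obtain ⟨l', rfl⟩ := Multiset.exists_cons_of_mem hp
  have hpS := hS p (by simp)
  have hS' : ∀ r ∈ l', r ∈ S := fun r hr => hS r (by simp [hr])
  rw [Multiset.card_cons] at hl
  -- With numerator `1`: two distinct poles are separated by `1/((x-p)(x-r)) = (p-r)⁻¹ (1/(x-p) -
  -- 1/(x-r))`, and if all poles coincide the function is an inverse power.
  have hone : SameIntegral Γ₁ Γ₂ (fun x => (((p ::ₘ l').map fun p => x - p).prod)⁻¹) := by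
    by_cases hr : ∃ r ∈ l', r ≠ p
    · obtain ⟨r, hr, hrp⟩ := hr
      obtain ⟨l'', rfl⟩ := Multiset.exists_cons_of_mem hr
      rw [Multiset.card_cons] at hl
      have h1 := ih (n - 1) (by omega) (p ::ₘ l'') (by rw [Multiset.card_cons]; omega)
        (fun s hs => by
          rcases Multiset.mem_cons.mp hs with rfl | hs
          · exact hpS
          · exact hS' s (by simp [hs])) 1
      have h2 := ih (n - 1) (by omega) (r ::ₘ l'') (by rw [Multiset.card_cons]; omega) hS' 1
      have hpr : p - r ≠ 0 := sub_ne_zero.mpr (Ne.symm hrp)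
      refine sameIntegral_congr (h.sameIntegral_add (sameIntegral_const_mul (p - r)⁻¹ h1)
        (sameIntegral_const_mul (-(p - r)⁻¹) h2)) fun x hx => ?_
      have hxp := h.sub_ne hpS hx
      have hxr := h.sub_ne (hS' r (by simp)) hx
      simp only [Multiset.map_cons, Multiset.prod_cons, Polynomial.eval_one, one_mul, mul_inv]
      field_simp
      ring
    · push Not at hr
      rw [Multiset.eq_replicate_card.mpr hr]
      refine sameIntegral_congr (h.sameIntegral_inv_pow hpS l'.card) fun x _ => ?_
      simp [pow_succ']
  -- A general numerator is split as `N(p) + (x - p) N₁`; the second summand cancels a pole.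
  have hrest := ih (n - 1) (by omega) l' (by omega) hS' (N /ₘ (Polynomial.X - Polynomial.C p))
  refine sameIntegral_congr (h.sameIntegral_add (sameIntegral_const_mul (N.eval p) hone) hrest)
    fun x hx => ?_
  have hxp := h.sub_ne hpS hx
  have hdiv : N.eval x = N.eval p +
      (x - p) * (N /ₘ (Polynomial.X - Polynomial.C p)).eval x := by
    conv_lhs => rw [← Polynomial.modByMonic_add_div N (Polynomial.X - Polynomial.C p)]
    simp [Polynomial.modByMonic_X_sub_C_eq_C_eval]
  simp only [Multiset.map_cons, Multiset.prod_cons, hdiv, mul_inv]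
  field_simp

end SameWinding

/-- Contour integrals commute with uniform limits. -/
lemma tendsto_contourIntegral {Γ : ℝ → ℂ} (h : IsClosedLipschitz Γ) {F : ℕ → ℂ → ℂ} {f : ℂ → ℂ}
    (hF : ∀ n, ContinuousOn (F n) (trace Γ)) (hf : TendstoUniformlyOn F f atTop (trace Γ)) :
    Tendsto (fun n => contourIntegral Γ (F n)) atTop (𝓝 (contourIntegral Γ f)) := by
  obtain ⟨K, hK⟩ := h.lipschitz
  have hfc : ContinuousOn f (trace Γ) := hf.continuousOn (Frequently.of_forall hF)
  rw [Metric.tendsto_atTop]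
  intro ε hε
  have hK1 : (0 : ℝ) < K + 1 := by positivity
  obtain ⟨n₀, hn₀⟩ := eventually_atTop.mp
    (Metric.tendstoUniformlyOn_iff.mp hf (ε / (K + 1)) (by positivity))
  refine ⟨n₀, fun n hn => ?_⟩
  have e : contourIntegral Γ (F n) - contourIntegral Γ f
      = contourIntegral Γ (fun x => F n x + (-1) * f x) := by
    rw [contourIntegral_add h (g := fun x => (-1) * f x) (hF n) (continuousOn_const.mul hfc),
        contourIntegral_const_mul]
    ring
  rw [dist_eq_norm, e]
  refine (norm_contourIntegral_le hK (M := ε / (K + 1)) fun x hx => ?_).trans_lt ?_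
  · have := (hn₀ n hn x hx).le
    rw [dist_comm, dist_eq_norm] at this
    rwa [neg_one_mul, ← sub_eq_add_neg]
  · rw [div_mul_eq_mul_div, div_lt_iff₀ hK1]
    nlinarith [K.2]

lemma SameWinding.sameIntegral_of_tendsto {S : Set ℂ} {Γ₁ Γ₂ : ℝ → ℂ} (h : SameWinding S Γ₁ Γ₂)
    {F : ℕ → ℂ → ℂ} {f : ℂ → ℂ} (hF : ∀ n, SameIntegral Γ₁ Γ₂ (F n))
    (hf : TendstoUniformlyOn F f atTop (trace Γ₁ ∪ trace Γ₂)) : SameIntegral Γ₁ Γ₂ f := by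
  refine ⟨hf.continuousOn (Frequently.of_forall fun n => (hF n).1), ?_⟩
  refine tendsto_nhds_unique (tendsto_contourIntegral h.left
    (fun n => (hF n).1.mono subset_union_left) (hf.mono subset_union_left)) ?_
  simp only [fun n => (hF n).2]
  exact tendsto_contourIntegral h.right
    (fun n => (hF n).1.mono subset_union_right) (hf.mono subset_union_right)

/-! ### Infinite and finite shifted factorials -/

lemma summable_norm_mul_pow {q : ℂ} (hq : ‖q‖ < 1) (z : ℂ) : Summable fun k : ℕ => ‖-(z * q ^ k)‖ := by
  simp only [norm_neg, norm_mul, norm_pow]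
  exact (summable_geometric_of_lt_one (norm_nonneg _) hq).mul_left _

lemma multipliable_qPoch {q : ℂ} (hq : ‖q‖ < 1) (z : ℂ) : Multipliable fun k : ℕ => 1 - z * q ^ k := by
  simp only [sub_eq_add_neg]
  exact multipliable_one_add_of_summable (summable_norm_mul_pow hq z)

lemma qPoch_eq_mul {q : ℂ} (hq : ‖q‖ < 1) (z : ℂ) : qPoch q z = (1 - z) * qPoch q (z * q) := by
  have h : (fun k : ℕ => 1 - z * q ^ (k + 1)) = fun k => 1 - z * q * q ^ k := by
    funext k; ring
  rw [qPoch, tprod_eq_zero_mul', qPoch, h]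
  · simp
  · rw [h]; exact multipliable_qPoch hq _

lemma qPoch_ne_zero {q z : ℂ} (hq : ‖q‖ < 1) (hz : ∀ k : ℕ, 1 - z * q ^ k ≠ 0) : qPoch q z ≠ 0 := by
  simp only [qPoch, sub_eq_add_neg] at hz ⊢
  exact tprod_one_add_ne_zero_of_summable hz (summable_norm_mul_pow hq z)

lemma qPoch_zero (q : ℂ) : qPoch q 0 = 1 := by simp [qPoch]

/-- The finite `q`-shifted factorial `(z; q)_n`. -/
def qFact (q z : ℂ) (n : ℕ) : ℂ := ∏ k ∈ Finset.range n, (1 - z * q ^ k)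

lemma qFact_zero (q z : ℂ) : qFact q z 0 = 1 := by simp [qFact]

lemma qFact_succ (q z : ℂ) (n : ℕ) : qFact q z (n + 1) = qFact q z n * (1 - z * q ^ n) := by
  simp [qFact, Finset.prod_range_succ]

lemma qFact_succ' (q z : ℂ) (n : ℕ) : qFact q z (n + 1) = (1 - z) * qFact q (z * q) n := by
  simp only [qFact, Finset.prod_range_succ', pow_zero, mul_one]
  rw [mul_comm]
  congr 1
  exact Finset.prod_congr rfl fun k _ => by ring

lemma qFact_ne_zero {q z : ℂ} {n : ℕ} (h : ∀ k < n, 1 - z * q ^ k ≠ 0) : qFact q z n ≠ 0 :=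
  Finset.prod_ne_zero_iff.mpr fun k hk => h k (Finset.mem_range.mp hk)

/-- The Weierstrass test with the majorant `M |q|^n`, where `M` bounds `g` on the compact set. It is
used both for analyticity of `qPoch` and for the rational approximation of weights. -/
lemma tendstoUniformlyOn_qFact {q : ℂ} (hq : ‖q‖ < 1) {K : Set ℂ} (hK : IsCompact K) {g : ℂ → ℂ}
    (hg : ContinuousOn g K) :
    TendstoUniformlyOn (fun n x => qFact q (g x) n) (fun x => qPoch q (g x)) atTop K := by
  obtain ⟨M, hM⟩ := hK.exists_bound_of_continuousOn hg
  have := (Summable.hasProdUniformlyOn_nat_one_add (f := fun n x => -(g x * q ^ n)) hK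
    (u := fun n => M * ‖q‖ ^ n)
    ((summable_geometric_of_lt_one (norm_nonneg _) hq).mul_left M)
    (Eventually.of_forall fun n x hx => by
      rw [norm_neg, norm_mul, norm_pow]
      exact mul_le_mul_of_nonneg_right (hM x hx) (by positivity))
    fun n => (hg.mul continuousOn_const).neg)
  have h2 := this.tendstoUniformlyOn_finsetRange
  simp only [← sub_eq_add_neg] at h2
  exact h2

lemma differentiable_qPoch {q : ℂ} (hq : ‖q‖ < 1) : Differentiable ℂ (qPoch q) := by
  intro z
  have hU : IsOpen (Metric.ball (0 : ℂ) (‖z‖ + 1)) := Metric.isOpen_ball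
  have h := (tendstoUniformlyOn_qFact hq (isCompact_closedBall (0 : ℂ) (‖z‖ + 1))
    (g := fun x => x) continuousOn_id).mono Metric.ball_subset_closedBall
  refine (h.tendstoLocallyUniformlyOn.differentiableOn (Eventually.of_forall fun n => ?_)
    hU).differentiableAt (hU.mem_nhds (by simp))
  simp only [qFact]
  fun_prop

lemma continuous_qPoch {q : ℂ} (hq : ‖q‖ < 1) : Continuous (qPoch q) :=
  (differentiable_qPoch hq).continuous

/-- `(x²; q²)`-type splitting: `(z²; r²)_∞ = (z, -z, rz, -rz; r²)_∞`. -/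
lemma qPoch_sq {r : ℂ} (hr : ‖r ^ 2‖ < 1) (z : ℂ) :
    qPoch (r ^ 2) (z ^ 2) = qPoch (r ^ 2) z * qPoch (r ^ 2) (-z) * qPoch (r ^ 2) (r * z) *
      qPoch (r ^ 2) (-(r * z)) := by
  have hr1 : ‖r‖ < 1 := by
    rw [norm_pow] at hr
    by_contra h
    have := one_le_pow₀ (not_lt.mp h) (n := 2)
    linarith
  -- The product with base `r` is separated into even and odd exponents; `h2` then uses `1 - z²
  -- r^(2k) = (1 - z r^k)(1 + z r^k)` factor by factor.
  have h1 : ∀ z : ℂ, qPoch r z = qPoch (r ^ 2) z * qPoch (r ^ 2) (r * z) := by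
    intro z
    have e1 : (fun k : ℕ => 1 - z * r ^ (2 * k)) = fun k => 1 - z * (r ^ 2) ^ k := by
      funext k; rw [pow_mul]
    have e2 : (fun k : ℕ => 1 - z * r ^ (2 * k + 1)) = fun k => 1 - r * z * (r ^ 2) ^ k := by
      funext k; rw [pow_succ, pow_mul]; ring
    have := tprod_even_mul_odd (f := fun k : ℕ => 1 - z * r ^ k)
      (by rw [e1]; exact multipliable_qPoch hr z) (by rw [e2]; exact multipliable_qPoch hr _)
    rw [e1, e2] at this
    exact this.symm
  have h2 : qPoch (r ^ 2) (z ^ 2) = qPoch r z * qPoch r (-z) := by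
    rw [qPoch, qPoch, qPoch, ← (multipliable_qPoch hr1 z).tprod_mul (multipliable_qPoch hr1 (-z))]
    congr 1; funext k; ring
  rw [h2, h1 z, h1 (-z)]
  ring_nf

/-! ### Rational functions with prescribed poles and their limits -/

/-- Rational functions with poles in `S`. -/
def IsRat (S : Set ℂ) (f : ℂ → ℂ) : Prop :=
  ∃ (N : Polynomial ℂ) (l : Multiset ℂ), (∀ p ∈ l, p ∈ S) ∧
    ∀ x ∉ S, f x = N.eval x * ((l.map fun p => x - p).prod)⁻¹

namespace IsRat

variable {S : Set ℂ} {f g : ℂ → ℂ}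

lemma polynomial (N : Polynomial ℂ) : IsRat S (fun x => N.eval x) := ⟨N, 0, by simp, by simp⟩

lemma const (c : ℂ) : IsRat S (fun _ => c) := by simpa using polynomial (S := S) (Polynomial.C c)

lemma id : IsRat S (fun x => x) := by simpa using polynomial (S := S) Polynomial.X

lemma inv_sub {p : ℂ} (hp : p ∈ S) : IsRat S (fun x => (x - p)⁻¹) :=
  ⟨1, {p}, by simpa using hp, by simp⟩

lemma mul (hf : IsRat S f) (hg : IsRat S g) : IsRat S (fun x => f x * g x) := by
  obtain ⟨N, l, hl, h⟩ := hf
  obtain ⟨N', l', hl', h'⟩ := hg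
  refine ⟨N * N', l + l', fun p hp => ?_, fun x hx => ?_⟩
  · exact (Multiset.mem_add.mp hp).elim (hl p) (hl' p)
  · simp only [h x hx, h' x hx, Polynomial.eval_mul, Multiset.map_add, Multiset.prod_add, mul_inv]
    ring

lemma prod_sub_ne_zero {l : Multiset ℂ} (hl : ∀ p ∈ l, p ∈ S) {x : ℂ} (hx : x ∉ S) :
    (l.map fun p => x - p).prod ≠ 0 := by
  refine Multiset.prod_ne_zero fun h => ?_
  obtain ⟨p, hp, h0⟩ := Multiset.mem_map.mp h
  exact hx (by rw [sub_eq_zero.mp h0]; exact hl p hp)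

lemma add (hf : IsRat S f) (hg : IsRat S g) : IsRat S (fun x => f x + g x) := by
  obtain ⟨N, l, hl, h⟩ := hf
  obtain ⟨N', l', hl', h'⟩ := hg
  refine ⟨N * (l'.map fun p => Polynomial.X - Polynomial.C p).prod +
    N' * (l.map fun p => Polynomial.X - Polynomial.C p).prod, l + l', fun p hp => ?_,
    fun x hx => ?_⟩
  · exact (Multiset.mem_add.mp hp).elim (hl p) (hl' p)
  · have e : ∀ l : Multiset ℂ, ((l.map fun p => Polynomial.X - Polynomial.C p).prod).eval x =
        (l.map fun p => x - p).prod := fun l => by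
      rw [Polynomial.eval_multiset_prod, Multiset.map_map]
      simp
    have h1 := prod_sub_ne_zero hl hx
    have h2 := prod_sub_ne_zero hl' hx
    simp only [h x hx, h' x hx, Polynomial.eval_add, Polynomial.eval_mul, e, Multiset.map_add,
      Multiset.prod_add]
    field_simp

lemma prod {ι : Type*} (s : Finset ι) {F : ι → ℂ → ℂ} (h : ∀ i ∈ s, IsRat S (F i)) :
    IsRat S (fun x => ∏ i ∈ s, F i x) := by
  classical
  induction s using Finset.induction_on with
  | empty => simpa using const (S := S) 1
  | insert a s ha ih =>
    simp only [Finset.prod_insert ha]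
    exact (h a (by simp)).mul (ih fun i hi => h i (by simp [hi]))

lemma congr (hf : IsRat S f) (h : ∀ x ∉ S, g x = f x) : IsRat S g := by
  obtain ⟨N, l, hl, h'⟩ := hf
  exact ⟨N, l, hl, fun x hx => (h x hx).trans (h' x hx)⟩

lemma sameIntegral {Γ₁ Γ₂ : ℝ → ℂ} (h : SameWinding S Γ₁ Γ₂) (hf : IsRat S f) :
    SameIntegral Γ₁ Γ₂ f := by
  obtain ⟨N, l, hl, h'⟩ := hf
  exact SameWinding.sameIntegral_congr (h.sameIntegral_inv_prod l.card l rfl hl N) fun x hx =>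
    h' x fun hxS => h.notMem hxS hx

end IsRat

/-- Limits, uniform on `K`, of rational functions with poles in `S`. -/
structure IsRatLimit (S K : Set ℂ) (f : ℂ → ℂ) : Prop where
  exists_seq : ∃ F : ℕ → ℂ → ℂ, (∀ n, IsRat S (F n)) ∧ TendstoLocallyUniformlyOn F f atTop K
  continuousOn : ContinuousOn f K

namespace IsRatLimit

variable {S K : Set ℂ} {f g : ℂ → ℂ}

lemma of_isRat (hf : IsRat S f) (hc : ContinuousOn f K) : IsRatLimit S K f :=
  ⟨⟨fun _ => f, fun _ => hf, fun _ hu _ _ => ⟨K, self_mem_nhdsWithin,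
    Eventually.of_forall fun _ _ _ => refl_mem_uniformity hu⟩⟩, hc⟩

lemma mul (hf : IsRatLimit S K f) (hg : IsRatLimit S K g) : IsRatLimit S K (fun x => f x * g x) := by
  obtain ⟨⟨F, hF, hFf⟩, hfc⟩ := hf
  obtain ⟨⟨G, hG, hGg⟩, hgc⟩ := hg
  exact ⟨⟨fun n x => F n x * G n x, fun n => (hF n).mul (hG n), hFf.mul₀ hGg hfc hgc⟩,
    hfc.mul hgc⟩

lemma qPoch {q : ℂ} (hq : ‖q‖ < 1) (hK : IsCompact K) (hg : IsRat S g) (hgc : ContinuousOn g K) :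
    IsRatLimit S K (fun x => qPoch q (g x)) := by
  refine ⟨⟨fun n x => qFact q (g x) n, fun n => IsRat.prod _ fun k _ => ?_,
    (tendstoUniformlyOn_qFact hq hK hgc).tendstoLocallyUniformlyOn⟩,
    (continuous_qPoch hq).comp_continuousOn hgc⟩
  exact ((IsRat.const 1).add (hg.mul (IsRat.const (-q ^ k)))).congr fun x _ => by ring

lemma inv_qPoch {q : ℂ} (hq : ‖q‖ < 1) (hK : IsCompact K) (hgc : ContinuousOn g K)
    (hg : ∀ k : ℕ, IsRat S fun x => (1 - g x * q ^ k)⁻¹)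
    (h0 : ∀ x ∈ K, ∀ k : ℕ, 1 - g x * q ^ k ≠ 0) :
    IsRatLimit S K (fun x => (AskeyWilson.qPoch q (g x))⁻¹) := by
  have hne : ∀ x ∈ K, AskeyWilson.qPoch q (g x) ≠ 0 := fun x hx => qPoch_ne_zero hq (h0 x hx)
  have hc : ContinuousOn (fun x => AskeyWilson.qPoch q (g x)) K :=
    (continuous_qPoch hq).comp_continuousOn hgc
  refine ⟨⟨fun n x => (qFact q (g x) n)⁻¹, fun n => ?_,
    (tendstoUniformlyOn_qFact hq hK hgc).tendstoLocallyUniformlyOn.inv₀ hc hne⟩, hc.inv₀ hne⟩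
  refine (IsRat.prod (Finset.range n) fun k _ => hg k).congr fun x _ => ?_
  simp [qFact]

lemma inv_qPoch_mul {q e : ℂ} (hq : ‖q‖ < 1) (hK : IsCompact K) (hSK : ∀ p ∈ S, p ∉ K)
    (he : ∀ k : ℕ, e * q ^ k ≠ 0 ∧ (e * q ^ k)⁻¹ ∈ S) :
    IsRatLimit S K (fun x => (AskeyWilson.qPoch q (e * x))⁻¹) := by
  refine inv_qPoch hq hK (by fun_prop) (fun k => ?_) fun x hx k h0 => ?_
  · refine ((IsRat.const (-(e * q ^ k)⁻¹)).mul (IsRat.inv_sub (he k).2)).congr fun x hx => ?_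
    have h1 := (he k).1
    rw [neg_mul, ← mul_inv, mul_sub, mul_inv_cancel₀ h1, ← inv_neg]
    ring_nf
  · refine hSK _ (he k).2 ?_
    rwa [inv_eq_of_mul_eq_one_right (b := x) (by linear_combination -h0)]

lemma inv_qPoch_div {q e : ℂ} (hq : ‖q‖ < 1) (hK : IsCompact K) (hSK : ∀ p ∈ S, p ∉ K)
    (hS0 : (0 : ℂ) ∈ S) (he : ∀ k : ℕ, e * q ^ k ∈ S) :
    IsRatLimit S K (fun x => (AskeyWilson.qPoch q (e * x⁻¹))⁻¹) := by
  have hx0 : ∀ x ∈ K, x ≠ 0 := fun x hx h => hSK 0 hS0 (h ▸ hx)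
  refine inv_qPoch hq hK (continuousOn_const.mul (continuousOn_id.inv₀ hx0)) (fun k => ?_)
    fun x hx k h0 => ?_
  · refine (IsRat.id.mul (IsRat.inv_sub (he k))).congr fun x hx => ?_
    have h1 : x ≠ 0 := fun h => hx (h ▸ hS0)
    have h2 : x - e * q ^ k ≠ 0 := fun h => hx (sub_eq_zero.mp h ▸ he k)
    have : 1 - e * x⁻¹ * q ^ k = (x - e * q ^ k) * x⁻¹ := by field_simp
    rw [this, mul_inv, inv_inv, mul_comm]
  · have h1 := hx0 x hx
    refine hSK _ (he k) ?_
    have : e * q ^ k = x := by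
      field_simp at h0
      linear_combination -h0
    rwa [this]

lemma sameIntegral {Γ₁ Γ₂ : ℝ → ℂ} (h : SameWinding S Γ₁ Γ₂)
    (hf : IsRatLimit S (trace Γ₁ ∪ trace Γ₂) f) : SameIntegral Γ₁ Γ₂ f := by
  obtain ⟨⟨F, hF, hFf⟩, -⟩ := hf
  refine h.sameIntegral_of_tendsto (fun n => (hF n).sameIntegral h) ?_
  rwa [← tendstoLocallyUniformlyOn_iff_tendstoUniformlyOn_of_compact
    ((isCompact_trace h.left).union (isCompact_trace h.right))]

end IsRatLimit

/-! ### The Askey-Wilson functional and its first moment -/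

/-- The point `e` lies, with its `q`-string `e q^k`, inside the curve, and the reciprocals
lie outside. -/
def Enclosed (q : ℂ) (Γ : ℝ → ℂ) (e : ℂ) : Prop :=
  e ≠ 0 ∧ ∀ k : ℕ, e * q ^ k ∉ trace Γ ∧ winding Γ (e * q ^ k) = 1 ∧
    (e * q ^ k)⁻¹ ∉ trace Γ ∧ winding Γ (e * q ^ k)⁻¹ = 0

lemma Enclosed.mul_pow {q : ℂ} (hq0 : q ≠ 0) {Γ : ℝ → ℂ} {e : ℂ} (h : Enclosed q Γ e) (n : ℕ) :
    Enclosed q Γ (e * q ^ n) :=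
  ⟨mul_ne_zero h.1 (pow_ne_zero _ hq0), fun k => by
    rw [mul_assoc, ← pow_add]; exact h.2 (n + k)⟩

/-- Closed curves winding once around the origin. -/
structure IsLoop (Γ : ℝ → ℂ) : Prop where
  lip : IsClosedLipschitz Γ
  zero_notMem : (0 : ℂ) ∉ trace Γ
  winding_zero : winding Γ 0 = 1

lemma deriv_const_smul_curve (q : ℂ) (Γ : ℝ → ℂ) (s : ℝ) :
    deriv (fun s => q * Γ s) s = q * deriv Γ s := deriv_const_mul_field q

lemma contourIntegral_smul (q : ℂ) (Γ : ℝ → ℂ) (f : ℂ → ℂ) :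
    contourIntegral (fun s => q * Γ s) f = contourIntegral Γ fun x => q * f (q * x) := by
  simp only [contourIntegral, deriv_const_smul_curve]
  congr 2
  funext s
  ring

lemma winding_smul {q : ℂ} (hq0 : q ≠ 0) (Γ : ℝ → ℂ) (p : ℂ) :
    winding (fun s => q * Γ s) p = winding Γ (q⁻¹ * p) := by
  rw [winding, contourIntegral_smul, winding]
  refine contourIntegral_congr fun x _ => ?_
  have : q * x - p = q * (x - q⁻¹ * p) := by field_simp
  simp only [this, mul_inv]
  field_simp

lemma mem_trace_smul {q : ℂ} (hq0 : q ≠ 0) {Γ : ℝ → ℂ} {p : ℂ} :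
    p ∈ trace (fun s => q * Γ s) ↔ q⁻¹ * p ∈ trace Γ := by
  constructor
  · rintro ⟨s, hs, rfl⟩
    exact ⟨s, hs, by field_simp⟩
  · rintro ⟨s, hs, h⟩
    exact ⟨s, hs, by simp only [h]; field_simp⟩

lemma IsClosedLipschitz.smul {Γ : ℝ → ℂ} (h : IsClosedLipschitz Γ) (q : ℂ) :
    IsClosedLipschitz fun s => q * Γ s := by
  obtain ⟨K, hK⟩ := h.lipschitz
  refine ⟨⟨‖q‖₊ * K, ?_⟩, by simp [h.closed]⟩
  refine LipschitzOnWith.of_dist_le_mul fun x hx y hy => ?_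
  rw [dist_eq_norm, ← mul_sub, norm_mul, ← dist_eq_norm, NNReal.coe_mul, coe_nnnorm, mul_assoc]
  exact mul_le_mul_of_nonneg_left (hK.dist_le_mul x hx y hy) (norm_nonneg _)

/-- The Askey-Wilson weight function with parameters `a, b, c, d`. -/
noncomputable def awWeight (q a b c d x : ℂ) : ℂ :=
  qPoch q (x ^ 2) * qPoch q (x⁻¹ ^ 2) /
    (qPoch q (a * x) * qPoch q (a * x⁻¹) * qPoch q (b * x) * qPoch q (b * x⁻¹) *
      qPoch q (c * x) * qPoch q (c * x⁻¹) * qPoch q (d * x) * qPoch q (d * x⁻¹))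

/-- The Askey-Wilson functional `f ↦ (2πi)⁻¹ ∮ f(x) Δ₊(x) dx / x`. -/
noncomputable def awInt (q : ℂ) (Γ : ℝ → ℂ) (a b c d : ℂ) (f : ℂ → ℂ) : ℂ :=
  contourIntegral Γ fun x => f x * awWeight q a b c d x / x

/-- A contour separating the two families of poles of the Askey-Wilson weight. -/
structure IsAWContour (q : ℂ) (Γ : ℝ → ℂ) (a b c d : ℂ) : Prop where
  loop : IsLoop Γ
  ha : Enclosed q Γ a
  hb : Enclosed q Γ b
  hc : Enclosed q Γ c
  hd : Enclosed q Γ d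

lemma Enclosed.qPoch_mul_ne {q : ℂ} (hq : ‖q‖ < 1) {Γ : ℝ → ℂ} {e : ℂ} (h : Enclosed q Γ e)
    {x : ℂ} (hx : x ∈ trace Γ) : qPoch q (e * x) ≠ 0 := by
  refine qPoch_ne_zero hq fun k h0 => (h.2 k).2.2.1 ?_
  rwa [inv_eq_of_mul_eq_one_right (b := x) (by linear_combination -h0)]

lemma Enclosed.qPoch_div_ne {q : ℂ} (hq : ‖q‖ < 1) {Γ : ℝ → ℂ} (h0 : (0 : ℂ) ∉ trace Γ) {e : ℂ}
    (h : Enclosed q Γ e) {x : ℂ} (hx : x ∈ trace Γ) : qPoch q (e * x⁻¹) ≠ 0 := by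
  have hx0 : x ≠ 0 := fun h => h0 (h ▸ hx)
  refine qPoch_ne_zero hq fun k hk => (h.2 k).1 ?_
  have : e * q ^ k = x := by
    field_simp at hk
    linear_combination -hk
  rwa [this]

lemma continuousOn_awWeight {q : ℂ} (hq : ‖q‖ < 1) {Γ : ℝ → ℂ} {a b c d : ℂ}
    (h : IsAWContour q Γ a b c d) : ContinuousOn (awWeight q a b c d) (trace Γ) := by
  have hx0 : ∀ x ∈ trace Γ, x ≠ 0 := fun x hx h' => h.loop.zero_notMem (h' ▸ hx)
  have hi : ContinuousOn (fun x : ℂ => x⁻¹) (trace Γ) := continuousOn_id.inv₀ hx0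
  have hm : ∀ e : ℂ, ContinuousOn (fun x => qPoch q (e * x)) (trace Γ) := fun e =>
    (continuous_qPoch hq).comp_continuousOn (by fun_prop)
  have hd : ∀ e : ℂ, ContinuousOn (fun x => qPoch q (e * x⁻¹)) (trace Γ) := fun e =>
    (continuous_qPoch hq).comp_continuousOn (continuousOn_const.mul hi)
  refine ContinuousOn.div ?_ ?_ fun x hx => ?_
  · exact ((continuous_qPoch hq).comp_continuousOn (by fun_prop)).mul
      ((continuous_qPoch hq).comp_continuousOn (hi.pow 2))
  · exact (((((((hm a).mul (hd a)).mul (hm b)).mul (hd b)).mul (hm c)).mul (hd c)).mul (hm d)).mul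
      (hd d)
  · have H := fun (e : ℂ) (he : Enclosed q Γ e) => he.qPoch_mul_ne hq hx
    have H' := fun (e : ℂ) (he : Enclosed q Γ e) => he.qPoch_div_ne hq h.loop.zero_notMem hx
    simp only [ne_eq, mul_eq_zero, not_or]
    exact ⟨⟨⟨⟨⟨⟨⟨H a h.ha, H' a h.ha⟩, H b h.hb⟩, H' b h.hb⟩, H c h.hc⟩, H' c h.hc⟩, H d h.hd⟩,
      H' d h.hd⟩

/-- Winding of `qΓ` around `p` is winding of `Γ` around `p / q`. Division by `q` sends `e q^(k+1)`
to `e q^k`, still enclosed, and `(e q^k)⁻¹` to `(e q^(k+1))⁻¹`, still excluded. The points `e`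
themselves must be left out, since `e / q` may lie outside; the integrand to be shifted therefore
carries `e q x⁻¹` in place of `e x⁻¹`. -/
lemma sameWinding_smul {q : ℂ} (hq0 : q ≠ 0) {Γ : ℝ → ℂ} {a b c d : ℂ}
    (h : IsAWContour q Γ a b c d) :
    SameWinding ({0} ∪ {p | ∃ e ∈ ({a, b, c, d} : Set ℂ), ∃ k : ℕ, p = e * q * q ^ k} ∪
      {p | ∃ e ∈ ({a, b, c, d} : Set ℂ), ∃ k : ℕ, p = (e * q ^ k)⁻¹}) Γ (fun s => q * Γ s) := by
  have he : ∀ e ∈ ({a, b, c, d} : Set ℂ), Enclosed q Γ e := by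
    rintro e (rfl | rfl | rfl | rfl)
    exacts [h.ha, h.hb, h.hc, h.hd]
  have e1 : ∀ (e : ℂ) (k : ℕ), q⁻¹ * (e * q * q ^ k) = e * q ^ k := fun e k => by field_simp
  have e2 : ∀ (e : ℂ) (k : ℕ), q⁻¹ * (e * q ^ k)⁻¹ = (e * q ^ (k + 1))⁻¹ := fun e k => by
    rw [← mul_inv]; ring_nf
  have e3 : ∀ (e : ℂ) (k : ℕ), e * q * q ^ k = e * q ^ (k + 1) := fun e k => by ring
  refine ⟨h.loop.lip, h.loop.lip.smul q, ?_, ?_, ?_⟩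
  · rintro p ((rfl | ⟨e, hE, k, rfl⟩) | ⟨e, hE, k, rfl⟩)
    · exact h.loop.zero_notMem
    · rw [e3]; exact ((he e hE).2 _).1
    · exact ((he e hE).2 _).2.2.1
  · rintro p ((rfl | ⟨e, hE, k, rfl⟩) | ⟨e, hE, k, rfl⟩) <;> rw [mem_trace_smul hq0]
    · rw [mul_zero]; exact h.loop.zero_notMem
    · rw [e1]; exact ((he e hE).2 _).1
    · rw [e2]; exact ((he e hE).2 _).2.2.1
  · rintro p ((rfl | ⟨e, hE, k, rfl⟩) | ⟨e, hE, k, rfl⟩) <;> rw [winding_smul hq0]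
    · rw [mul_zero]
    · rw [e1, e3, ((he e hE).2 _).2.1, ((he e hE).2 _).2.1]
    · rw [e2, ((he e hE).2 _).2.2.2, ((he e hE).2 _).2.2.2]

/-- The shift invariance of the contour integral of
`(x², q x⁻²)_∞ / ∏ (e x, q e x⁻¹)_∞` under `x ↦ q x`. -/
lemma contourIntegral_shift {q : ℂ} (hq0 : q ≠ 0) (hq : ‖q‖ < 1) {Γ : ℝ → ℂ} {a b c d : ℂ}
    (h : IsAWContour q Γ a b c d) {W : ℂ → ℂ}
    (hW : W = fun x => qPoch q (x ^ 2) * qPoch q (q * x⁻¹ ^ 2) *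
      ((qPoch q (a * x))⁻¹ * (qPoch q (a * q * x⁻¹))⁻¹) *
      ((qPoch q (b * x))⁻¹ * (qPoch q (b * q * x⁻¹))⁻¹) *
      ((qPoch q (c * x))⁻¹ * (qPoch q (c * q * x⁻¹))⁻¹) *
      ((qPoch q (d * x))⁻¹ * (qPoch q (d * q * x⁻¹))⁻¹)) :
    contourIntegral Γ (fun x => W x + (-q) * W (q * x)) = 0 ∧ ContinuousOn W (trace Γ) := by
  have hS := sameWinding_smul hq0 h
  set S : Set ℂ := {0} ∪ {p | ∃ e ∈ ({a, b, c, d} : Set ℂ), ∃ k : ℕ, p = e * q * q ^ k} ∪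
      {p | ∃ e ∈ ({a, b, c, d} : Set ℂ), ∃ k : ℕ, p = (e * q ^ k)⁻¹}
  have hK := (isCompact_trace hS.left).union (isCompact_trace hS.right)
  set K := trace Γ ∪ trace (fun s => q * Γ s)
  have hSK : ∀ p ∈ S, p ∉ K := fun p hp => hS.notMem hp
  have h0S : (0 : ℂ) ∈ S := by simp [S]
  have hx0 : ∀ x ∈ K, x ≠ 0 := fun x hx h' => hSK 0 h0S (h' ▸ hx)
  have hfac : ∀ e ∈ ({a, b, c, d} : Set ℂ), Enclosed q Γ e →
      IsRatLimit S K fun x => (qPoch q (e * x))⁻¹ * (qPoch q (e * q * x⁻¹))⁻¹ := by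
    intro e he hE
    refine (IsRatLimit.inv_qPoch_mul hq hK hSK fun k =>
      ⟨mul_ne_zero hE.1 (pow_ne_zero _ hq0), Or.inr ⟨e, he, k, rfl⟩⟩).mul
      (IsRatLimit.inv_qPoch_div hq hK hSK h0S fun k => Or.inl (Or.inr ⟨e, he, k, rfl⟩))
  have hinv : IsRat S fun x => q * x⁻¹ ^ 2 := by
    have := IsRat.inv_sub h0S
    refine (IsRat.const q).mul ((this.mul this).congr fun x _ => ?_)
    simp [pow_two]
  have hsq : IsRat S fun x : ℂ => x ^ 2 := (IsRat.id.mul IsRat.id).congr fun x _ => pow_two x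
  have hWS : IsRatLimit S K W := by
    rw [hW]
    refine ((((((IsRatLimit.qPoch hq hK hsq (by fun_prop)).mul (IsRatLimit.qPoch hq hK hinv
      (continuousOn_const.mul ((continuousOn_id.inv₀ hx0).pow 2)))).mul
      (hfac a (by simp) h.ha)).mul (hfac b (by simp) h.hb)).mul (hfac c (by simp) h.hc)).mul
      (hfac d (by simp) h.hd))
  -- Integrating `W` over `qΓ` is integrating `q W(qx)` over `Γ`, so equality of the two integrals
  -- is the claimed vanishing.
  have heq := (hWS.sameIntegral hS).2
  rw [contourIntegral_smul] at heq
  have hc1 : ContinuousOn W (trace Γ) := hWS.continuousOn.mono subset_union_left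
  have hc2 : ContinuousOn (fun x => W (q * x)) (trace Γ) :=
    hWS.continuousOn.comp (by fun_prop) fun x hx => Or.inr (by
      rw [mem_trace_smul hq0]; rwa [inv_mul_cancel_left₀ hq0])
  refine ⟨?_, hc1⟩
  rw [contourIntegral_add h.loop.lip (g := fun x => (-q) * W (q * x)) hc1
    (continuousOn_const.mul hc2), heq, contourIntegral_const_mul, contourIntegral_const_mul]
  ring

/-- The first moment relation of the Askey-Wilson functional. -/
lemma awInt_first_moment {q : ℂ} (hq0 : q ≠ 0) (hq : ‖q‖ < 1) {Γ : ℝ → ℂ} {a b c d : ℂ}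
    (h : IsAWContour q Γ a b c d) :
    awInt q Γ a b c d (fun x => (1 - a * b * c * d) * (x + x⁻¹) +
      (a * b * c + a * b * d + a * c * d + b * c * d - a - b - c - d)) = 0 := by
  -- The moment integrand is equal, pointwise on the curve, to `W(x) - q W(qx)`: after all infinite
  -- products are reduced to common ones, a rational identity in `x` remains.
  rw [← (contourIntegral_shift hq0 hq h rfl).1, awInt]
  refine contourIntegral_congr fun x hx => ?_
  have hx0 : x ≠ 0 := fun h' => h.loop.zero_notMem (h' ▸ hx)
  have k1 : ∀ e, qPoch q (e * x) = (1 - e * x) * qPoch q (e * (q * x)) := fun e => by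
    rw [qPoch_eq_mul hq]; ring_nf
  have k2 : ∀ e, qPoch q (e * x⁻¹) = (1 - e * x⁻¹) * qPoch q (e * q * x⁻¹) := fun e => by
    rw [qPoch_eq_mul hq]; ring_nf
  have k3 : ∀ e, e * q * (q * x)⁻¹ = e * x⁻¹ := fun e => by field_simp
  have p1 : qPoch q (x ^ 2) = (1 - x ^ 2) * ((1 - q * x ^ 2) * qPoch q ((q * x) ^ 2)) := by
    rw [qPoch_eq_mul hq, qPoch_eq_mul hq (x ^ 2 * q)]; ring_nf
  have p2 : qPoch q (x⁻¹ ^ 2) = (1 - x⁻¹ ^ 2) * qPoch q (q * x⁻¹ ^ 2) := by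
    rw [qPoch_eq_mul hq, mul_comm q]
  have p3 : qPoch q (q * (q * x)⁻¹ ^ 2) =
      (1 - q⁻¹ * x⁻¹ ^ 2) * ((1 - x⁻¹ ^ 2) * qPoch q (q * x⁻¹ ^ 2)) := by
    have : q * (q * x)⁻¹ ^ 2 = q⁻¹ * x⁻¹ ^ 2 := by field_simp
    rw [this, qPoch_eq_mul hq, ← p2]
    congr 2
    field_simp
  have n1 : ∀ e, Enclosed q Γ e → 1 - e * x ≠ 0 ∧ qPoch q (e * (q * x)) ≠ 0 := fun e he => by
    have := he.qPoch_mul_ne hq hx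
    rw [k1 e] at this
    exact ⟨left_ne_zero_of_mul this, right_ne_zero_of_mul this⟩
  have n2 : ∀ e, Enclosed q Γ e → x - e ≠ 0 ∧ qPoch q (e * q * x⁻¹) ≠ 0 := fun e he => by
    have := he.qPoch_div_ne hq h.loop.zero_notMem hx
    rw [k2 e] at this
    refine ⟨fun h0 => left_ne_zero_of_mul this ?_, right_ne_zero_of_mul this⟩
    rw [← sub_eq_zero.mp h0, mul_inv_cancel₀ hx0, sub_self]
  obtain ⟨a1, a2⟩ := n1 a h.ha
  obtain ⟨b1, b2⟩ := n1 b h.hb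
  obtain ⟨c1, c2⟩ := n1 c h.hc
  obtain ⟨d1, d2⟩ := n1 d h.hd
  obtain ⟨a3, a4⟩ := n2 a h.ha
  obtain ⟨b3, b4⟩ := n2 b h.hb
  obtain ⟨c3, c4⟩ := n2 c h.hc
  obtain ⟨d3, d4⟩ := n2 d h.hd
  simp only [awWeight, k3]
  rw [p3, p1, p2]
  rw [k1 a, k1 b, k1 c, k1 d, k2 a, k2 b, k2 c, k2 d]
  generalize qPoch q (a * (q * x)) = A1 at *
  generalize qPoch q (b * (q * x)) = B1 at *
  generalize qPoch q (c * (q * x)) = C1 at *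
  generalize qPoch q (d * (q * x)) = D1 at *
  generalize qPoch q (a * q * x⁻¹) = A2 at *
  generalize qPoch q (b * q * x⁻¹) = B2 at *
  generalize qPoch q (c * q * x⁻¹) = C2 at *
  generalize qPoch q (d * q * x⁻¹) = D2 at *
  generalize qPoch q ((q * x) ^ 2) = P at *
  generalize qPoch q (q * x⁻¹ ^ 2) = Q at *
  have e1 : ∀ e, 1 - e * x⁻¹ = (x - e) * x⁻¹ := fun e => by field_simp
  simp only [e1, mul_inv]
  field_simp
  ring

/-! ### The total mass up to a constant -/

section Moments

variable {q : ℂ} {Γ : ℝ → ℂ} {a b c d : ℂ}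

lemma IsLoop.ne_zero (h : IsLoop Γ) {x : ℂ} (hx : x ∈ trace Γ) : x ≠ 0 :=
  fun h' => h.zero_notMem (h' ▸ hx)

lemma IsAWContour.rotate (h : IsAWContour q Γ a b c d) : IsAWContour q Γ b c d a :=
  ⟨h.loop, h.hb, h.hc, h.hd, h.ha⟩

lemma IsAWContour.swap (h : IsAWContour q Γ a b c d) : IsAWContour q Γ b a c d :=
  ⟨h.loop, h.hb, h.ha, h.hc, h.hd⟩

lemma IsAWContour.shift (hq0 : q ≠ 0) (h : IsAWContour q Γ a b c d) (i j k l : ℕ) :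
    IsAWContour q Γ (a * q ^ i) (b * q ^ j) (c * q ^ k) (d * q ^ l) :=
  ⟨h.loop, h.ha.mul_pow hq0 i, h.hb.mul_pow hq0 j, h.hc.mul_pow hq0 k, h.hd.mul_pow hq0 l⟩

lemma awWeight_rotate (q a b c d x : ℂ) : awWeight q b c d a x = awWeight q a b c d x := by
  simp only [awWeight]; ring

lemma awWeight_swap (q a b c d x : ℂ) : awWeight q b a c d x = awWeight q a b c d x := by
  simp only [awWeight]; ring

lemma continuousOn_awInt (hq : ‖q‖ < 1) (h : IsAWContour q Γ a b c d) {f : ℂ → ℂ}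
    (hf : ContinuousOn f (trace Γ)) :
    ContinuousOn (fun x => f x * awWeight q a b c d x / x) (trace Γ) :=
  (hf.mul (continuousOn_awWeight hq h)).div continuousOn_id fun _ hx => h.loop.ne_zero hx

lemma awInt_add (hq : ‖q‖ < 1) (h : IsAWContour q Γ a b c d) {f g : ℂ → ℂ}
    (hf : ContinuousOn f (trace Γ)) (hg : ContinuousOn g (trace Γ)) :
    awInt q Γ a b c d (fun x => f x + g x) = awInt q Γ a b c d f + awInt q Γ a b c d g := by
  simp only [awInt]
  rw [← contourIntegral_add h.loop.lip (continuousOn_awInt hq h hf) (continuousOn_awInt hq h hg)]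
  congr 1; funext x; ring

lemma awInt_const_mul (q : ℂ) (Γ : ℝ → ℂ) (a b c d e : ℂ) (f : ℂ → ℂ) :
    awInt q Γ a b c d (fun x => e * f x) = e * awInt q Γ a b c d f := by
  simp only [awInt]
  rw [← contourIntegral_const_mul]
  congr 1; funext x; ring

lemma awInt_sum (hq : ‖q‖ < 1) (h : IsAWContour q Γ a b c d) {ι : Type*} (s : Finset ι)
    {f : ι → ℂ → ℂ} (hf : ∀ i ∈ s, ContinuousOn (f i) (trace Γ)) :
    awInt q Γ a b c d (fun x => ∑ i ∈ s, f i x) = ∑ i ∈ s, awInt q Γ a b c d (f i) := by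
  simp only [awInt]
  rw [← contourIntegral_sum h.loop.lip s fun i hi => continuousOn_awInt hq h (hf i hi)]
  simp only [Finset.sum_mul, Finset.sum_div]

lemma awInt_congr {f g : ℂ → ℂ} (hfg : EqOn f g (trace Γ)) :
    awInt q Γ a b c d f = awInt q Γ a b c d g :=
  contourIntegral_congr fun x hx => by simp only [hfg hx]

lemma awWeight_mul (hq : ‖q‖ < 1) (h : IsAWContour q Γ a b c d) {x : ℂ} (hx : x ∈ trace Γ) :
    awWeight q (a * q) b c d x = (1 - a * x) * (1 - a * x⁻¹) * awWeight q a b c d x := by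
  have h1 := h.ha.qPoch_mul_ne hq hx
  have h2 := h.ha.qPoch_div_ne hq h.loop.zero_notMem hx
  have k1 : qPoch q (a * x) = (1 - a * x) * qPoch q (a * q * x) := by
    rw [qPoch_eq_mul hq]; ring_nf
  have k2 : qPoch q (a * x⁻¹) = (1 - a * x⁻¹) * qPoch q (a * q * x⁻¹) := by
    rw [qPoch_eq_mul hq]; ring_nf
  rw [k1] at h1
  rw [k2] at h2
  have h3 := left_ne_zero_of_mul h1
  have h4 := left_ne_zero_of_mul h2
  simp only [awWeight]
  rw [k1, k2]
  generalize 1 - a * x = u at *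
  generalize 1 - a * x⁻¹ = v at *
  simp only [div_eq_mul_inv, mul_inv]
  field_simp

lemma awInt_mul (hq : ‖q‖ < 1) (h : IsAWContour q Γ a b c d) (f : ℂ → ℂ) :
    awInt q Γ (a * q) b c d f =
      awInt q Γ a b c d (fun x => (1 - a * x) * (1 - a * x⁻¹) * f x) :=
  contourIntegral_congr fun x hx => by
    simp only [awWeight_mul hq h hx]; ring

/-- The total mass of the Askey-Wilson functional. -/
noncomputable def awMass (q : ℂ) (Γ : ℝ → ℂ) (a b c d : ℂ) : ℂ := awInt q Γ a b c d fun _ => 1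

lemma awMass_rotate (q : ℂ) (Γ : ℝ → ℂ) (a b c d : ℂ) :
    awMass q Γ b c d a = awMass q Γ a b c d := by
  simp only [awMass, awInt, awWeight_rotate]

lemma awMass_swap (q : ℂ) (Γ : ℝ → ℂ) (a b c d : ℂ) :
    awMass q Γ b a c d = awMass q Γ a b c d := by
  simp only [awMass, awInt, awWeight_swap]

lemma IsLoop.continuousOn_inv (h : IsLoop Γ) : ContinuousOn (fun x : ℂ => x⁻¹) (trace Γ) :=
  continuousOn_id.inv₀ fun _ hx => h.ne_zero hx

/-- The inserted factor `(1 - ax)(1 - a/x)` equals `1 + a² - a(x + 1/x)`, and the first moment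
relation evaluates the integral of `x + 1/x` in terms of the mass. -/
lemma awMass_mul (hq0 : q ≠ 0) (hq : ‖q‖ < 1) (h : IsAWContour q Γ a b c d) :
    (1 - a * b * c * d) * awMass q Γ (a * q) b c d =
      (1 - a * b) * (1 - a * c) * (1 - a * d) * awMass q Γ a b c d := by
  have h1 := awInt_first_moment hq0 hq h
  have hc := h.loop.continuousOn_inv
  rw [awMass, awMass, awInt_mul hq h, ← awInt_const_mul, ← awInt_const_mul]
  have h2 : awInt q Γ a b c d (fun x => (1 - a * b * c * d) * ((1 - a * x) * (1 - a * x⁻¹) * 1))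
      = awInt q Γ a b c d (fun x => (1 - a * b) * (1 - a * c) * (1 - a * d) * 1 +
        (-a) * ((1 - a * b * c * d) * (x + x⁻¹) +
      (a * b * c + a * b * d + a * c * d + b * c * d - a - b - c - d))) := by
    refine awInt_congr fun x hx => ?_
    have hx0 := h.loop.ne_zero hx
    field_simp
    ring
  rw [h2, awInt_add hq h (g := fun x => (-a) * ((1 - a * b * c * d) * (x + x⁻¹) +
      (a * b * c + a * b * d + a * c * d + b * c * d - a - b - c - d))) (by fun_prop)
      (by fun_prop), awInt_const_mul (e := -a), h1]
  ring

/-- The product `(ab, ac, ad, bc, bd, cd; q)_∞`. -/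
noncomputable def pairProd (q a b c d : ℂ) : ℂ :=
  qPoch q (a * b) * qPoch q (a * c) * qPoch q (a * d) * qPoch q (b * c) * qPoch q (b * d) *
    qPoch q (c * d)

/-- The normalized total mass. -/
noncomputable def awRatio (q : ℂ) (Γ : ℝ → ℂ) (a b c d : ℂ) : ℂ :=
  awMass q Γ a b c d * pairProd q a b c d / qPoch q (a * b * c * d)

lemma awRatio_rotate (q : ℂ) (Γ : ℝ → ℂ) (a b c d : ℂ) :
    awRatio q Γ b c d a = awRatio q Γ a b c d := by
  have e : b * c * d * a = a * b * c * d := by ring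
  simp only [awRatio, awMass_rotate, pairProd, e, mul_comm b a, mul_comm c a, mul_comm d a]
  ring

/-- The infinite products in `awRatio` are chosen so that `(1 - ab)(1 - ac)(1 - ad) / (1 - abcd)`,
the factor in the contiguous relation, cancels. -/
lemma awRatio_mul (hq0 : q ≠ 0) (hq : ‖q‖ < 1) (h : IsAWContour q Γ a b c d)
    (hne : ∀ n : ℕ, 1 - a * b * c * d * q ^ n ≠ 0) :
    awRatio q Γ (a * q) b c d = awRatio q Γ a b c d := by
  have h1 := awMass_mul hq0 hq h
  have n1 : qPoch q (a * b * c * d) ≠ 0 := qPoch_ne_zero hq hne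
  have e : ∀ z, qPoch q (a * z) = (1 - a * z) * qPoch q (a * q * z) := fun z => by
    rw [qPoch_eq_mul hq]; ring_nf
  have e4 : qPoch q (a * b * c * d) = (1 - a * b * c * d) * qPoch q (a * q * b * c * d) := by
    rw [qPoch_eq_mul hq]; ring_nf
  rw [e4] at n1
  have n2 := left_ne_zero_of_mul n1
  have n3 := right_ne_zero_of_mul n1
  simp only [awRatio, pairProd]
  rw [e4, e b, e c, e d, div_eq_div_iff n3 n1]
  linear_combination qPoch q (a * q * b) * qPoch q (a * q * c) * qPoch q (a * q * d) *
    qPoch q (b * c) * qPoch q (b * d) * qPoch q (c * d) * qPoch q (a * q * b * c * d) * h1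

lemma awRatio_mul_pow (hq0 : q ≠ 0) (hq : ‖q‖ < 1) (h : IsAWContour q Γ a b c d)
    (hne : ∀ n : ℕ, 1 - a * b * c * d * q ^ n ≠ 0) (n : ℕ) :
    awRatio q Γ (a * q ^ n) b c d = awRatio q Γ a b c d := by
  induction n with
  | zero => simp
  | succ n ih =>
    have h' : IsAWContour q Γ (a * q ^ n) b c d := by simpa using h.shift hq0 n 0 0 0
    rw [← ih, ← awRatio_mul hq0 hq h' fun k => ?_, pow_succ, mul_assoc]
    have := hne (n + k)
    rw [pow_add] at this
    convert! this using 2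
    ring

lemma awRatio_shift (hq0 : q ≠ 0) (hq : ‖q‖ < 1) (h : IsAWContour q Γ a b c d)
    (hne : ∀ n : ℕ, 1 - a * b * c * d * q ^ n ≠ 0) (n : ℕ) :
    awRatio q Γ (a * q ^ n) (b * q ^ n) (c * q ^ n) (d * q ^ n) = awRatio q Γ a b c d := by
  -- One parameter is shifted and the four are rotated; after four rounds every parameter is shifted
  -- and the order is restored.
  have key : ∀ {a b c d : ℂ}, IsAWContour q Γ a b c d →
      (∀ n : ℕ, 1 - a * b * c * d * q ^ n ≠ 0) →
      IsAWContour q Γ b c d (a * q ^ n) ∧ (∀ k : ℕ, 1 - b * c * d * (a * q ^ n) * q ^ k ≠ 0) ∧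
      awRatio q Γ b c d (a * q ^ n) = awRatio q Γ a b c d := by
    intro a b c d h hne
    refine ⟨by simpa using (h.shift hq0 n 0 0 0).rotate, fun k => ?_, ?_⟩
    · have := hne (n + k)
      rw [pow_add] at this
      convert! this using 2
      ring
    · rw [awRatio_rotate, awRatio_mul_pow hq0 hq h hne]
  obtain ⟨h1, n1, e1⟩ := key h hne
  obtain ⟨h2, n2, e2⟩ := key h1 n1
  obtain ⟨h3, n3, e3⟩ := key h2 n2
  obtain ⟨h4, n4, e4⟩ := key h3 n3
  rw [e4, e3, e2, e1]

lemma tendstoUniformlyOn_qPoch_one (hq : ‖q‖ < 1) {K : Set ℂ} (hK : IsCompact K) {g : ℂ → ℂ}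
    (hg : ContinuousOn g K) :
    TendstoUniformlyOn (fun (n : ℕ) x => qPoch q (g x * q ^ n)) (fun _ => 1) atTop K := by
  obtain ⟨M, hM⟩ := hK.exists_bound_of_continuousOn hg
  rw [Metric.tendstoUniformlyOn_iff]
  intro ε hε
  obtain ⟨δ, hδ, hd⟩ := Metric.continuous_iff.mp (continuous_qPoch hq) 0 ε hε
  have hlim : Tendsto (fun n : ℕ => M * ‖q‖ ^ n) atTop (𝓝 0) := by
    simpa using (tendsto_pow_atTop_nhds_zero_of_lt_one (norm_nonneg _) hq).const_mul M
  filter_upwards [hlim.eventually_lt_const hδ] with n hn x hx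
  rw [dist_comm, ← qPoch_zero q]
  refine hd _ ?_
  rw [dist_zero_right, norm_mul, norm_pow]
  exact (mul_le_mul_of_nonneg_right (hM x hx) (by positivity)).trans_lt hn

/-- The total mass for vanishing parameters. -/
noncomputable def awMassZero (q : ℂ) (Γ : ℝ → ℂ) : ℂ :=
  contourIntegral Γ fun x => qPoch q (x ^ 2) * qPoch q (x⁻¹ ^ 2) * x⁻¹

/-- The contour stays fixed while all parameters tend to zero: the enclosure conditions are
inherited by `e q^n`, and the denominator of the weight tends to `1` uniformly on the curve. -/
lemma tendsto_awMass (hq0 : q ≠ 0) (hq : ‖q‖ < 1) (h : IsAWContour q Γ a b c d) :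
    Tendsto (fun n : ℕ => awMass q Γ (a * q ^ n) (b * q ^ n) (c * q ^ n) (d * q ^ n)) atTop
      (𝓝 (awMassZero q Γ)) := by
  have hK := isCompact_trace h.loop.lip
  have hi := h.loop.continuousOn_inv
  set N : ℂ → ℂ := fun x => qPoch q (x ^ 2) * qPoch q (x⁻¹ ^ 2) * x⁻¹ with hN
  set F : ℕ → ℂ → ℂ := fun n x => 1 * awWeight q (a * q ^ n) (b * q ^ n) (c * q ^ n) (d * q ^ n) x
    / x with hF
  have hFc : ∀ n, ContinuousOn (F n) (trace Γ) := fun n =>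
    continuousOn_awInt hq (h.shift hq0 n n n n) (f := fun _ => 1) continuousOn_const
  suffices hFN : TendstoUniformlyOn F N atTop (trace Γ) by
    have := tendsto_contourIntegral h.loop.lip hFc hFN
    simp only [awMass, awInt, awMassZero]
    exact this
  rw [← tendstoLocallyUniformlyOn_iff_tendstoUniformlyOn_of_compact hK]
  have hNc : ContinuousOn N (trace Γ) :=
    (((continuous_qPoch hq).comp_continuousOn (by fun_prop)).mul
      ((continuous_qPoch hq).comp_continuousOn (hi.pow 2))).mul hi
  have hone : ∀ x ∈ trace Γ, (1 : ℂ) ≠ 0 := fun _ _ => one_ne_zero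
  have hfac : ∀ g : ℂ → ℂ, ContinuousOn g (trace Γ) → TendstoLocallyUniformlyOn
      (fun (n : ℕ) x => (qPoch q (g x * q ^ n))⁻¹) (fun _ => 1) atTop (trace Γ) := fun g hg => by
    simpa using (tendstoUniformlyOn_qPoch_one hq hK hg).tendstoLocallyUniformlyOn.fun_inv₀
      continuousOn_const hone
  have hmul : ∀ {F G : ℕ → ℂ → ℂ} {u : ℂ → ℂ}, ContinuousOn u (trace Γ) →
      TendstoLocallyUniformlyOn F u atTop (trace Γ) →
      TendstoLocallyUniformlyOn G (fun _ => 1) atTop (trace Γ) →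
      TendstoLocallyUniformlyOn (fun n x => F n x * G n x) u atTop (trace Γ) := by
    intro F G u hu hF hG
    simpa using hF.fun_mul₀ hG hu continuousOn_const
  have hcst : TendstoLocallyUniformlyOn (fun _ : ℕ => N) N atTop (trace Γ) :=
    fun _ hu _ _ => ⟨trace Γ, self_mem_nhdsWithin,
      Eventually.of_forall fun _ _ _ => refl_mem_uniformity hu⟩
  set D : ℂ → ℕ → ℂ → ℂ := fun e n x =>
    (qPoch q (e * x * q ^ n))⁻¹ * (qPoch q (e * x⁻¹ * q ^ n))⁻¹ with hD
  have hDt : ∀ e, TendstoLocallyUniformlyOn (D e) (fun _ => 1) atTop (trace Γ) := fun e =>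
    hmul continuousOn_const (hfac (fun x => e * x) (by fun_prop))
      (hfac (fun x => e * x⁻¹) (by fun_prop))
  have h1 : TendstoLocallyUniformlyOn (fun n x => N x * D a n x) N atTop (trace Γ) :=
    hmul hNc hcst (hDt a)
  have h2 : TendstoLocallyUniformlyOn (fun n x => N x * D a n x * D b n x) N atTop (trace Γ) :=
    hmul hNc h1 (hDt b)
  have h3 : TendstoLocallyUniformlyOn (fun n x => N x * D a n x * D b n x * D c n x) N atTop
    (trace Γ) := hmul hNc h2 (hDt c)
  have h4 : TendstoLocallyUniformlyOn (fun n x => N x * D a n x * D b n x * D c n x * D d n x) N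
    atTop (trace Γ) := hmul hNc h3 (hDt d)
  refine h4.congr fun n x _ => ?_
  have e1 : ∀ e y : ℂ, e * q ^ n * y = e * y * q ^ n := fun e y => mul_right_comm _ _ _
  simp only [hF, hN, hD, awWeight, div_eq_mul_inv, mul_inv, e1]
  ring

/-- Shift invariance makes the sequence of ratios at `a q^n, b q^n, c q^n, d q^n` constant, and its
limit no longer involves the parameters. This is the Askey-Wilson integral up to a constant factor,
which is all that is needed. -/
lemma awRatio_eq (hq0 : q ≠ 0) (hq : ‖q‖ < 1) (h : IsAWContour q Γ a b c d)
    (hne : ∀ n : ℕ, 1 - a * b * c * d * q ^ n ≠ 0) :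
    awRatio q Γ a b c d = awMassZero q Γ := by
  have ht : ∀ e f : ℂ, Tendsto (fun n : ℕ => qPoch q (e * q ^ n * (f * q ^ n))) atTop (𝓝 1) := by
    intro e f
    have h1 : Tendsto (fun n : ℕ => e * q ^ n * (f * q ^ n)) atTop (𝓝 0) := by
      have := tendsto_pow_atTop_nhds_zero_of_norm_lt_one hq
      simpa using (this.const_mul e).mul (this.const_mul f)
    rw [← qPoch_zero q]
    exact ((continuous_qPoch hq).tendsto 0).comp h1
  have ht4 : Tendsto (fun n : ℕ => qPoch q (a * q ^ n * (b * q ^ n) * (c * q ^ n) * (d * q ^ n)))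
      atTop (𝓝 1) := by
    have h1 : Tendsto (fun n : ℕ => a * q ^ n * (b * q ^ n) * (c * q ^ n) * (d * q ^ n))
        atTop (𝓝 0) := by
      have := tendsto_pow_atTop_nhds_zero_of_norm_lt_one hq
      simpa using (((this.const_mul a).mul (this.const_mul b)).mul (this.const_mul c)).mul
        (this.const_mul d)
    rw [← qPoch_zero q]
    exact ((continuous_qPoch hq).tendsto 0).comp h1
  have hlim := ((tendsto_awMass hq0 hq h).mul ((((((ht a b).mul (ht a c)).mul (ht a d)).mul
    (ht b c)).mul (ht b d)).mul (ht c d))).div ht4 one_ne_zero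
  simp only [mul_one, div_one] at hlim
  refine tendsto_nhds_unique (tendsto_const_nhds.congr fun n => ?_) hlim
  exact (awRatio_shift hq0 hq h hne n).symm

end Moments

/-! ### Nonvanishing of the total mass -/

/-- The unit circle. -/
noncomputable def unitCurve (s : ℝ) : ℂ := Complex.exp (2 * Real.pi * Complex.I * s)

lemma hasDerivAt_unitCurve (s : ℝ) :
    HasDerivAt unitCurve (unitCurve s * (2 * Real.pi * Complex.I)) s := by
  have h1 : HasDerivAt (fun s : ℝ => 2 * Real.pi * Complex.I * (s : ℂ)) (2 * Real.pi * Complex.I) s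
      := by
    simpa using (Complex.ofRealCLM.hasDerivAt (x := s)).const_mul (2 * Real.pi * Complex.I)
  exact h1.cexp

lemma norm_unitCurve (s : ℝ) : ‖unitCurve s‖ = 1 := by
  rw [unitCurve, Complex.norm_exp]
  simp

lemma norm_of_mem_trace_unitCurve {x : ℂ} (hx : x ∈ trace unitCurve) : ‖x‖ = 1 := by
  obtain ⟨s, -, rfl⟩ := hx
  exact norm_unitCurve s

lemma isLoop_unitCurve : IsLoop unitCurve := by
  have hlip : IsClosedLipschitz unitCurve := by
    refine ⟨⟨Real.toNNReal (2 * Real.pi), ?_⟩, ?_⟩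
    · refine (convex_Icc (0 : ℝ) 1).lipschitzOnWith_of_nnnorm_hasDerivWithin_le
        (fun s _ => (hasDerivAt_unitCurve s).hasDerivWithinAt) fun s _ => ?_
      rw [← NNReal.coe_le_coe, Real.coe_toNNReal _ (by positivity)]
      simp [norm_unitCurve, abs_of_pos Real.pi_pos]
    · simp [unitCurve]
  refine ⟨hlip, fun h => by simpa using norm_of_mem_trace_unitCurve h, ?_⟩
  rw [winding, contourIntegral]
  have : ∀ s : ℝ, (unitCurve s - 0)⁻¹ * deriv unitCurve s = 2 * Real.pi * Complex.I := fun s => by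
    have h0 : unitCurve s ≠ 0 := Complex.exp_ne_zero _
    rw [(hasDerivAt_unitCurve s).deriv, sub_zero, inv_mul_cancel_left₀ h0]
  rw [intervalIntegral.integral_congr fun s _ => this s, intervalIntegral.integral_const, sub_zero,
    one_smul]
  exact inv_mul_cancel₀ Complex.two_pi_I_ne_zero

lemma enclosed_unitCurve {q e : ℂ} (hq0 : q ≠ 0) (hq : ‖q‖ < 1) (he0 : e ≠ 0) (he : ‖e‖ < 1) :
    Enclosed q unitCurve e := by
  refine ⟨he0, fun k => ?_⟩
  have h0 : e * q ^ k ≠ 0 := mul_ne_zero he0 (pow_ne_zero _ hq0)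
  have h1 : ‖e * q ^ k‖ < 1 := by
    rw [norm_mul, norm_pow]
    exact mul_lt_one_of_nonneg_of_lt_one_left (norm_nonneg _) he
      (pow_le_one₀ (norm_nonneg _) hq.le)
  have h2 : 1 < ‖(e * q ^ k)⁻¹‖ := by
    rw [norm_inv]
    exact (one_lt_inv₀ (norm_pos_iff.mpr h0)).mpr h1
  have hn : e * q ^ k ∉ trace unitCurve := fun h => h1.ne (norm_of_mem_trace_unitCurve h)
  refine ⟨hn, ?_, fun h => h2.ne' (norm_of_mem_trace_unitCurve h), ?_⟩
  · rw [winding_eq_of_near isLoop_unitCurve.lip isLoop_unitCurve.zero_notMem hn fun x hx => ?_,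
      isLoop_unitCurve.winding_zero]
    simpa [norm_of_mem_trace_unitCurve hx] using h1
  · exact winding_eq_zero_of_norm_lt isLoop_unitCurve.lip fun x hx => by
      rwa [norm_of_mem_trace_unitCurve hx]

/-- Without parameters the only pole is the origin, so winding once around it is all that matters.
-/
lemma awMassZero_eq {q : ℂ} (hq : ‖q‖ < 1) {Γ₁ Γ₂ : ℝ → ℂ} (h₁ : IsLoop Γ₁) (h₂ : IsLoop Γ₂) :
    awMassZero q Γ₁ = awMassZero q Γ₂ := by
  have hS : SameWinding {0} Γ₁ Γ₂ := by
    refine ⟨h₁.lip, h₂.lip, ?_, ?_, ?_⟩ <;> rintro p rfl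
    · exact h₁.zero_notMem
    · exact h₂.zero_notMem
    · rw [h₁.winding_zero, h₂.winding_zero]
  have hK := (isCompact_trace h₁.lip).union (isCompact_trace h₂.lip)
  have hx0 : ∀ x ∈ trace Γ₁ ∪ trace Γ₂, x ≠ 0 := fun x hx h => hS.notMem rfl (h ▸ hx)
  have hi : ContinuousOn (fun x : ℂ => x⁻¹) (trace Γ₁ ∪ trace Γ₂) := continuousOn_id.inv₀ hx0
  have hinv : IsRat {0} fun x : ℂ => x⁻¹ := by
    simpa using IsRat.inv_sub (S := {0}) (p := 0) rfl
  refine (IsRatLimit.sameIntegral hS (((IsRatLimit.qPoch hq hK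
    ((IsRat.id.mul IsRat.id).congr fun x _ => pow_two x) (by fun_prop)).mul (IsRatLimit.qPoch hq hK
    ((hinv.mul hinv).congr fun x _ => pow_two x⁻¹) (hi.pow 2))).mul
    (IsRatLimit.of_isRat hinv hi))).2

lemma one_sub_ne_zero_of_norm_lt {z : ℂ} (hz : ‖z‖ < 1) : 1 - z ≠ 0 := by
  intro h
  rw [← sub_eq_zero.mp h] at hz
  simp at hz

lemma qPoch_ne_zero_of_norm_lt {q z : ℂ} (hq : ‖q‖ < 1) (hz : ‖z‖ < 1) : qPoch q z ≠ 0 := by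
  refine qPoch_ne_zero hq fun k => one_sub_ne_zero_of_norm_lt ?_
  rw [norm_mul, norm_pow]
  exact mul_lt_one_of_nonneg_of_lt_one_left (norm_nonneg _) hz (pow_le_one₀ (norm_nonneg _) hq.le)

/-- For the parameters `q, -q, q^(1/2), -q^(1/2)` the splitting `qPoch_sq` collapses the weight to
`(1 - x²)(1 - x⁻²) = 2 - x² - x⁻²`, whose constant term is `2`. -/
lemma awMass_unitCurve {r : ℂ} (hr0 : r ≠ 0) (hr : ‖r‖ < 1) :
    awMass (r ^ 2) unitCurve (r ^ 2) (-r ^ 2) r (-r) = 2 := by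
  have hq : ‖r ^ 2‖ < 1 := by rw [norm_pow]; exact pow_lt_one₀ (norm_nonneg _) hr two_ne_zero
  have hq0 : r ^ 2 ≠ 0 := pow_ne_zero _ hr0
  have hL := isLoop_unitCurve
  have hE : ∀ e : ℂ, e ≠ 0 → ‖e‖ < 1 → ∀ x ∈ trace unitCurve,
      qPoch (r ^ 2) (e * x) ≠ 0 ∧ qPoch (r ^ 2) (e * x⁻¹) ≠ 0 := fun e he0 he x hx =>
    ⟨(enclosed_unitCurve hq0 hq he0 he).qPoch_mul_ne hq hx,
      (enclosed_unitCurve hq0 hq he0 he).qPoch_div_ne hq hL.zero_notMem hx⟩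
  have hw : EqOn (fun x => 1 * awWeight (r ^ 2) (r ^ 2) (-r ^ 2) r (-r) x / x)
      (fun x => 2 * (x - 0)⁻¹ + (-1) * (x + (x ^ 3)⁻¹)) (trace unitCurve) := by
    intro x hx
    have hx0 := hL.ne_zero hx
    obtain ⟨a1, a2⟩ := hE (r ^ 2) hq0 hq x hx
    obtain ⟨b1, b2⟩ := hE (-r ^ 2) (neg_ne_zero.mpr hq0) (by simpa using hq) x hx
    obtain ⟨c1, c2⟩ := hE r hr0 hr x hx
    obtain ⟨d1, d2⟩ := hE (-r) (neg_ne_zero.mpr hr0) (by simpa using hr) x hx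
    have key : ∀ y : ℂ, qPoch (r ^ 2) (y ^ 2) = (1 - y ^ 2) * (qPoch (r ^ 2) (r ^ 2 * y) *
        qPoch (r ^ 2) (-r ^ 2 * y) * qPoch (r ^ 2) (r * y) * qPoch (r ^ 2) (-r * y)) := by
      intro y
      rw [qPoch_sq hq, qPoch_eq_mul hq y, qPoch_eq_mul hq (-y)]
      have e1 : y * r ^ 2 = r ^ 2 * y := mul_comm _ _
      have e2 : -y * r ^ 2 = -r ^ 2 * y := by ring
      rw [e1, e2, ← neg_mul]
      ring
    simp only [awWeight]
    rw [key x, key x⁻¹]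
    generalize qPoch (r ^ 2) (r ^ 2 * x) = A1 at *
    generalize qPoch (r ^ 2) (-r ^ 2 * x) = A2 at *
    generalize qPoch (r ^ 2) (r * x) = A3 at *
    generalize qPoch (r ^ 2) (-r * x) = A4 at *
    generalize qPoch (r ^ 2) (r ^ 2 * x⁻¹) = B1 at *
    generalize qPoch (r ^ 2) (-r ^ 2 * x⁻¹) = B2 at *
    generalize qPoch (r ^ 2) (r * x⁻¹) = B3 at *
    generalize qPoch (r ^ 2) (-r * x⁻¹) = B4 at *
    field_simp
    ring
  rw [awMass, awInt, contourIntegral_congr hw]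
  have hc : ContinuousOn (fun x : ℂ => x + (x ^ 3)⁻¹) (trace unitCurve) :=
    continuousOn_id.add ((continuousOn_id.pow 3).inv₀ fun x hx => pow_ne_zero _ (hL.ne_zero hx))
  have hprim : contourIntegral unitCurve (fun x : ℂ => x + (x ^ 3)⁻¹) = 0 := by
    refine contourIntegral_eq_zero_of_primitive hL.lip
      (F := fun x => x ^ 2 / 2 + (-1 / 2) * (x ^ 2)⁻¹) (fun x hx => ?_) fun x hx => ?_
    · exact ((analyticAt_id.pow 2).div analyticAt_const two_ne_zero).add
        (analyticAt_const.mul ((analyticAt_id.pow 2).inv (pow_ne_zero _ (hL.ne_zero hx))))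
    · have hx0 := hL.ne_zero hx
      have h1 : HasDerivAt (fun x : ℂ => x ^ 2) (2 * x) x := by simpa using hasDerivAt_pow 2 x
      have := (h1.div_const 2).add ((h1.inv (pow_ne_zero _ hx0)).const_mul (-1 / 2))
      refine this.deriv.trans ?_
      field_simp
  rw [contourIntegral_add hL.lip (f := fun x => 2 * (x - 0)⁻¹)
    (g := fun x => (-1) * (x + (x ^ 3)⁻¹))
    (continuousOn_const.mul (continuousOn_inv_sub hL.zero_notMem)) (continuousOn_const.mul hc),
    contourIntegral_const_mul, contourIntegral_const_mul, hprim]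
  change 2 * winding unitCurve 0 + _ = _
  rw [hL.winding_zero]
  ring

/-- Transfer to the unit circle, where the special parameters above have a known nonzero mass; all
products `ef` there have modulus less than one, so the normalizing factors are nonzero. -/
lemma awMassZero_ne_zero {r : ℂ} (hr0 : r ≠ 0) (hr : ‖r‖ < 1) {Γ : ℝ → ℂ} (hΓ : IsLoop Γ) :
    awMassZero (r ^ 2) Γ ≠ 0 := by
  have hq : ‖r ^ 2‖ < 1 := by rw [norm_pow]; exact pow_lt_one₀ (norm_nonneg _) hr two_ne_zero
  have hq0 : r ^ 2 ≠ 0 := pow_ne_zero _ hr0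
  have hA : IsAWContour (r ^ 2) unitCurve (r ^ 2) (-r ^ 2) r (-r) :=
    ⟨isLoop_unitCurve, enclosed_unitCurve hq0 hq hq0 hq,
      enclosed_unitCurve hq0 hq (neg_ne_zero.mpr hq0) (by simpa using hq),
      enclosed_unitCurve hq0 hq hr0 hr,
      enclosed_unitCurve hq0 hq (neg_ne_zero.mpr hr0) (by simpa using hr)⟩
  have hlt : ∀ {u v : ℂ}, ‖u‖ < 1 → ‖v‖ < 1 → ‖u * v‖ < 1 := fun hu hv => by
    rw [norm_mul]; exact mul_lt_one_of_nonneg_of_lt_one_left (norm_nonneg _) hu hv.le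
  have hn : ∀ {u : ℂ}, ‖u‖ < 1 → ‖-u‖ < 1 := fun hu => by simpa using hu
  have hp4 : ‖r ^ 2 * -r ^ 2 * r * -r‖ < 1 := hlt (hlt (hlt hq (hn hq)) hr) (hn hr)
  rw [awMassZero_eq hq hΓ isLoop_unitCurve, ← awRatio_eq hq0 hq hA fun n => ?_, awRatio,
    awMass_unitCurve hr0 hr, pairProd]
  · have Q := fun {z : ℂ} (hz : ‖z‖ < 1) => qPoch_ne_zero_of_norm_lt hq hz
    exact div_ne_zero (mul_ne_zero two_ne_zero (mul_ne_zero (mul_ne_zero (mul_ne_zero (mul_ne_zero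
      (mul_ne_zero (Q (hlt hq (hn hq))) (Q (hlt hq hr))) (Q (hlt hq (hn hr))))
      (Q (hlt (hn hq) hr))) (Q (hlt (hn hq) (hn hr)))) (Q (hlt hr (hn hr))))) (Q hp4)
  · refine one_sub_ne_zero_of_norm_lt ?_
    rw [norm_mul, norm_pow]
    exact mul_lt_one_of_nonneg_of_lt_one_left (norm_nonneg _) hp4
      (pow_le_one₀ (norm_nonneg _) hq.le)

lemma awMass_ne_zero {r : ℂ} (hr0 : r ≠ 0) (hr : ‖r‖ < 1) {Γ : ℝ → ℂ} {a b c d : ℂ}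
    (h : IsAWContour (r ^ 2) Γ a b c d) (hne : ∀ n : ℕ, 1 - a * b * c * d * (r ^ 2) ^ n ≠ 0) :
    awMass (r ^ 2) Γ a b c d ≠ 0 := by
  have hq : ‖r ^ 2‖ < 1 := by rw [norm_pow]; exact pow_lt_one₀ (norm_nonneg _) hr two_ne_zero
  have h1 := awRatio_eq (pow_ne_zero _ hr0) hq h hne
  intro h0
  refine awMassZero_ne_zero hr0 hr h.loop ?_
  rw [← h1, awRatio, h0, zero_mul, zero_div]

/-! ### Mixed moments and orthogonality -/

/-- The symmetric function `(e x, e x⁻¹; q)_j`. -/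
noncomputable def symFact (q e : ℂ) (j : ℕ) (x : ℂ) : ℂ := qFact q (e * x) j * qFact q (e * x⁻¹) j

lemma symFact_zero (q e x : ℂ) : symFact q e 0 x = 1 := by simp [symFact, qFact_zero]

lemma symFact_succ (q e : ℂ) (j : ℕ) (x : ℂ) :
    symFact q e (j + 1) x = (1 - e * q ^ j * x) * (1 - e * q ^ j * x⁻¹) * symFact q e j x := by
  simp only [symFact, qFact_succ]
  ring

/-- The eigenvalues of the Askey-Wilson operator, where `κ = abcd / q`. -/
noncomputable def awEigen (q κ : ℂ) (j : ℕ) : ℂ := ((q ^ j)⁻¹ - 1) * (1 - κ * q ^ j)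

/-- The lowering coefficients of the Askey-Wilson operator on the functions `(a x, a x⁻¹; q)_j`. -/
noncomputable def awLower (q a b c d : ℂ) (j : ℕ) : ℂ :=
  -((q ^ j)⁻¹ - 1) * (1 - a * b * q ^ j / q) * (1 - a * c * q ^ j / q) * (1 - a * d * q ^ j / q)

lemma awLower_zero (q a b c d : ℂ) : awLower q a b c d 0 = 0 := by simp [awLower]

lemma awEigen_sub {q κ : ℂ} (hq0 : q ≠ 0) {m j : ℕ} (h : j ≤ m) :
    awEigen q κ m - awEigen q κ j = (q ^ m)⁻¹ * (1 - q ^ (m - j)) * (1 - κ * q ^ (m + j)) := by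
  obtain ⟨n, rfl⟩ := Nat.exists_eq_add_of_le h
  have := pow_ne_zero n hq0
  have := pow_ne_zero j hq0
  simp only [awEigen, Nat.add_sub_cancel_left, pow_add]
  field_simp
  ring

lemma one_sub_pow_ne_zero {q : ℂ} (hq : ‖q‖ < 1) (n : ℕ) : 1 - q ^ (n + 1) ≠ 0 :=
  one_sub_ne_zero_of_norm_lt (by
    rw [norm_pow]; exact pow_lt_one₀ (norm_nonneg _) hq (Nat.succ_ne_zero n))

section Functional

variable {q : ℂ} {Γ : ℝ → ℂ} {a b c d κ : ℂ}

lemma IsLoop.continuousOn_symFact (h : IsLoop Γ) (q e : ℂ) (j : ℕ) :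
    ContinuousOn (symFact q e j) (trace Γ) := by
  have hc := h.continuousOn_inv
  unfold symFact qFact
  fun_prop

lemma awInt_mul_pow (hq0 : q ≠ 0) (hq : ‖q‖ < 1) (h : IsAWContour q Γ a b c d) (f : ℂ → ℂ)
    (i : ℕ) : awInt q Γ (a * q ^ i) b c d f =
      awInt q Γ a b c d (fun x => symFact q a i x * f x) := by
  induction i generalizing f with
  | zero => simp [symFact_zero]
  | succ i ih =>
    have h' : IsAWContour q Γ (a * q ^ i) b c d := by simpa using h.shift hq0 i 0 0 0
    rw [pow_succ, ← mul_assoc, awInt_mul hq h', ih]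
    congr 1; funext x
    rw [symFact_succ]
    ring

/-- This turns pairings of the two bases `φ_i` (for `a`) and `ψ_k` (for `b`) into total masses.
Using different parameters in the two slots is what makes all pairings products. -/
lemma awMass_mul_pow (hq0 : q ≠ 0) (hq : ‖q‖ < 1) (h : IsAWContour q Γ a b c d) (i k : ℕ) :
    awMass q Γ (a * q ^ i) (b * q ^ k) c d =
      awInt q Γ a b c d (fun x => symFact q a i x * symFact q b k x) := by
  have h' : IsAWContour q Γ a (b * q ^ k) c d := by simpa using h.shift hq0 0 k 0 0
  have hs : ∀ a b f, awInt q Γ a b c d f = awInt q Γ b a c d f := fun a b f => by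
    simp only [awInt, awWeight_swap q a b]
  rw [awMass, awInt_mul_pow hq0 hq h', hs, awInt_mul_pow hq0 hq h.swap, hs]
  congr 1; funext x
  ring

/-- The mixed moments. -/
noncomputable def moment (q : ℂ) (Γ : ℝ → ℂ) (a b c d : ℂ) (i k : ℕ) : ℂ :=
  awMass q Γ (a * q ^ i) (b * q ^ k) c d

lemma moment_succ_left (hq0 : q ≠ 0) (hq : ‖q‖ < 1) (h : IsAWContour q Γ a b c d) (i k : ℕ) :
    (1 - a * b * c * d * q ^ (i + k)) * moment q Γ a b c d (i + 1) k =
      (1 - a * b * q ^ (i + k)) * (1 - a * c * q ^ i) * (1 - a * d * q ^ i) *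
        moment q Γ a b c d i k := by
  have h' : IsAWContour q Γ (a * q ^ i) (b * q ^ k) c d := by simpa using h.shift hq0 i k 0 0
  have := awMass_mul hq0 hq h'
  have e : a * q ^ i * q = a * q ^ (i + 1) := by ring
  rw [e] at this
  simp only [moment]
  convert! this using 2
  · ring
  · ring

lemma moment_succ_right (hq0 : q ≠ 0) (hq : ‖q‖ < 1) (h : IsAWContour q Γ a b c d) (i k : ℕ) :
    (1 - a * b * c * d * q ^ (i + k)) * moment q Γ a b c d i (k + 1) =
      (1 - a * b * q ^ (i + k)) * (1 - b * c * q ^ k) * (1 - b * d * q ^ k) *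
        moment q Γ a b c d i k := by
  have hs : ∀ i k, moment q Γ a b c d i k = moment q Γ b a c d k i := fun i k => awMass_swap ..
  have := moment_succ_left hq0 hq h.swap k i
  rw [hs, hs, add_comm i k, mul_comm a b]
  linear_combination this

/-- The case `i, k ≥ 1` of `moment_adjoint`, with `u = q^i` and `v = q^k` for the decreased indices
and `X` the moment at those indices; the other three moments have been expressed through `X`. -/
lemma moment_adjoint_algebra {q u v a b c d X : ℂ} (hq0 : q ≠ 0) (hu : u ≠ 0) (hv : v ≠ 0)
    {D E : ℂ} (hE : E = 1 - a * b * c * d * (u * v * q))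
    (hD0 : D ≠ 0) (hE0 : E ≠ 0) :
    (((u * q)⁻¹ - 1) * (1 - a * b * c * d * u) - ((v * q)⁻¹ - 1) * (1 - a * b * c * d * v)) *
      ((1 - a * b * (u * v * q)) * (1 - a * c * u) * (1 - a * d * u) *
        ((1 - a * b * (u * v)) * (1 - b * c * v) * (1 - b * d * v) * X / D) / E) +
      -((u * q)⁻¹ - 1) * (1 - a * b * u) * (1 - a * c * u) * (1 - a * d * u) *
        ((1 - a * b * (u * v)) * (1 - b * c * v) * (1 - b * d * v) * X / D) -
      -((v * q)⁻¹ - 1) * (1 - b * a * v) * (1 - b * c * v) * (1 - b * d * v) *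
        ((1 - a * b * (u * v)) * (1 - a * c * u) * (1 - a * d * u) * X / D) = 0 := by
  field_simp
  rw [hE]
  ring
-- This expresses `⟨L φ_i, ψ_k⟩ = ⟨φ_i, L ψ_k⟩` for the Askey-Wilson operator `L`, where `L φ_i =
-- λ_i φ_i + μ_i φ_{i-1}` and likewise for `ψ_k`. It is verified on the moments themselves, without
-- manipulating the operator under the integral. The truncated `i - 1` and `k - 1` at zero are
-- harmless because `awLower` vanishes there.
lemma moment_adjoint (hq0 : q ≠ 0) (hq : ‖q‖ < 1) (h : IsAWContour q Γ a b c d)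
    (hκ : a * b * c * d = q * κ) (hκ0 : ∀ n : ℕ, 1 - κ * q ^ n ≠ 0) (i k : ℕ) :
    (awEigen q κ i - awEigen q κ k) * moment q Γ a b c d i k +
      awLower q a b c d i * moment q Γ a b c d (i - 1) k -
      awLower q b a c d k * moment q Γ a b c d i (k - 1) = 0 := by
  have hne : ∀ n : ℕ, 1 - a * b * c * d * q ^ n ≠ 0 := fun n => by
    rw [hκ]; convert! hκ0 (n + 1) using 2; ring
  have r1 : ∀ n : ℕ, awEigen q κ (n + 1) = ((q ^ n * q)⁻¹ - 1) * (1 - a * b * c * d * q ^ n) :=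
    fun n => by rw [awEigen, hκ, pow_succ]; ring
  have r0 : awEigen q κ 0 = 0 := by simp [awEigen]
  have r2 : ∀ (a b c d : ℂ) (n : ℕ), awLower q a b c d (n + 1) = -((q ^ n * q)⁻¹ - 1) *
      (1 - a * b * q ^ n) * (1 - a * c * q ^ n) * (1 - a * d * q ^ n) := fun a b c d n => by
    have : ∀ e : ℂ, e * q ^ (n + 1) / q = e * q ^ n := fun e => by rw [pow_succ]; field_simp
    rw [awLower, this, this, this, pow_succ]
  have solve : ∀ {u v w : ℂ}, u ≠ 0 → u * v = w → v = w / u := fun hu h => by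
    rw [← h, mul_div_cancel_left₀ _ hu]
  rcases i with _ | i <;> rcases k with _ | k
  · simp [awLower_zero]
  · have e := moment_succ_right hq0 hq h 0 k
    rw [zero_add] at e
    rw [awLower_zero, Nat.add_sub_cancel, r0, r1, r2]
    linear_combination (-((q ^ k * q)⁻¹ - 1)) * e
  · have e := moment_succ_left hq0 hq h i 0
    rw [add_zero] at e
    rw [awLower_zero, Nat.add_sub_cancel, r0, r1, r2]
    linear_combination ((q ^ i * q)⁻¹ - 1) * e
  · have e1 := solve (hne _) (moment_succ_left hq0 hq h i (k + 1))
    have e2 := solve (hne _) (moment_succ_left hq0 hq h i k)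
    have e3 := solve (hne _) (moment_succ_right hq0 hq h i k)
    have h1 := hne (i + k)
    have h4 := hne (i + (k + 1))
    have p1 : q ^ (i + (k + 1)) = q ^ i * q ^ k * q := by ring
    rw [p1] at e1 h4
    rw [pow_add] at e2 e3 h1
    rw [Nat.add_sub_cancel, Nat.add_sub_cancel, e1, e2, e3, r1, r1, r2, r2]
    exact moment_adjoint_algebra hq0 (pow_ne_zero i hq0) (pow_ne_zero k hq0) rfl h1 h4

/-- The pairing of a combination of the `(a x, a x⁻¹; q)_j` with `(b x, b x⁻¹; q)_k`. -/
lemma moment_sum_eq_zero (hq0 : q ≠ 0) (hq : ‖q‖ < 1) (h : IsAWContour q Γ a b c d)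
    (hκ : a * b * c * d = q * κ) (hκ0 : ∀ n : ℕ, 1 - κ * q ^ n ≠ 0) {m : ℕ} {A : ℕ → ℂ}
    (hA : ∀ j < m, A (j + 1) * awLower q a b c d (j + 1) =
      (awEigen q κ m - awEigen q κ j) * A j) {k : ℕ} (hk : k < m) :
    ∑ j ∈ Finset.range (m + 1), A j * moment q Γ a b c d j k = 0 := by
  -- With `I_k` the sum at `k`, this is `(λ_m - λ_k) I_k = μ_k I_{k-1}`. Since `μ_0 = 0` and `λ_k ≠
  -- λ_m` for `k < m`, all these `I_k` vanish successively.
  have step : ∀ k, (awEigen q κ m - awEigen q κ k) *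
      ∑ j ∈ Finset.range (m + 1), A j * moment q Γ a b c d j k = awLower q b a c d k *
      ∑ j ∈ Finset.range (m + 1), A j * moment q Γ a b c d j (k - 1) := by
    intro k
    -- Reindexing by the recurrence: the term `j = 0` on the left and the term `j = m` on the right
    -- are both zero.
    have h1 : ∑ j ∈ Finset.range (m + 1), A j * awLower q a b c d j * moment q Γ a b c d (j - 1) k
        = ∑ j ∈ Finset.range (m + 1),
          (awEigen q κ m - awEigen q κ j) * A j * moment q Γ a b c d j k := by
      rw [Finset.sum_range_succ', Finset.sum_range_succ]
      simp only [awLower_zero, Nat.add_sub_cancel, sub_self]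
      rw [mul_zero, zero_mul, zero_mul, zero_mul]
      congr 1
      exact Finset.sum_congr rfl fun j hj => by rw [hA j (Finset.mem_range.mp hj)]
    have h2 : ∑ j ∈ Finset.range (m + 1), A j *
        ((awEigen q κ j - awEigen q κ k) * moment q Γ a b c d j k +
      awLower q a b c d j * moment q Γ a b c d (j - 1) k -
      awLower q b a c d k * moment q Γ a b c d j (k - 1)) = 0 :=
      Finset.sum_eq_zero fun j _ => by rw [moment_adjoint hq0 hq h hκ hκ0, mul_zero]
    have h3 : ∑ j ∈ Finset.range (m + 1), A j *
        ((awEigen q κ j - awEigen q κ k) * moment q Γ a b c d j k +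
      awLower q a b c d j * moment q Γ a b c d (j - 1) k -
      awLower q b a c d k * moment q Γ a b c d j (k - 1)) =
      (∑ j ∈ Finset.range (m + 1),
        A j * ((awEigen q κ j - awEigen q κ k) * moment q Γ a b c d j k)) +
      (∑ j ∈ Finset.range (m + 1),
        A j * awLower q a b c d j * moment q Γ a b c d (j - 1) k) -
      awLower q b a c d k *
        ∑ j ∈ Finset.range (m + 1), A j * moment q Γ a b c d j (k - 1) := by
      rw [Finset.mul_sum, ← Finset.sum_add_distrib, ← Finset.sum_sub_distrib]
      exact Finset.sum_congr rfl fun j _ => by ring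
    rw [h3, h1, ← Finset.sum_add_distrib] at h2
    rw [← sub_eq_zero.mp h2, Finset.mul_sum]
    exact Finset.sum_congr rfl fun j _ => by ring
  have hne : ∀ k < m, awEigen q κ m - awEigen q κ k ≠ 0 := fun k hk => by
    obtain ⟨n, rfl⟩ := Nat.exists_eq_add_of_lt hk
    rw [awEigen_sub hq0 hk.le]
    have : k + n + 1 - k = n + 1 := by omega
    rw [this]
    exact mul_ne_zero (mul_ne_zero (inv_ne_zero (pow_ne_zero _ hq0)) (one_sub_pow_ne_zero hq n))
      (hκ0 _)
  induction k with
  | zero =>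
    have := step 0
    rw [awLower_zero, zero_mul] at this
    exact (mul_eq_zero.mp this).resolve_left (hne 0 hk)
  | succ k ih =>
    have := step (k + 1)
    rw [Nat.add_sub_cancel, ih (by omega), mul_zero] at this
    exact (mul_eq_zero.mp this).resolve_left (hne _ hk)

end Functional

/-! ### Evaluation of the quadratic norm -/

/-- With `m` distinct roots and degree at most `m`, `N` is a constant multiple of the product of its
root factors; cross-multiplying the values at `u` and `v` eliminates the constant. -/
lemma eval_mul_prod_eq_of_roots {m : ℕ} {N : Polynomial ℂ} (hN : N.natDegree ≤ m) {y : ℕ → ℂ}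
    (hy : Function.Injective y) (h0 : ∀ k < m, N.eval (y k) = 0) (u v : ℂ) :
    N.eval u * ∏ k ∈ Finset.range m, (v - y k) = N.eval v * ∏ k ∈ Finset.range m, (u - y k) := by
  have hdvd : ∏ k ∈ Finset.range m, (Polynomial.X - Polynomial.C (y k)) ∣ N :=
    Finset.prod_dvd_of_coprime
      (fun i _ j _ hij => Polynomial.pairwise_coprime_X_sub_C hy hij) fun k hk =>
      Polynomial.dvd_iff_isRoot.mpr (h0 k (Finset.mem_range.mp hk))
  have hmon : (∏ k ∈ Finset.range m, (Polynomial.X - Polynomial.C (y k))).Monic :=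
    Polynomial.monic_prod_of_monic _ _ fun k _ => Polynomial.monic_X_sub_C _
  have hdeg : N.natDegree ≤
      (∏ k ∈ Finset.range m, (Polynomial.X - Polynomial.C (y k))).natDegree := by
    rw [Polynomial.natDegree_prod_of_monic _ _ fun k _ => Polynomial.monic_X_sub_C _]
    simpa using hN
  have e := Polynomial.eq_leadingCoeff_mul_of_monic_of_dvd_of_natDegree_le hmon hdvd hdeg
  have ev : ∀ w, N.eval w = N.leadingCoeff * ∏ k ∈ Finset.range m, (w - y k) := fun w => by
    conv_lhs => rw [e]
    simp [Polynomial.eval_prod]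
  rw [ev u, ev v]
  ring

lemma qFact_add (q z : ℂ) (m n : ℕ) :
    qFact q z (m + n) = qFact q z m * qFact q (z * q ^ m) n := by
  rw [qFact, Finset.prod_range_add]
  congr 1
  exact Finset.prod_congr rfl fun k _ => by ring

lemma prod_one_sub_pow_reverse (q : ℂ) (m : ℕ) :
    ∏ j ∈ Finset.range m, (1 - q ^ (m - j)) = qFact q q m := by
  rw [← Finset.prod_range_reflect, qFact]
  refine Finset.prod_congr rfl fun j hj => ?_
  have := Finset.mem_range.mp hj
  have e : m - (m - 1 - j) = j + 1 := by omega
  rw [e, pow_succ']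

lemma prod_awEigen_sub {q : ℂ} (hq0 : q ≠ 0) (κ : ℂ) (m : ℕ) :
    ∏ j ∈ Finset.range m, (awEigen q κ m - awEigen q κ j) =
      ((q ^ m) ^ m)⁻¹ * qFact q q m * qFact q (κ * q ^ m) m := by
  rw [Finset.prod_congr rfl fun j hj => awEigen_sub hq0 (κ := κ) (Finset.mem_range.mp hj).le,
    Finset.prod_mul_distrib, Finset.prod_mul_distrib, prod_one_sub_pow_reverse]
  simp only [Finset.prod_const, Finset.card_range, inv_pow]
  congr 1
  exact Finset.prod_congr rfl fun k _ => by ring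

lemma prod_awLower {q : ℂ} (hq0 : q ≠ 0) (a b c d : ℂ) (m : ℕ) :
    ∏ j ∈ Finset.range m, awLower q a b c d (j + 1) =
      (-1) ^ m * (∏ j ∈ Finset.range m, q ^ (j + 1))⁻¹ * qFact q q m * qFact q (a * b) m *
        qFact q (a * c) m * qFact q (a * d) m := by
  induction m with
  | zero => simp [qFact_zero]
  | succ m ih =>
    rw [Finset.prod_range_succ, ih, Finset.prod_range_succ, awLower]
    have : ∀ e : ℂ, e * q ^ (m + 1) / q = e * q ^ m := fun e => by rw [pow_succ]; field_simp
    have h2 : ((q ^ (m + 1))⁻¹ - 1) = (q ^ (m + 1))⁻¹ * (1 - q * q ^ m) := by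
      have := pow_ne_zero (m + 1) hq0
      field_simp
      ring
    simp only [this, qFact_succ, mul_inv, h2, pow_succ (-1 : ℂ)]
    ring

lemma prod_pow_sub_pow (q : ℂ) (m : ℕ) :
    ∏ k ∈ Finset.range m, (q ^ m - q ^ k) =
      (-1) ^ m * (∏ k ∈ Finset.range m, q ^ k) * qFact q q m := by
  have : ((-1 : ℂ)) ^ m = ∏ k ∈ Finset.range m, (-1 : ℂ) := by simp
  rw [← prod_one_sub_pow_reverse, this, ← Finset.prod_mul_distrib, ← Finset.prod_mul_distrib]
  refine Finset.prod_congr rfl fun k hk => ?_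
  obtain ⟨n, rfl⟩ := Nat.exists_eq_add_of_le (Finset.mem_range.mp hk).le
  rw [Nat.add_sub_cancel_left, pow_add]
  ring

lemma prod_pow_mul_prod_pow (q : ℂ) (m : ℕ) :
    (∏ j ∈ Finset.range m, q ^ (j + 1)) * ∏ k ∈ Finset.range m, q ^ k = (q ^ m) ^ m := by
  induction m with
  | zero => simp
  | succ m ih =>
    rw [Finset.prod_range_succ, Finset.prod_range_succ]
    calc _ = ((∏ j ∈ Finset.range m, q ^ (j + 1)) * ∏ k ∈ Finset.range m, q ^ k) *
          (q ^ (m + 1) * q ^ m) := by ring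
      _ = _ := by rw [ih]; ring

/-- The quadratic norm of the Askey-Wilson polynomial normalized at `x = a`, where
`κ = abcd / q`. -/
noncomputable def awNorm (q a b c d κ : ℂ) (m : ℕ) : ℂ :=
  a ^ (2 * m) * (qFact q q m * qFact q (b * c) m * qFact q (b * d) m * qFact q (c * d) m) *
    (1 - κ) / (qFact q (a * b) m * qFact q (a * c) m * qFact q (a * d) m * qFact q κ m *
      (1 - κ * q ^ (2 * m)))

section Functional

variable {q : ℂ} {Γ : ℝ → ℂ} {a b c d κ : ℂ}

lemma moment_left (hq0 : q ≠ 0) (hq : ‖q‖ < 1) (h : IsAWContour q Γ a b c d) (j k : ℕ) :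
    moment q Γ a b c d j k * qFact q (a * b * c * d * q ^ k) j = moment q Γ a b c d 0 k *
      (qFact q (a * b * q ^ k) j * qFact q (a * c) j * qFact q (a * d) j) := by
  induction j with
  | zero => simp [qFact_zero]
  | succ j ih =>
    have := moment_succ_left hq0 hq h j k
    simp only [qFact_succ]
    rw [pow_add] at this
    linear_combination qFact q (a * b * c * d * q ^ k) j * this +
      (1 - a * b * (q ^ j * q ^ k)) * (1 - a * c * q ^ j) * (1 - a * d * q ^ j) * ih

lemma moment_right (hq0 : q ≠ 0) (hq : ‖q‖ < 1) (h : IsAWContour q Γ a b c d) (k : ℕ) :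
    moment q Γ a b c d 0 k * qFact q (a * b * c * d) k = awMass q Γ a b c d *
      (qFact q (a * b) k * qFact q (b * c) k * qFact q (b * d) k) := by
  induction k with
  | zero => simp [qFact_zero, moment]
  | succ k ih =>
    have := moment_succ_right hq0 hq h 0 k
    simp only [qFact_succ]
    rw [zero_add] at this
    linear_combination qFact q (a * b * c * d) k * this +
      (1 - a * b * q ^ k) * (1 - b * c * q ^ k) * (1 - b * d * q ^ k) * ih

/-- Clearing denominators in the product formula for the moments leaves, in each summand, `j`
factors `1 - ab q^i u` and `m - j` factors `1 - abcd q^(j+i) u` evaluated at `u = q^k`, hence a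
polynomial in `u` of degree at most `m`. At `u = (ab)⁻¹` each summand with `j ≥ 1` contains the
vanishing factor `1 - ab u`. Interpolation then replaces a basic hypergeometric summation formula.
-/
lemma exists_polynomial_moment (hq0 : q ≠ 0) (hq : ‖q‖ < 1) (h : IsAWContour q Γ a b c d)
    (hab : a * b ≠ 0) (m : ℕ) (A : ℕ → ℂ) :
    ∃ N : Polynomial ℂ, N.natDegree ≤ m ∧ N.eval (a * b)⁻¹ = A 0 * qFact q (c * d) m ∧
      ∀ k, (∑ j ∈ Finset.range (m + 1), A j * moment q Γ a b c d j k) *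
        qFact q (a * b * c * d * q ^ k) m = moment q Γ a b c d 0 k * N.eval (q ^ k) := by
  set L : ℂ → Polynomial ℂ := fun e => 1 - Polynomial.C e * Polynomial.X with hL
  have hLd : ∀ e, (L e).natDegree ≤ 1 := fun e => by
    simp only [hL]
    compute_degree
  have hLe : ∀ e u, (L e).eval u = 1 - e * u := fun e u => by simp [hL]
  have hPd : ∀ (e : ℕ → ℂ) (n : ℕ), (∏ i ∈ Finset.range n, L (e i)).natDegree ≤ n := fun e n => by
    refine (Polynomial.natDegree_prod_le _ _).trans ?_
    refine (Finset.sum_le_sum fun i _ => hLd (e i)).trans (by simp)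
  have hPe : ∀ (e : ℂ) (n : ℕ) (u : ℂ),
      (∏ i ∈ Finset.range n, L (e * q ^ i)).eval u = qFact q (e * u) n := fun e n u => by
    rw [Polynomial.eval_prod, qFact]
    exact Finset.prod_congr rfl fun i _ => by rw [hLe]; ring
  refine ⟨∑ j ∈ Finset.range (m + 1), Polynomial.C (A j * qFact q (a * c) j * qFact q (a * d) j) *
    ((∏ i ∈ Finset.range j, L (a * b * q ^ i)) *
      ∏ i ∈ Finset.range (m - j), L (a * b * c * d * q ^ j * q ^ i)), ?_, ?_, fun k => ?_⟩
  · refine Polynomial.natDegree_sum_le_of_forall_le _ _ fun j hj => ?_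
    refine (Polynomial.natDegree_C_mul_le _ _).trans (Polynomial.natDegree_mul_le.trans ?_)
    have h1 := hPd (fun i => a * b * q ^ i) j
    have h2 := hPd (fun i => a * b * c * d * q ^ j * q ^ i) (m - j)
    have := Finset.mem_range.mp hj
    omega
  · rw [Polynomial.eval_finsetSum, Finset.sum_eq_single 0]
    · have : a * b * c * d * (a * b)⁻¹ = c * d := by
        rw [mul_assoc (a * b), mul_right_comm, mul_inv_cancel₀ hab, one_mul]
      simp only [Polynomial.eval_mul, hPe, Polynomial.eval_C, qFact_zero, pow_zero, mul_one, this,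
        Nat.sub_zero, one_mul]
    · intro j _ hj
      obtain ⟨n, rfl⟩ := Nat.exists_eq_succ_of_ne_zero hj
      simp only [Polynomial.eval_mul, hPe, mul_inv_cancel₀ hab, qFact_succ', sub_self, zero_mul,
        mul_zero]
    · simp
  · rw [Polynomial.eval_finsetSum, Finset.sum_mul, Finset.mul_sum]
    refine Finset.sum_congr rfl fun j hj => ?_
    obtain ⟨n, rfl⟩ := Nat.exists_eq_add_of_le (Nat.lt_succ_iff.mp (Finset.mem_range.mp hj))
    simp only [Polynomial.eval_mul, hPe, Polynomial.eval_C, Nat.add_sub_cancel_left]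
    have e : a * b * c * d * q ^ j * q ^ k = a * b * c * d * q ^ k * q ^ j := by ring
    rw [qFact_add, e]
    linear_combination A j * qFact q (a * b * c * d * q ^ k * q ^ j) n * moment_left hq0 hq h j k

/-- The quadratic norm of a function which expands both in the `(a x, a x⁻¹; q)_j` and in the
`(b x, b x⁻¹; q)_k`, the coefficients being those of an eigenfunction of the Askey-Wilson
operator. -/
lemma awInt_sq (hq0 : q ≠ 0) (hq : ‖q‖ < 1) (h : IsAWContour q Γ a b c d)
    (hκ : a * b * c * d = q * κ) (hκ0 : ∀ n : ℕ, 1 - κ * q ^ n ≠ 0)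
    (hab : ∀ n : ℕ, 1 - a * b * q ^ n ≠ 0) (hac : ∀ n : ℕ, 1 - a * c * q ^ n ≠ 0)
    (had : ∀ n : ℕ, 1 - a * d * q ^ n ≠ 0) (hmass : ∀ k, moment q Γ a b c d 0 k ≠ 0)
    {m : ℕ} {A B : ℕ → ℂ} {p : ℂ → ℂ}
    (hpA : ∀ x ∈ trace Γ, p x = ∑ j ∈ Finset.range (m + 1), A j * symFact q a j x)
    (hpB : ∀ x ∈ trace Γ, p x = ∑ j ∈ Finset.range (m + 1), B j * symFact q b j x)
    (hA : ∀ j < m, A (j + 1) * awLower q a b c d (j + 1) =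
      (awEigen q κ m - awEigen q κ j) * A j)
    (hA0 : A 0 = 1) (hAB : B m * b ^ m = A m * a ^ m) :
    awInt q Γ a b c d (fun x => p x * p x) = awNorm q a b c d κ m * awMass q Γ a b c d := by
  have ha0 := h.ha.1
  have hb0 := h.hb.1
  have hne : ∀ n : ℕ, 1 - a * b * c * d * q ^ n ≠ 0 := fun n => by
    rw [hκ]; convert! hκ0 (n + 1) using 2; ring
  have hs := h.loop.continuousOn_symFact q
  set I : ℕ → ℂ := fun k => ∑ j ∈ Finset.range (m + 1), A j * moment q Γ a b c d j k with hI
  have hIp : ∀ k, awInt q Γ a b c d (fun x => p x * symFact q b k x) = I k := by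
    intro k
    have e : awInt q Γ a b c d (fun x => p x * symFact q b k x) = awInt q Γ a b c d
        (fun x => ∑ j ∈ Finset.range (m + 1), A j * (symFact q a j x * symFact q b k x)) := by
      refine awInt_congr fun x hx => ?_
      simp only [hpA x hx, Finset.sum_mul]
      exact Finset.sum_congr rfl fun j _ => by ring
    rw [e, awInt_sum hq h (f := fun j x => A j * (symFact q a j x * symFact q b k x)) _
      fun j _ => continuousOn_const.mul ((hs a j).mul (hs b k))]
    refine Finset.sum_congr rfl fun j _ => ?_
    rw [awInt_const_mul, moment, awMass_mul_pow hq0 hq h]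
  -- One factor is expanded in the `ψ_k`; orthogonality removes every term except the top one.
  have hL : awInt q Γ a b c d (fun x => p x * p x) = B m * I m := by
    have hpc : ContinuousOn p (trace Γ) := ContinuousOn.congr
      (continuousOn_finsetSum _ fun j _ => continuousOn_const.mul (hs a j)) hpA
    have e : awInt q Γ a b c d (fun x => p x * p x) = awInt q Γ a b c d
        (fun x => ∑ k ∈ Finset.range (m + 1), B k * (p x * symFact q b k x)) := by
      refine awInt_congr fun x hx => ?_
      have : p x * p x = p x * ∑ j ∈ Finset.range (m + 1), B j * symFact q b j x := by
        rw [← hpB x hx]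
      simp only [this, Finset.mul_sum]
      exact Finset.sum_congr rfl fun j _ => by ring
    rw [e, awInt_sum hq h (f := fun k x => B k * (p x * symFact q b k x)) _
        fun j _ => continuousOn_const.mul (hpc.mul (hs b j)),
      Finset.sum_range_succ, Finset.sum_eq_zero, zero_add, awInt_const_mul, hIp]
    intro k hk
    rw [awInt_const_mul, hIp, hI]
    simp only
    rw [moment_sum_eq_zero hq0 hq h hκ hκ0 hA (Finset.mem_range.mp hk), mul_zero]
  obtain ⟨N, hNd, hN0, hNk⟩ := exists_polynomial_moment hq0 hq h (mul_ne_zero ha0 hb0) m A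
  have hy : Function.Injective fun k : ℕ => q ^ k := by
    have key : ∀ k n : ℕ, q ^ k ≠ q ^ (k + n + 1) := fun k n hkn => by
      have h1 : q ^ k * (1 - q ^ (n + 1)) = 0 := by
        rw [add_assoc, pow_add] at hkn
        linear_combination hkn
      exact (mul_ne_zero (pow_ne_zero k hq0) (one_sub_pow_ne_zero hq n)) h1
    intro k l hkl
    rcases lt_trichotomy k l with h' | h' | h'
    · obtain ⟨n, rfl⟩ := Nat.exists_eq_add_of_lt h'
      exact (key _ _ hkl).elim
    · exact h'
    · obtain ⟨n, rfl⟩ := Nat.exists_eq_add_of_lt h'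
      exact (key _ _ hkl.symm).elim
  have hNz : ∀ k < m, N.eval (q ^ k) = 0 := fun k hk => by
    have := hNk k
    rw [moment_sum_eq_zero hq0 hq h hκ hκ0 hA hk, zero_mul] at this
    exact (mul_eq_zero.mp this.symm).resolve_left (hmass k)
  -- Orthogonality supplies the roots `q^k`, `k < m`, so the unknown value at `q^m` follows from the
  -- known one at `(ab)⁻¹`.
  have hNm := eval_mul_prod_eq_of_roots hNd hy hNz (q ^ m) (a * b)⁻¹
  rw [hN0, hA0, one_mul] at hNm
  simp only [prod_pow_sub_pow] at hNm
  have hprod : ∏ k ∈ Finset.range m, ((a * b)⁻¹ - q ^ k) = ((a * b) ^ m)⁻¹ * qFact q (a * b) m := by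
    have : ((a * b) ^ m)⁻¹ = ∏ k ∈ Finset.range m, (a * b)⁻¹ := by
      rw [Finset.prod_const, Finset.card_range, inv_pow]
    rw [this, qFact, ← Finset.prod_mul_distrib]
    refine Finset.prod_congr rfl fun k _ => ?_
    field_simp
  rw [hprod] at hNm
  -- The recurrence iterated from `A 0 = 1`.
  have hAm : A m * ∏ j ∈ Finset.range m, awLower q a b c d (j + 1) =
      ∏ j ∈ Finset.range m, (awEigen q κ m - awEigen q κ j) := by
    have : ∀ n ≤ m, A n * ∏ j ∈ Finset.range n, awLower q a b c d (j + 1) =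
        ∏ j ∈ Finset.range n, (awEigen q κ m - awEigen q κ j) := by
      intro n
      induction n with
      | zero => intro _; simp [hA0]
      | succ n ih =>
        intro hn
        rw [Finset.prod_range_succ, Finset.prod_range_succ, ← ih (by omega)]
        linear_combination (∏ j ∈ Finset.range n, awLower q a b c d (j + 1)) * hA n (by omega)
    exact this m le_rfl
  rw [prod_awLower hq0, prod_awEigen_sub hq0] at hAm
  have hP := prod_pow_mul_prod_pow q m
  have hIm := hNk m
  have hMm := moment_right hq0 hq h m
  -- Both sides are `(κ; q)_{2m+1}`, split off at the first factor or at the last one.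
  have hX : (1 - κ) * (qFact q (a * b * c * d) m * qFact q (a * b * c * d * q ^ m) m) =
      qFact q κ m * qFact q (κ * q ^ m) m * (1 - κ * q ^ (2 * m)) := by
    rw [← qFact_add, ← qFact_add, ← two_mul, ← qFact_succ, qFact_succ', hκ, mul_comm q κ]
  have n1 : qFact q (a * b) m ≠ 0 := qFact_ne_zero fun k _ => hab k
  have n2 : qFact q (a * c) m ≠ 0 := qFact_ne_zero fun k _ => hac k
  have n3 : qFact q (a * d) m ≠ 0 := qFact_ne_zero fun k _ => had k
  have n4 : qFact q κ m ≠ 0 := qFact_ne_zero fun k _ => hκ0 k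
  have n5 : 1 - κ * q ^ (2 * m) ≠ 0 := hκ0 _
  have n6 : qFact q (a * b * c * d) m ≠ 0 := qFact_ne_zero fun k _ => hne k
  have n7 : qFact q (a * b * c * d * q ^ m) m ≠ 0 := qFact_ne_zero fun k _ => by
    have := hne (m + k); rwa [pow_add, ← mul_assoc] at this
  have n8 : qFact q q m ≠ 0 := qFact_ne_zero fun k _ => by
    rw [← pow_succ']; exact one_sub_pow_ne_zero hq k
  have n9 : ∏ j ∈ Finset.range m, q ^ (j + 1) ≠ 0 :=
    Finset.prod_ne_zero_iff.mpr fun j _ => pow_ne_zero _ hq0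
  have n10 : ((q ^ m) ^ m) ≠ 0 := pow_ne_zero _ (pow_ne_zero _ hq0)
  have n11 : a ^ m ≠ 0 := pow_ne_zero _ ha0
  have n12 : b ^ m ≠ 0 := pow_ne_zero _ hb0
  have hsgn : ((-1 : ℂ) ^ m) * (-1) ^ m = 1 := by rw [← mul_pow]; simp
  have n13 : ((-1 : ℂ) ^ m) ≠ 0 := left_ne_zero_of_mul_eq_one hsgn
  rw [hL, awNorm]
  have hIm' : I m * qFact q (a * b * c * d * q ^ m) m =
    moment q Γ a b c d 0 m * N.eval (q ^ m) := hIm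
  clear_value I
  rw [mul_pow] at hNm
  have e2 : a ^ (2 * m) = a ^ m * a ^ m := by rw [two_mul, pow_add]
  rw [e2]
  generalize q ^ (2 * m) = qq at *
  generalize (q ^ m) ^ m = Q at *
  generalize ∏ j ∈ Finset.range m, q ^ (j + 1) = P1 at *
  generalize ∏ j ∈ Finset.range m, q ^ j = P2 at *
  generalize moment q Γ a b c d 0 m = M at *
  generalize N.eval (q ^ m) = Nm at *
  generalize qFact q (a * b * c * d * q ^ m) m = X2 at *
  generalize qFact q (a * b * c * d) m = X1 at *
  generalize qFact q (κ * q ^ m) m = K1 at *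
  generalize qFact q κ m = K0 at *
  generalize qFact q q m = Fq at *
  generalize qFact q (a * b) m = Fab at *
  generalize qFact q (a * c) m = Fac at *
  generalize qFact q (a * d) m = Fad at *
  generalize qFact q (b * c) m = Fbc at *
  generalize qFact q (b * d) m = Fbd at *
  generalize qFact q (c * d) m = Fcd at *
  generalize awMass q Γ a b c d = W at *
  generalize a ^ m = am at *
  generalize b ^ m = bm at *
  generalize (-1 : ℂ) ^ m = s at *
  generalize I m = Im at *
  generalize A m = Am at *
  generalize B m = Bm at *
  have f1 : Bm = Am * am / bm := by rw [eq_div_iff n12, hAB]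
  have f2 : Im = M * Nm / X2 := by rw [eq_div_iff n7, hIm']
  have f3 : M = W * (Fab * Fbc * Fbd) / X1 := by rw [eq_div_iff n6, hMm]
  have f4 : Nm = Fcd * (s * P2 * Fq) * (am * bm) / Fab := by
    rw [eq_div_iff n1, ← hNm]; field_simp
  have f5 : Am = P1 * K1 / (s * Q * Fab * Fac * Fad) := by
    rw [eq_div_iff (by positivity)]
    field_simp at hAm
    linear_combination hAm
  have f6 : K1 = (1 - κ) * (X1 * X2) / (K0 * (1 - κ * qq)) := by
    rw [eq_div_iff (mul_ne_zero n4 n5), hX]; ring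
  rw [f1, f2, f3, f4, f5, f6, ← hP]
  rw [← hP] at n10
  have n14 := right_ne_zero_of_mul n10
  field_simp

end Functional

/-! ### Evaluation of Laurent polynomials and the quadratic relations -/

section

lemma linearMap_ext_T {M : Type*} [AddCommMonoid M] [Module ℂ M] {F G : ℂ[T;T⁻¹] →ₗ[ℂ] M}
    (h : ∀ m, F (T m) = G (T m)) : F = G := by
  refine (AddMonoidAlgebra.basis ℤ ℂ).ext fun m => ?_
  rw [AddMonoidAlgebra.basis_apply]
  exact h m

/-- Evaluation at a point as a linear map. -/
noncomputable def evalLin (x : ℂ) : ℂ[T;T⁻¹] →ₗ[ℂ] ℂ where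
  toFun f := evalAt f x
  map_add' f g := by
    simp only [evalAt, AddMonoidAlgebra.coeff_add]
    exact Finsupp.sum_add_index' (by simp) (by intros; ring)
  map_smul' c f := by
    simp only [evalAt, AddMonoidAlgebra.coeff_smul, RingHom.id_apply, smul_eq_mul]
    rw [Finsupp.sum_smul_index (by simp), Finsupp.mul_sum]
    simp only [mul_assoc]

lemma evalLin_apply (x : ℂ) (f : ℂ[T;T⁻¹]) : evalLin x f = evalAt f x := rfl

@[simp] lemma evalLin_T (x : ℂ) (n : ℤ) : evalLin x (T n) = x ^ n := by
  change (Finsupp.single n (1 : ℂ)).sum (fun n c => c * x ^ n) = x ^ n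
  rw [Finsupp.sum_single_index (by simp), one_mul]

/-- At `x = 0` evaluation is not multiplicative, because of the convention for negative powers of
zero. -/
lemma evalLin_mul {x : ℂ} (hx : x ≠ 0) (f g : ℂ[T;T⁻¹]) :
    evalLin x (f * g) = evalLin x f * evalLin x g := by
  have h1 : ∀ m, (evalLin x).comp (LinearMap.mulLeft ℂ (T m : ℂ[T;T⁻¹])) = x ^ m • evalLin x :=
    fun m => linearMap_ext_T fun n => by
      simp only [LinearMap.comp_apply, LinearMap.mulLeft_apply, LinearMap.smul_apply, smul_eq_mul]
      rw [← LaurentPolynomial.T_add, evalLin_T, evalLin_T, zpow_add₀ hx]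
  have h2 : (evalLin x).comp (LinearMap.mulRight ℂ g) = (evalLin x g) • evalLin x :=
    linearMap_ext_T fun m => by
      have := congrArg (fun F => F g) (h1 m)
      simp only [LinearMap.comp_apply, LinearMap.mulLeft_apply, LinearMap.smul_apply,
        smul_eq_mul] at this
      simp only [LinearMap.comp_apply, LinearMap.mulRight_apply, LinearMap.smul_apply,
        smul_eq_mul]
      rw [this, evalLin_T, mul_comm]
  have := congrArg (fun F => F f) h2
  simp only [LinearMap.comp_apply, LinearMap.mulRight_apply, LinearMap.smul_apply,
    smul_eq_mul] at this
  rw [this, mul_comm]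

@[simp] lemma evalLin_one (x : ℂ) : evalLin x 1 = 1 := by
  rw [← LaurentPolynomial.T_zero, evalLin_T, zpow_zero]

lemma C_eq_smul_one (c : ℂ) : (C c : ℂ[T;T⁻¹]) = c • 1 := by
  rw [LaurentPolynomial.smul_eq_C_mul, mul_one]

@[simp] lemma evalLin_C (x c : ℂ) : evalLin x (C c) = c := by
  rw [C_eq_smul_one, map_smul, evalLin_one, smul_eq_mul, mul_one]

lemma evalLin_toLaurent {x : ℂ} (hx : x ≠ 0) (p : Polynomial ℂ) :
    evalLin x (Polynomial.toLaurent p) = p.eval x := by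
  induction p using Polynomial.induction_on' with
  | add p q hp hq => simp [hp, hq]
  | monomial n a =>
    rw [← Polynomial.C_mul_X_pow_eq_monomial, map_mul, Polynomial.toLaurent_C,
      Polynomial.toLaurent_X_pow, evalLin_mul hx]
    simp

/-- Laurent polynomials are determined by their values outside a finite set. -/
lemma eq_of_evalLin_eq {S : Set ℂ} (hS : S.Finite) {f g : ℂ[T;T⁻¹]}
    (h : ∀ x ∉ S, x ≠ 0 → evalLin x f = evalLin x g) : f = g := by
  obtain ⟨n, p, hp⟩ := LaurentPolynomial.exists_T_pow (f - g)
  have hinf : (S ∪ {0})ᶜ.Infinite := (hS.union (finite_singleton 0)).infinite_compl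
  have hp0 : p = 0 := by
    refine Polynomial.eq_zero_of_infinite_isRoot p (hinf.mono fun x hx => ?_)
    have hx' : x ∉ S ∧ x ≠ 0 := by
      simpa [not_or, and_comm] using hx
    change p.eval x = 0
    rw [← evalLin_toLaurent hx'.2, hp, evalLin_mul hx'.2, map_sub, h x hx'.1 hx'.2, sub_self,
      zero_mul]
  rw [hp0, map_zero] at hp
  have h2 : (f - g) * (T n * T (-n)) = 0 := by rw [← mul_assoc, ← hp, zero_mul]
  rw [← LaurentPolynomial.T_add, add_neg_cancel, LaurentPolynomial.T_zero, mul_one] at h2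
  exact sub_eq_zero.mp h2

lemma evalLin_s₁ (x : ℂ) (f : ℂ[T;T⁻¹]) : evalLin x (s₁ f) = evalLin x⁻¹ f := by
  refine congrArg (fun F => F f) (?_ : (evalLin x).comp s₁ = evalLin x⁻¹)
  refine linearMap_ext_T fun m => ?_
  simp [s₁, linExt_T]

lemma evalLin_s₀ (t : Param) {x : ℂ} (hx : x ≠ 0) (f : ℂ[T;T⁻¹]) :
    evalLin x (s₀ t f) = evalLin (t.q * x⁻¹) f := by
  refine congrArg (fun F => F f) (?_ : (evalLin x).comp (s₀ t) = evalLin (t.q * x⁻¹))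
  refine linearMap_ext_T fun m => ?_
  simp [s₀, linExt_T, evalLin_mul hx, mul_zpow]

namespace Param

variable (t : Param)

/-- The coefficient of `T₁`: `T₁ f = k₁ f + B (s₁ f - f)`. -/
noncomputable def coeff₁ (x : ℂ) : ℂ := t.k₁⁻¹ * ((1 - t.a * x) * (1 - t.b * x)) / (1 - x ^ 2)

/-- The coefficient of `T₀`: `T₀ f = k₀ f + G (s₀ f - f)`. -/
noncomputable def coeff₀ (x : ℂ) : ℂ :=
  t.k₀⁻¹ * ((1 - t.c * x⁻¹) * (1 - t.d * x⁻¹)) / (1 - t.q * x⁻¹ ^ 2)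

end Param

variable {t : Param}

/-- The parameters `a`, `b` appear through `k₁(1 - x²) - (k₁ - k₁⁻¹) - (u₁ - u₁⁻¹)x = k₁⁻¹(1 - ax)(1
- bx)`; similarly `c`, `d` come from `T₀`. -/
lemma evalLin_T₁ (ht : t.Generic) {x : ℂ} (hx : x ≠ 0) (hx1 : 1 - x ^ 2 ≠ 0) (f : ℂ[T;T⁻¹]) :
    evalLin x (T₁ t f) = t.k₁ * evalLin x f + t.coeff₁ x * (evalLin x⁻¹ f - evalLin x f) := by
  have h1 := congrArg (evalLin x) (divDiff₁_spec f)
  rw [evalLin_mul hx, map_sub, map_sub, evalLin_s₁, evalLin_one, evalLin_T] at h1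
  have e2 : x ^ (2 : ℤ) = x ^ 2 := by norm_cast
  rw [e2] at h1
  have h2 : evalLin x (divDiff₁ f) = (evalLin x f - evalLin x⁻¹ f) / (1 - x ^ 2) := by
    rw [← h1, mul_div_cancel_left₀ _ hx1]
  simp only [T₁, LinearMap.add_apply, LinearMap.smul_apply, LinearMap.comp_apply,
    LinearMap.mulLeft_apply, map_add, map_smul, evalLin_mul hx, evalLin_C, evalLin_T, evalLin_s₁,
    h2, Param.coeff₁, Param.a, Param.b, zpow_one, smul_eq_mul]
  have k1 := ht.k₁_ne
  have u1 := ht.u₁_ne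
  field_simp
  ring

lemma evalLin_T₀ (ht : t.Generic) {x : ℂ} (hx : x ≠ 0) (hx1 : x ^ 2 - t.q ≠ 0) (f : ℂ[T;T⁻¹]) :
    evalLin x (T₀ t f) =
      t.k₀ * evalLin x f + t.coeff₀ x * (evalLin (t.q * x⁻¹) f - evalLin x f) := by
  have h1 := congrArg (evalLin x) (divDiff₀_spec t ht.q_ne f)
  rw [evalLin_mul hx, map_sub, map_sub, evalLin_s₀ t hx, evalLin_one, evalLin_mul hx, evalLin_T,
    evalLin_C] at h1
  have e2 : x ^ (-2 : ℤ) = x⁻¹ ^ 2 := by rw [zpow_neg, inv_pow]; norm_cast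
  rw [e2] at h1
  have hd : 1 - t.q * x⁻¹ ^ 2 ≠ 0 := by
    have : 1 - t.q * x⁻¹ ^ 2 = (x ^ 2 - t.q) / x ^ 2 := by field_simp
    rw [this]
    exact div_ne_zero hx1 (pow_ne_zero _ hx)
  have h2 : evalLin x (divDiff₀ t f) =
      (evalLin x f - evalLin (t.q * x⁻¹) f) / (1 - t.q * x⁻¹ ^ 2) := by
    rw [← h1, mul_div_cancel_left₀ _ hd]
  simp only [T₀, LinearMap.add_apply, LinearMap.smul_apply, LinearMap.comp_apply,
    LinearMap.mulLeft_apply, map_add, map_smul, evalLin_mul hx, evalLin_C, evalLin_T,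
    evalLin_s₀ t hx, h2, Param.coeff₀, Param.c, Param.d, zpow_neg_one, smul_eq_mul]
  have k0 := ht.k₀_ne
  have u0 := ht.u₀_ne
  generalize evalLin (t.q * x⁻¹) f = F at *
  generalize evalLin x f = G at *
  have hdd : 1 - t.q * x⁻¹ ^ 2 = 1 - t.rq ^ 2 * x⁻¹ ^ 2 := rfl
  rw [hdd] at hd ⊢
  generalize x⁻¹ = y at *
  field_simp
  ring

lemma coeff₁_add (ht : t.Generic) {x : ℂ} (hx : x ≠ 0) (hx1 : 1 - x ^ 2 ≠ 0) :
    t.coeff₁ x + t.coeff₁ x⁻¹ = t.k₁ + t.k₁⁻¹ := by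
  have k1 := ht.k₁_ne
  have u1 := ht.u₁_ne
  have h2 : 1 - x⁻¹ ^ 2 = -(1 - x ^ 2) / x ^ 2 := by field_simp; ring
  simp only [Param.coeff₁, Param.a, Param.b, h2]
  field_simp
  ring

lemma coeff₀_add (ht : t.Generic) {x : ℂ} (hx : x ≠ 0) (hx1 : x ^ 2 - t.q ≠ 0) :
    t.coeff₀ x + t.coeff₀ (t.q * x⁻¹) = t.k₀ + t.k₀⁻¹ := by
  have k0 := ht.k₀_ne
  have u0 := ht.u₀_ne
  have hr : t.rq ≠ 0 := fun h => ht.q_ne (by simp [Param.q, h])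
  have h1 : 1 - t.q * x⁻¹ ^ 2 = (x ^ 2 - t.rq ^ 2) / x ^ 2 := by
    simp only [Param.q]; field_simp
  have h2 : 1 - t.q * (t.q * x⁻¹)⁻¹ ^ 2 = -(x ^ 2 - t.rq ^ 2) / t.rq ^ 2 := by
    simp only [Param.q]; field_simp; ring
  simp only [Param.q] at hx1
  simp only [Param.coeff₀, Param.c, Param.d, h1, h2]
  simp only [Param.q]
  field_simp
  ring

lemma finite_sq_eq (c : ℂ) : {x : ℂ | c - x ^ 2 = 0}.Finite := by
  have hp : (Polynomial.C c - Polynomial.X ^ 2 : Polynomial ℂ) ≠ 0 := fun h => by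
    have := congrArg (fun p => Polynomial.coeff p 2) h
    simp at this
  refine (Polynomial.finite_setOfPred_isRoot hp).subset fun x hx => ?_
  simpa [Polynomial.IsRoot] using hx

/-- The Hecke relation `(T₁ - k₁)(T₁ + k₁⁻¹) = 0`. Written pointwise it amounts to `coeff₁_add`, and
finitely many exceptional points do not matter for Laurent polynomials. -/
lemma T₁_sq (ht : t.Generic) (f : ℂ[T;T⁻¹]) :
    T₁ t (T₁ t f) = (t.k₁ - t.k₁⁻¹) • T₁ t f + f := by
  have k1 := ht.k₁_ne
  refine eq_of_evalLin_eq (finite_sq_eq 1) fun x hx hx0 => ?_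
  have hx1 : 1 - x ^ 2 ≠ 0 := hx
  have hx2 : 1 - x⁻¹ ^ 2 ≠ 0 := by
    have : 1 - x⁻¹ ^ 2 = -(1 - x ^ 2) / x ^ 2 := by field_simp; ring
    rw [this]
    exact div_ne_zero (neg_ne_zero.mpr hx1) (pow_ne_zero _ hx0)
  have e := coeff₁_add ht hx0 hx1
  rw [map_add, map_smul, evalLin_T₁ ht hx0 hx1, evalLin_T₁ ht hx0 hx1,
    evalLin_T₁ ht (inv_ne_zero hx0) hx2, inv_inv, smul_eq_mul]
  have e' : t.coeff₁ x⁻¹ = t.k₁ + t.k₁⁻¹ - t.coeff₁ x := by linear_combination e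
  rw [e']
  field_simp
  ring

lemma T₀_sq (ht : t.Generic) (f : ℂ[T;T⁻¹]) :
    T₀ t (T₀ t f) = (t.k₀ - t.k₀⁻¹) • T₀ t f + f := by
  have k0 := ht.k₀_ne
  have q0 := ht.q_ne
  refine eq_of_evalLin_eq (finite_sq_eq t.q) fun x hx hx0 => ?_
  have hx' : t.q - x ^ 2 ≠ 0 := hx
  have hx1 : x ^ 2 - t.q ≠ 0 := fun h => hx' (by linear_combination -h)
  have hx2 : (t.q * x⁻¹) ^ 2 - t.q ≠ 0 := by
    have : (t.q * x⁻¹) ^ 2 - t.q = t.q * (t.q - x ^ 2) / x ^ 2 := by field_simp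
    rw [this]
    exact div_ne_zero (mul_ne_zero q0 hx') (pow_ne_zero _ hx0)
  have e := coeff₀_add ht hx0 hx1
  have e3 : t.q * (t.q * x⁻¹)⁻¹ = x := by field_simp
  rw [map_add, map_smul, evalLin_T₀ ht hx0 hx1, evalLin_T₀ ht hx0 hx1,
    evalLin_T₀ ht (mul_ne_zero q0 (inv_ne_zero hx0)) hx2, e3, smul_eq_mul]
  have e' : t.coeff₀ (t.q * x⁻¹) = t.k₀ + t.k₀⁻¹ - t.coeff₀ x := by linear_combination e
  rw [e']
  field_simp
  ring

end

section

/-! ### Triangularity -/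

/-- The span of the monomials of rank less than `r`. -/
noncomputable def lowerSpan (r : ℤ) : Submodule ℂ ℂ[T;T⁻¹] := Submodule.span ℂ (T '' {n : ℤ | rank n < r})

lemma T_mem_lowerSpan {n r : ℤ} (h : rank n < r) : (T n : ℂ[T;T⁻¹]) ∈ lowerSpan r :=
  Submodule.subset_span ⟨n, h, rfl⟩

lemma lowerSpan_mono {r s : ℤ} (h : r ≤ s) : lowerSpan r ≤ lowerSpan s :=
  Submodule.span_mono (image_mono fun _ hn => lt_of_lt_of_le hn h)

lemma lowerSpan_map_le {F : ℂ[T;T⁻¹] →ₗ[ℂ] ℂ[T;T⁻¹]} {r s : ℤ}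
    (h : ∀ n, rank n < r → F (T n) ∈ lowerSpan s) {f : ℂ[T;T⁻¹]} (hf : f ∈ lowerSpan r) :
    F f ∈ lowerSpan s := by
  have : lowerSpan r ≤ (lowerSpan s).comap F := by
    refine Submodule.span_le.mpr ?_
    rintro _ ⟨n, hn, rfl⟩
    exact h n hn
  exact this hf

lemma rank_neg {k : ℤ} (hk : 0 < k) : rank (-k) = 2 * k - 1 := by
  rw [rank, if_neg (by omega)]; ring

lemma rank_pos {k : ℤ} (hk : 0 ≤ k) : rank k = 2 * k := by
  rw [rank, if_pos hk]

/-- Thus `lowerSpan (2 * k - 1)` is the symmetric band of exponents `|n| < k`, the only truncations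
stable under `T₁`-type operators. -/
lemma rank_lt_iff {n k : ℤ} (hk : 0 < k) : rank n < 2 * k - 1 ↔ -k < n ∧ n < k := by
  unfold rank; split_ifs <;> omega

lemma rank_nonneg (n : ℤ) : 0 ≤ rank n := by
  unfold rank; split_ifs <;> omega

lemma rank_injective : Function.Injective rank := by
  intro m n h
  unfold rank at h; split_ifs at h <;> omega

lemma C_mul_mem {S : Submodule ℂ ℂ[T;T⁻¹]} {f : ℂ[T;T⁻¹]} (c : ℂ) (hf : f ∈ S) : C c * f ∈ S := by
  rw [← LaurentPolynomial.smul_eq_C_mul]; exact S.smul_mem c hf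

lemma T_mem {n k : ℤ} (h1 : -k < n) (h2 : n < k) :
    (T n : ℂ[T;T⁻¹]) ∈ lowerSpan (2 * k - 1) :=
  T_mem_lowerSpan ((rank_lt_iff (by omega)).mpr ⟨h1, h2⟩)

variable {t : Param}

/-- The term `j = 0` of the divided difference combines with `k₁ s₁` to `k₁⁻¹ x^(-k)`; all remaining
exponents lie strictly between `-k` and `k`. The next three lemmas follow the same pattern. -/
lemma T₁_T_pos (t : Param) {k : ℤ} (hk : 0 < k) :
    T₁ t (T k) - C t.k₁⁻¹ * T (-k) ∈ lowerSpan (2 * k - 1) := by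
  obtain ⟨n, rfl⟩ : ∃ n : ℕ, k = n + 1 := ⟨(k - 1).toNat, by omega⟩
  simp only [T₁, LinearMap.add_apply, LinearMap.smul_apply, LinearMap.comp_apply,
    LinearMap.mulLeft_apply, s₁, divDiff₁, linExt_T, if_pos hk.le]
  rw [show ((n : ℤ) + 1).toNat = n + 1 by omega]
  have e : (t.k₁ • T (-(n + 1 : ℤ)) + (C (t.k₁ - t.k₁⁻¹) + C (t.u₁ - t.u₁⁻¹) * T 1) *
      -∑ j ∈ Finset.range (n + 1), T (-(n + 1 : ℤ) + 2 * j) - C t.k₁⁻¹ * T (-(n + 1 : ℤ)) :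
        ℂ[T;T⁻¹]) =
      -(C (t.k₁ - t.k₁⁻¹) * ∑ j ∈ Finset.range n, T (-(n + 1 : ℤ) + 2 * (j + 1 : ℕ))) -
        C (t.u₁ - t.u₁⁻¹) * ∑ j ∈ Finset.range (n + 1), T (1 + (-(n + 1 : ℤ) + 2 * j)) := by
    have h1 : ∑ j ∈ Finset.range (n + 1), (T (1 + (-(n + 1 : ℤ) + 2 * j)) : ℂ[T;T⁻¹]) =
        T 1 * ∑ j ∈ Finset.range (n + 1), T (-(n + 1 : ℤ) + 2 * j) := by
      rw [Finset.mul_sum]; simp only [LaurentPolynomial.T_add]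
    rw [h1, Finset.sum_range_succ', LaurentPolynomial.smul_eq_C_mul, map_sub]
    simp only [Nat.cast_zero, mul_zero, add_zero]
    ring
  rw [e]
  refine Submodule.sub_mem _ (Submodule.neg_mem _ (C_mul_mem _ (Submodule.sum_mem _ ?_)))
    (C_mul_mem _ (Submodule.sum_mem _ ?_))
  all_goals
    intro j hj
    have := Finset.mem_range.mp hj
    exact T_mem (by push_cast; omega) (by push_cast; omega)

lemma T₁_T_neg (t : Param) {k : ℤ} (hk : 0 < k) :
    T₁ t (T (-k)) - (C t.k₁ * T k + C (t.k₁ - t.k₁⁻¹) * T (-k)) ∈ lowerSpan (2 * k - 1) := by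
  obtain ⟨n, rfl⟩ : ∃ n : ℕ, k = n + 1 := ⟨(k - 1).toNat, by omega⟩
  simp only [T₁, LinearMap.add_apply, LinearMap.smul_apply, LinearMap.comp_apply,
    LinearMap.mulLeft_apply, s₁, divDiff₁, linExt_T]
  rw [if_neg (by omega), neg_neg, show ((n : ℤ) + 1).toNat = n + 1 by omega]
  have e : (t.k₁ • T ((n + 1 : ℤ)) + (C (t.k₁ - t.k₁⁻¹) + C (t.u₁ - t.u₁⁻¹) * T 1) *
      ∑ j ∈ Finset.range (n + 1), T (-(n + 1 : ℤ) + 2 * j) -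
        (C t.k₁ * T (n + 1 : ℤ) + C (t.k₁ - t.k₁⁻¹) * T (-(n + 1 : ℤ))) : ℂ[T;T⁻¹]) =
      (C (t.k₁ - t.k₁⁻¹) * ∑ j ∈ Finset.range n, T (-(n + 1 : ℤ) + 2 * (j + 1 : ℕ))) +
        C (t.u₁ - t.u₁⁻¹) * ∑ j ∈ Finset.range (n + 1), T (1 + (-(n + 1 : ℤ) + 2 * j)) := by
    have h1 : ∑ j ∈ Finset.range (n + 1), (T (1 + (-(n + 1 : ℤ) + 2 * j)) : ℂ[T;T⁻¹]) =
        T 1 * ∑ j ∈ Finset.range (n + 1), T (-(n + 1 : ℤ) + 2 * j) := by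
      rw [Finset.mul_sum]; simp only [LaurentPolynomial.T_add]
    rw [h1, Finset.sum_range_succ', LaurentPolynomial.smul_eq_C_mul]
    simp only [Nat.cast_zero, mul_zero, add_zero]
    ring
  rw [e]
  refine Submodule.add_mem _ (C_mul_mem _ (Submodule.sum_mem _ ?_))
    (C_mul_mem _ (Submodule.sum_mem _ ?_))
  all_goals
    intro j hj
    have := Finset.mem_range.mp hj
    exact T_mem (by push_cast; omega) (by push_cast; omega)

lemma T₀_T_pos (t : Param) {k : ℤ} (hk : 0 < k) :
    T₀ t (T k) - (C (t.k₀ - t.k₀⁻¹) * T k + C (t.k₀ * t.q ^ k) * T (-k)) ∈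
      lowerSpan (2 * k - 1) := by
  obtain ⟨n, rfl⟩ : ∃ n : ℕ, k = n + 1 := ⟨(k - 1).toNat, by omega⟩
  simp only [T₀, LinearMap.add_apply, LinearMap.smul_apply, LinearMap.comp_apply,
    LinearMap.mulLeft_apply, s₀, divDiff₀, linExt_T, if_pos hk.le]
  rw [show ((n : ℤ) + 1).toNat = n + 1 by omega]
  have e : (t.k₀ • (C (t.q ^ (n + 1 : ℤ)) * T (-(n + 1 : ℤ))) +
      (C (t.k₀ - t.k₀⁻¹) + C ((t.u₀ - t.u₀⁻¹) * t.rq) * T (-1)) *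
      ∑ j ∈ Finset.range (n + 1), C (t.q ^ j) * T ((n + 1 : ℤ) - 2 * j) -
        (C (t.k₀ - t.k₀⁻¹) * T (n + 1 : ℤ) + C (t.k₀ * t.q ^ (n + 1 : ℤ)) * T (-(n + 1 : ℤ))) :
          ℂ[T;T⁻¹]) =
      (C (t.k₀ - t.k₀⁻¹) *
        ∑ j ∈ Finset.range n, C (t.q ^ (j + 1)) * T ((n + 1 : ℤ) - 2 * (j + 1 : ℕ))) +
        C ((t.u₀ - t.u₀⁻¹) * t.rq) *
          ∑ j ∈ Finset.range (n + 1), C (t.q ^ j) * T (-1 + ((n + 1 : ℤ) - 2 * j)) := by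
    have h1 : ∑ j ∈ Finset.range (n + 1),
        (C (t.q ^ j) * T (-1 + ((n + 1 : ℤ) - 2 * j)) : ℂ[T;T⁻¹]) =
        T (-1) * ∑ j ∈ Finset.range (n + 1), C (t.q ^ j) * T ((n + 1 : ℤ) - 2 * j) := by
      rw [Finset.mul_sum]
      refine Finset.sum_congr rfl fun j _ => ?_
      rw [LaurentPolynomial.T_add]; ring
    rw [h1, Finset.sum_range_succ', LaurentPolynomial.smul_eq_C_mul, map_mul C t.k₀]
    simp only [Nat.cast_zero, mul_zero, sub_zero, pow_zero, map_one, one_mul]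
    ring
  rw [e]
  refine Submodule.add_mem _ (C_mul_mem _ (Submodule.sum_mem _ ?_))
    (C_mul_mem _ (Submodule.sum_mem _ ?_))
  all_goals
    intro j hj
    have := Finset.mem_range.mp hj
    exact C_mul_mem _ (T_mem (by push_cast; omega) (by push_cast; omega))

lemma T₀_T_neg (t : Param) {k : ℤ} (hk : 0 < k) :
    T₀ t (T (-k)) - C (t.k₀⁻¹ * t.q ^ (-k)) * T k ∈ lowerSpan (2 * k - 1) := by
  obtain ⟨n, rfl⟩ : ∃ n : ℕ, k = n + 1 := ⟨(k - 1).toNat, by omega⟩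
  simp only [T₀, LinearMap.add_apply, LinearMap.smul_apply, LinearMap.comp_apply,
    LinearMap.mulLeft_apply, s₀, divDiff₀, linExt_T]
  rw [if_neg (by omega), neg_neg, show ((n : ℤ) + 1).toNat = n + 1 by omega]
  have e : (t.k₀ • (C (t.q ^ (-(n + 1 : ℤ))) * T (n + 1 : ℤ)) +
      (C (t.k₀ - t.k₀⁻¹) + C ((t.u₀ - t.u₀⁻¹) * t.rq) * T (-1)) *
      -∑ j ∈ Finset.range (n + 1), C (t.q ^ (-(n + 1 : ℤ) + j)) * T ((n + 1 : ℤ) - 2 * j) -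
        C (t.k₀⁻¹ * t.q ^ (-(n + 1 : ℤ))) * T (n + 1 : ℤ) : ℂ[T;T⁻¹]) =
      -(C (t.k₀ - t.k₀⁻¹) * ∑ j ∈ Finset.range n,
        C (t.q ^ (-(n + 1 : ℤ) + (j + 1 : ℕ))) * T ((n + 1 : ℤ) - 2 * (j + 1 : ℕ))) -
        C ((t.u₀ - t.u₀⁻¹) * t.rq) * ∑ j ∈ Finset.range (n + 1),
          C (t.q ^ (-(n + 1 : ℤ) + j)) * T (-1 + ((n + 1 : ℤ) - 2 * j)) := by
    have h1 : ∑ j ∈ Finset.range (n + 1),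
        (C (t.q ^ (-(n + 1 : ℤ) + j)) * T (-1 + ((n + 1 : ℤ) - 2 * j)) : ℂ[T;T⁻¹]) =
        T (-1) * ∑ j ∈ Finset.range (n + 1),
          C (t.q ^ (-(n + 1 : ℤ) + j)) * T ((n + 1 : ℤ) - 2 * j) := by
      rw [Finset.mul_sum]
      refine Finset.sum_congr rfl fun j _ => ?_
      rw [LaurentPolynomial.T_add]; ring
    rw [h1, Finset.sum_range_succ', LaurentPolynomial.smul_eq_C_mul, map_mul C t.k₀⁻¹, map_sub]
    simp only [Nat.cast_zero, mul_zero, sub_zero, add_zero]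
    ring
  rw [e]
  refine Submodule.sub_mem _ (Submodule.neg_mem _ (C_mul_mem _ (Submodule.sum_mem _ ?_)))
    (C_mul_mem _ (Submodule.sum_mem _ ?_))
  all_goals
    intro j hj
    have := Finset.mem_range.mp hj
    exact C_mul_mem _ (T_mem (by push_cast; omega) (by push_cast; omega))

lemma T₁_one (t : Param) : T₁ t 1 = C t.k₁ := by
  rw [← LaurentPolynomial.T_zero]
  simp only [T₁, s₁, divDiff₁, LinearMap.add_apply, LinearMap.smul_apply, LinearMap.comp_apply, linExt_T]
  simp [LaurentPolynomial.smul_eq_C_mul]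

lemma T₀_one (t : Param) : T₀ t 1 = C t.k₀ := by
  rw [← LaurentPolynomial.T_zero]
  simp only [T₀, s₀, divDiff₀, LinearMap.add_apply, LinearMap.smul_apply, LinearMap.comp_apply, linExt_T]
  simp [LaurentPolynomial.smul_eq_C_mul]

lemma T₁_mem {k : ℤ} {f : ℂ[T;T⁻¹]} (hf : f ∈ lowerSpan (2 * k - 1)) :
    T₁ t f ∈ lowerSpan (2 * k - 1) := by
  refine lowerSpan_map_le (fun n hn => ?_) hf
  have hk : 0 < k := by have := rank_nonneg n; omega
  obtain ⟨h1, h2⟩ := (rank_lt_iff hk).mp hn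
  rcases lt_trichotomy n 0 with h | rfl | h
  · obtain ⟨l, rfl⟩ : ∃ l, n = -l := ⟨-n, by omega⟩
    rw [← sub_add_cancel (T₁ t (T (-l))) (C t.k₁ * T l + C (t.k₁ - t.k₁⁻¹) * T (-l))]
    exact add_mem (lowerSpan_mono (by omega) (T₁_T_neg t (by omega)))
      (add_mem (C_mul_mem _ (T_mem (by omega) (by omega)))
        (C_mul_mem _ (T_mem (by omega) (by omega))))
  · rw [LaurentPolynomial.T_zero, T₁_one, C_eq_smul_one, ← LaurentPolynomial.T_zero]
    exact Submodule.smul_mem _ _ (T_mem (by omega) (by omega))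
  · rw [← sub_add_cancel (T₁ t (T n)) (C t.k₁⁻¹ * T (-n))]
    exact add_mem (lowerSpan_mono (by omega) (T₁_T_pos t (by omega)))
      (C_mul_mem _ (T_mem (by omega) (by omega)))

lemma T₁_C_mul (c : ℂ) (f : ℂ[T;T⁻¹]) : T₁ t (C c * f) = C c * T₁ t f := by
  rw [← LaurentPolynomial.smul_eq_C_mul, map_smul, LaurentPolynomial.smul_eq_C_mul]

/-- `Y` is triangular with respect to the order `≺`, with the spectral points on the diagonal. -/
lemma Y_T_sub_mem (ht : t.Generic) (n : ℤ) :
    Y t (T n) - spec t n • T n ∈ lowerSpan (rank n) := by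
  have k0 := ht.k₀_ne
  have k1 := ht.k₁_ne
  rcases lt_trichotomy n 0 with h | rfl | h
  · obtain ⟨k, rfl⟩ : ∃ l, n = -l := ⟨-n, by omega⟩
    have hk : 0 < k := by omega
    rw [rank_neg hk]
    have h1 := T₀_T_neg t hk
    have h2 := T₁_T_pos t hk
    have h3 := T₁_mem (t := t) h1
    rw [map_sub, T₁_C_mul] at h3
    have e : Y t (T (-k)) - spec t (-k) • T (-k) = (T₁ t (T₀ t (T (-k))) -
        C (t.k₀⁻¹ * t.q ^ (-k)) * T₁ t (T k)) +
        C (t.k₀⁻¹ * t.q ^ (-k)) * (T₁ t (T k) - C t.k₁⁻¹ * T (-k)) := by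
      have : spec t (-k) = t.k₀⁻¹ * t.q ^ (-k) * t.k₁⁻¹ := by
        rw [spec, eps, if_neg (by omega), zpow_neg_one, zpow_neg_one]; ring
      rw [this, LaurentPolynomial.smul_eq_C_mul, map_mul C (t.k₀⁻¹ * t.q ^ (-k)), Y,
        LinearMap.comp_apply]
      ring
    rw [e]
    exact add_mem h3 (C_mul_mem _ h2)
  · have : Y t (T 0) - spec t 0 • T 0 = 0 := by
      rw [LaurentPolynomial.T_zero, Y, LinearMap.comp_apply, T₀_one, C_eq_smul_one, map_smul,
        T₁_one, C_eq_smul_one, smul_smul, spec, eps]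
      simp
    rw [this]
    exact zero_mem _
  · rw [rank_pos h.le]
    have h1 := T₁_mem (t := t) (T₀_T_pos t h)
    have h2 := T₁_T_pos t h
    have h3 := T₁_T_neg t h
    rw [map_sub, map_add, T₁_C_mul, T₁_C_mul] at h1
    have e : Y t (T n) - spec t n • T n =
        ((T₁ t (T₀ t (T n)) - (C (t.k₀ - t.k₀⁻¹) * T₁ t (T n) +
          C (t.k₀ * t.q ^ n) * T₁ t (T (-n)))) +
        C (t.k₀ - t.k₀⁻¹) * (T₁ t (T n) - C t.k₁⁻¹ * T (-n)) +
        C (t.k₀ * t.q ^ n) *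
          (T₁ t (T (-n)) - (C t.k₁ * T n + C (t.k₁ - t.k₁⁻¹) * T (-n)))) +
        C (t.k₀ - t.k₀⁻¹) * (C t.k₁⁻¹ * T (-n)) +
        C (t.k₀ * t.q ^ n) * (C (t.k₁ - t.k₁⁻¹) * T (-n)) := by
      have : spec t n = t.k₀ * t.q ^ n * t.k₁ := by
        rw [spec, eps, if_pos h.le, zpow_one, zpow_one]; ring
      rw [this, LaurentPolynomial.smul_eq_C_mul, map_mul C (t.k₀ * t.q ^ n), Y,
        LinearMap.comp_apply]
      ring
    have hT : (T (-n) : ℂ[T;T⁻¹]) ∈ lowerSpan (2 * n) :=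
      T_mem_lowerSpan (by rw [rank_neg h]; omega)
    have hle := lowerSpan_mono (show 2 * n - 1 ≤ 2 * n by omega)
    rw [e]
    exact add_mem (add_mem (hle (add_mem (add_mem h1 (C_mul_mem _ h2)) (C_mul_mem _ h3)))
      (C_mul_mem _ (C_mul_mem _ hT))) (C_mul_mem _ (C_mul_mem _ hT))

lemma lowerSpan_succ (n : ℤ) :
    lowerSpan (rank n + 1) = lowerSpan (rank n) ⊔ Submodule.span ℂ {T n} := by
  have : {k : ℤ | rank k < rank n + 1} = {k | rank k < rank n} ∪ {n} := by
    ext k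
    simp only [mem_ofPred_eq, mem_union, mem_singleton_iff]
    constructor
    · intro h
      rcases lt_or_eq_of_le (Int.lt_add_one_iff.mp h) with h | h
      · exact Or.inl h
      · exact Or.inr (rank_injective h)
    · rintro (h | rfl) <;> omega
  rw [lowerSpan, this, image_union, Submodule.span_union, image_singleton, lowerSpan]

lemma exists_rank_eq (r : ℕ) : ∃ n, rank n = r := by
  rcases Nat.even_or_odd' r with ⟨k, rfl | rfl⟩
  · exact ⟨k, by rw [rank_pos (by omega)]; push_cast; ring⟩
  · exact ⟨-(k + 1), by rw [rank_neg (by omega)]; push_cast; ring⟩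

/-- Back substitution for the triangular operator `Y - l`, whose diagonal entries `γ_n - l` are
nonzero on the monomials involved. -/
lemma exists_Y_sub_eq (ht : t.Generic) (l : ℂ) (r : ℕ)
    (hl : ∀ n, rank n < r → spec t n ≠ l) (f : ℂ[T;T⁻¹]) (hf : f ∈ lowerSpan r) :
    ∃ g ∈ lowerSpan r, Y t g - l • g = f := by
  induction r generalizing f with
  | zero =>
    have : lowerSpan ((0 : ℕ) : ℤ) = ⊥ := by
      rw [lowerSpan, show {n : ℤ | rank n < ((0 : ℕ) : ℤ)} = ∅ by
        ext n; have := rank_nonneg n; simp only [mem_ofPred_eq, mem_empty_iff_false, iff_false]; push_cast; omega]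
      simp
    rw [this, Submodule.mem_bot] at hf
    exact ⟨0, zero_mem _, by simp [hf]⟩
  | succ r ih =>
    obtain ⟨n, hn⟩ := exists_rank_eq r
    have ih' := ih fun k hk => hl k (by push_cast; omega)
    push_cast at hf ⊢
    rw [← hn] at hf ih' ⊢
    rw [lowerSpan_succ] at hf
    obtain ⟨f', hf', g', hg', rfl⟩ := Submodule.mem_sup.mp hf
    obtain ⟨c, rfl⟩ := Submodule.mem_span_singleton.mp hg'
    have hne : spec t n - l ≠ 0 := sub_ne_zero.mpr (hl n (by push_cast; omega))
    set e := c / (spec t n - l) with he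
    obtain ⟨g, hg, hgf⟩ := ih' (f' - e • (Y t (T n) - spec t n • T n))
      (sub_mem hf' (Submodule.smul_mem _ _ (Y_T_sub_mem ht n)))
    refine ⟨g + e • T n, add_mem (lowerSpan_mono (by omega) hg)
      (Submodule.smul_mem _ _ (T_mem_lowerSpan (by omega))), ?_⟩
    have hc : c = e * (spec t n - l) := by rw [he, div_mul_cancel₀ _ hne]
    rw [map_add, map_smul, hc]
    have : Y t g = l • g + (f' - e • (Y t (T n) - spec t n • T n)) := by rw [← hgf]; abel
    rw [this]
    module

end

section

variable {t : Param}

/-! ### The non-symmetric polynomials -/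

lemma q_zpow_ne_one (ht : t.Generic) {n : ℤ} (hn : n ≠ 0) : t.q ^ n ≠ 1 := by
  intro h
  have h1 := congrArg norm h
  rw [norm_zpow, norm_one, zpow_eq_one_iff_right₀ (norm_nonneg _) ht.q_lt.ne] at h1
  exact hn h1

lemma spec_natCast (t : Param) (m : ℕ) : spec t m = t.k₀ * t.k₁ * t.q ^ m := by
  simp [spec, eps]

lemma spec_neg_natCast (t : Param) {m : ℕ} (hm : m ≠ 0) : spec t (-m) = (spec t m)⁻¹ := by
  rw [spec_natCast, spec, eps, if_neg (by omega)]
  simp only [zpow_neg, zpow_one, zpow_natCast, mul_inv]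

lemma spec_eq_ite (t : Param) (m : ℤ) :
    spec t m = if 0 ≤ m then t.k₀ * t.k₁ * t.q ^ m else (t.k₀ * t.k₁)⁻¹ * t.q ^ m := by
  unfold spec eps
  split_ifs <;> simp [mul_comm]

lemma spec_ne_zero (ht : t.Generic) (m : ℤ) : spec t m ≠ 0 :=
  mul_ne_zero (mul_ne_zero (zpow_ne_zero _ ht.k₀_ne) (zpow_ne_zero _ ht.k₁_ne))
    (zpow_ne_zero _ ht.q_ne)

/-- The first dual parameter is `k₀ k₁`, so this is the dual separation condition with `e = f`. -/
lemma sq_k₀_mul_k₁_ne (ht : t.Generic) (n : ℤ) : (t.k₀ * t.k₁) ^ 2 ≠ t.q ^ n := by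
  have := ht.sep_dual t.dual.a (by simp) t.dual.a (by simp) n
  simp only [Param.a, Param.dual] at this
  intro h
  exact this (by rw [← mul_comm t.k₀, ← sq, h]; rfl)

lemma spec_injective (ht : t.Generic) : Function.Injective (spec t) := by
  have q0 := ht.q_ne
  have hK : t.k₀ * t.k₁ ≠ 0 := mul_ne_zero ht.k₀_ne ht.k₁_ne
  have hq : ∀ m n : ℤ, t.q ^ m = t.q ^ n → m = n := by
    intro m n h
    by_contra hmn
    refine q_zpow_ne_one ht (sub_ne_zero.mpr hmn) ?_
    rw [zpow_sub₀ q0, h, div_self (zpow_ne_zero _ q0)]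
  have hmix : ∀ m n : ℤ, t.k₀ * t.k₁ * t.q ^ m ≠ (t.k₀ * t.k₁)⁻¹ * t.q ^ n := by
    intro m n h
    refine sq_k₀_mul_k₁_ne ht (n - m) ?_
    rw [zpow_sub₀ q0, eq_div_iff (zpow_ne_zero _ q0)]
    rw [sq, mul_assoc, h, mul_inv_cancel_left₀ hK]
  intro m n h
  rw [spec_eq_ite, spec_eq_ite] at h
  split_ifs at h with h1 h2 h2
  · exact hq _ _ (mul_left_cancel₀ hK h)
  · exact (hmix _ _ h).elim
  · exact (hmix _ _ h.symm).elim
  · exact hq _ _ (mul_left_cancel₀ (inv_ne_zero hK) h)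

/-- A correction below `x^m` is obtained by solving a triangular system; its diagonal is nonzero
since the spectral points are distinct. Only existence is needed: every later argument uses just the
defining properties of the chosen polynomial. -/
lemma nonsym_spec (ht : t.Generic) (m : ℤ) : IsNonsym t m (nonsym t m) := by
  refine Classical.epsilon_spec (p := IsNonsym t m) ?_
  obtain ⟨r, hr⟩ := Int.eq_ofNat_of_zero_le (rank_nonneg m)
  have hY := Y_T_sub_mem ht m
  rw [hr] at hY
  obtain ⟨g, hg, h⟩ := exists_Y_sub_eq ht (spec t m) r
    (fun n hn h => by rw [spec_injective ht h, hr] at hn; exact lt_irrefl _ hn)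
    _ (Submodule.neg_mem _ hY)
  refine ⟨T m + g, ?_, ?_⟩
  · change T m + g - T m ∈ lowerSpan (rank m)
    rw [add_sub_cancel_left, hr]; exact hg
  · rw [map_add, eq_add_of_sub_eq h, smul_add]
    abel

lemma one_add_sq_ne_zero (ht : t.Generic) : 1 + t.k₁ ^ 2 ≠ 0 := fun h =>
  (ht.k₁_sq 0).2 (by rw [zpow_zero]; linear_combination h)

/-! ### The symmetric polynomials -/

/-- For `m > 0` a multiple of `C₊ P_{-m}` suffices: `T₁ x^(-m)` has leading term `k₁ x^m`, so `C₊
P_{-m}` has leading coefficient `k₁² / (1 + k₁²)`. For `m = 0` both `P_0` and `C₊ P_0` are `1`. -/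
lemma exists_monic_mem_Aplus (ht : t.Generic) (m : ℕ) :
    ∃ P, P ∈ Aplus t m ∧ IsMonicOfDegree m P := by
  have k1 := ht.k₁_ne
  have hk := one_add_sq_ne_zero ht
  rcases Nat.eq_zero_or_pos m with rfl | hm
  · have h0 := (nonsym_spec ht 0).1
    have h1 : nonsym t 0 = 1 := by
      have : lowerSpan (rank 0) = ⊥ := by
        rw [lowerSpan, show {n : ℤ | rank n < rank 0} = ∅ by
          ext n; have := rank_nonneg n
          rw [rank_pos le_rfl]
          simp only [mem_ofPred_eq, mem_empty_iff_false, iff_false]; omega]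
        simp
      change _ ∈ lowerSpan (rank 0) at h0
      rw [this, Submodule.mem_bot, LaurentPolynomial.T_zero] at h0
      exact sub_eq_zero.mp h0
    refine ⟨1, ⟨1, ?_, ?_⟩, ?_⟩
    · simp only [Nat.cast_zero, neg_zero, h1]
      exact Submodule.subset_span (by simp)
    · simp only [Cplus, LinearMap.smul_apply, LinearMap.add_apply, LinearMap.id_apply, T₁_one,
        C_eq_smul_one, smul_smul]
      have : (1 : ℂ[T;T⁻¹]) + (t.k₁ * t.k₁) • 1 = (1 + t.k₁ ^ 2) • 1 := by module
      rw [this, smul_smul, inv_mul_cancel₀ hk, one_smul]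
    · change _ ∈ lowerSpan _
      simp
  · have hm' : (0 : ℤ) < m := by omega
    have h0 : nonsym t (-m) - T (-m) ∈ lowerSpan (2 * m - 1) := by
      have := (nonsym_spec ht (-m)).1
      change _ ∈ lowerSpan _ at this
      rwa [rank_neg hm'] at this
    have h1 := T₁_mem (t := t) h0
    have h2 := T₁_T_neg t hm'
    refine ⟨((1 + t.k₁ ^ 2) / t.k₁ ^ 2) • Cplus t (nonsym t (-m)), Submodule.smul_mem _ _
      ⟨_, Submodule.subset_span (by simp), rfl⟩, ?_⟩
    change _ ∈ lowerSpan _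
    rw [rank_pos hm'.le]
    have hle := lowerSpan_mono (show 2 * (m : ℤ) - 1 ≤ 2 * m by omega)
    rw [map_sub] at h1
    have hT : (T (-m) : ℂ[T;T⁻¹]) ∈ lowerSpan (2 * m) :=
      T_mem_lowerSpan (by rw [rank_neg hm']; omega)
    have e : ((1 + t.k₁ ^ 2) / t.k₁ ^ 2) • Cplus t (nonsym t (-m)) - T (m : ℤ) =
        (t.k₁ ^ 2)⁻¹ • (nonsym t (-m) - T (-m)) + t.k₁⁻¹ • (T₁ t (nonsym t (-m)) - T₁ t (T (-m))) +
        t.k₁⁻¹ • (T₁ t (T (-m)) - (C t.k₁ * T (m : ℤ) + C (t.k₁ - t.k₁⁻¹) * T (-m))) +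
        T (-m) := by
      simp only [Cplus, LinearMap.smul_apply, LinearMap.add_apply, LinearMap.id_apply,
        ← LaurentPolynomial.smul_eq_C_mul]
      match_scalars <;> field_simp <;> ring
    rw [e]
    exact add_mem (hle (add_mem (add_mem (Submodule.smul_mem _ _ h0) (Submodule.smul_mem _ _ h1))
      (Submodule.smul_mem _ _ h2))) hT

lemma sym_spec (ht : t.Generic) (m : ℕ) : sym t m ∈ Aplus t m ∧ IsMonicOfDegree m (sym t m) :=
  Classical.epsilon_spec (exists_monic_mem_Aplus ht m)

/-- By the quadratic relation the image of `C₊` lies in the `k₁`-eigenspace of `T₁`. -/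
lemma T₁_Cplus (ht : t.Generic) (f : ℂ[T;T⁻¹]) : T₁ t (Cplus t f) = t.k₁ • Cplus t f := by
  have k1 := ht.k₁_ne
  simp only [Cplus, LinearMap.smul_apply, LinearMap.add_apply, LinearMap.id_apply, map_smul,
    map_add, T₁_sq ht]
  match_scalars <;> field_simp <;> ring

/-- The sum of `Y` and its inverse. -/
noncomputable def centralOp (t : Param) : ℂ[T;T⁻¹] →ₗ[ℂ] ℂ[T;T⁻¹] :=
  T₁ t ∘ₗ T₀ t + (T₀ t - (t.k₀ - t.k₀⁻¹) • LinearMap.id) ∘ₗ (T₁ t - (t.k₁ - t.k₁⁻¹) • LinearMap.id)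

lemma centralOp_apply (f : ℂ[T;T⁻¹]) : centralOp t f = T₁ t (T₀ t f) +
    (T₀ t (T₁ t f - (t.k₁ - t.k₁⁻¹) • f) - (t.k₀ - t.k₀⁻¹) • (T₁ t f - (t.k₁ - t.k₁⁻¹) • f)) := by
  simp [centralOp]

/-- In `centralOp` the inverses are written as `T_i⁻¹ = T_i - (k_i - k_i⁻¹)`. Expanding both sides,
the quadratic relation for `T₁` alone brings each to `T₁ T₀ T₁ + T₀⁻¹`. -/
lemma centralOp_T₁ (ht : t.Generic) (f : ℂ[T;T⁻¹]) :
    centralOp t (T₁ t f) = T₁ t (centralOp t f) := by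
  simp only [centralOp_apply, map_add, map_sub, map_smul, T₁_sq ht, add_sub_cancel_left]
  module

lemma centralOp_of_Y (ht : t.Generic) {f : ℂ[T;T⁻¹]} {γ : ℂ} (hγ : γ ≠ 0)
    (h : Y t f = γ • f) : centralOp t f = (γ + γ⁻¹) • f := by
  change T₁ t (T₀ t f) = _ at h
  have h1 := T₁_sq ht (T₀ t f)
  rw [h, map_smul] at h1
  have h2 : T₁ t f - (t.k₁ - t.k₁⁻¹) • f = γ⁻¹ • T₀ t f := by
    have : T₁ t f = γ⁻¹ • (γ • T₁ t f) := by rw [smul_smul, inv_mul_cancel₀ hγ, one_smul]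
    rw [this, h1]
    match_scalars <;> field_simp <;> ring
  rw [centralOp_apply, h2, h, map_smul, T₀_sq ht]
  module

lemma centralOp_Cplus (ht : t.Generic) (f : ℂ[T;T⁻¹]) :
    centralOp t (Cplus t f) = Cplus t (centralOp t f) := by
  simp only [Cplus, LinearMap.smul_apply, LinearMap.add_apply, LinearMap.id_apply, map_smul,
    map_add, centralOp_T₁ ht]

lemma T₁_sym (ht : t.Generic) (m : ℕ) : T₁ t (sym t m) = t.k₁ • sym t m := by
  obtain ⟨f, -, hf⟩ := (sym_spec ht m).1
  rw [← hf]; exact T₁_Cplus ht f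

/-- Both `P_m` and `P_{-m}` have eigenvalue `γ_m + γ_m⁻¹`, and `C₊` commutes with the operator. -/
lemma centralOp_sym (ht : t.Generic) (m : ℕ) :
    centralOp t (sym t m) = (spec t m + (spec t m)⁻¹) • sym t m := by
  obtain ⟨f, hf, hfs⟩ := (sym_spec ht m).1
  rw [← hfs, centralOp_Cplus ht, ← map_smul]
  congr 1
  obtain ⟨a, b, rfl⟩ := Submodule.mem_span_pair.mp hf
  rw [map_add, map_smul, map_smul, centralOp_of_Y ht (spec_ne_zero ht _) (nonsym_spec ht m).2,
    centralOp_of_Y ht (spec_ne_zero ht _) (nonsym_spec ht (-m)).2, spec_add_inv t (-m),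
    Int.natAbs_neg, Int.natAbs_natCast]
  module

lemma coeff₁_ne_zero (ht : t.Generic) {x : ℂ} (hx1 : 1 - x ^ 2 ≠ 0) (ha : 1 - t.a * x ≠ 0)
    (hb : 1 - t.b * x ≠ 0) : t.coeff₁ x ≠ 0 :=
  div_ne_zero (mul_ne_zero (inv_ne_zero ht.k₁_ne) (mul_ne_zero ha hb)) hx1

lemma finite_one_sub_mul (a : ℂ) : {x : ℂ | 1 - a * x = 0}.Finite := by
  rcases eq_or_ne a 0 with rfl | ha
  · simp
  · refine (finite_singleton a⁻¹).subset fun x (hx : 1 - a * x = 0) => ?_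
    rw [mem_singleton_iff]
    field_simp
    linear_combination -hx

/-- In `T₁ f = k₁ f` only the term `coeff₁ x * (f(x⁻¹) - f(x))` is left, and its coefficient has
finitely many zeros. -/
lemma evalLin_inv_sym (ht : t.Generic) (m : ℕ) (x : ℂ) :
    evalLin x⁻¹ (sym t m) = evalLin x (sym t m) := by
  rw [← evalLin_s₁]
  congr 1
  refine eq_of_evalLin_eq (((finite_sq_eq 1).union (finite_one_sub_mul t.a)).union
    (finite_one_sub_mul t.b)) fun x hx hx0 => ?_
  simp only [mem_union, mem_ofPred_eq, not_or] at hx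
  obtain ⟨⟨h1, ha⟩, hb⟩ := hx
  have h := congrArg (evalLin x) (T₁_sym ht m)
  rw [evalLin_T₁ ht hx0 h1, map_smul, smul_eq_mul, add_eq_left] at h
  rw [evalLin_s₁]
  exact sub_eq_zero.mp ((mul_eq_zero.mp h).resolve_left (coeff₁_ne_zero ht h1 ha hb))

lemma s₁_sym (ht : t.Generic) (m : ℕ) : s₁ (sym t m) = sym t m :=
  eq_of_evalLin_eq finite_empty fun x _ _ => by rw [evalLin_s₁, evalLin_inv_sym ht]

/-- On `k₁`-eigenvectors of `T₁` the inverse of `T₁` is the scalar `k₁⁻¹`, so `Y⁻¹` reduces to `k₁⁻¹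
(T₀ - (k₀ - k₀⁻¹))`. -/
lemma T₁_T₀_sym (ht : t.Generic) (m : ℕ) :
    T₁ t (T₀ t (sym t m)) + t.k₁⁻¹ • T₀ t (sym t m) =
      (spec t m + (spec t m)⁻¹ + (t.k₀ - t.k₀⁻¹) * t.k₁⁻¹) • sym t m := by
  have h := centralOp_sym ht m
  rw [centralOp_apply, T₁_sym ht m, ← sub_smul, sub_sub_cancel, map_smul, smul_smul] at h
  rw [add_smul, ← h]
  module

/-- The coefficient of the Askey-Wilson second order `q`-difference operator. -/
noncomputable def awCoeff (q a b c d x : ℂ) : ℂ :=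
  (1 - a * x) * (1 - b * x) * (1 - c * x) * (1 - d * x) / ((1 - x ^ 2) * (1 - q * x ^ 2))

/-- The second order `q`-difference equation for the symmetric Askey-Wilson polynomials. -/
lemma evalLin_sym_eigen (ht : t.Generic) (m : ℕ) {x : ℂ} (hx : x ≠ 0) (hx1 : 1 - x ^ 2 ≠ 0)
    (hx2 : t.q - x ^ 2 ≠ 0) (hx3 : 1 - t.q * x ^ 2 ≠ 0) :
    awCoeff t.q t.a t.b t.c t.d x * (evalLin (t.q * x) (sym t m) - evalLin x (sym t m)) +
      awCoeff t.q t.a t.b t.c t.d x⁻¹ * (evalLin (x / t.q) (sym t m) - evalLin x (sym t m)) =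
    awEigen t.q ((t.k₀ * t.k₁) ^ 2) m * evalLin x (sym t m) := by
  have k0 := ht.k₀_ne
  have k1 := ht.k₁_ne
  have q0 := ht.q_ne
  have h1' : 1 - x⁻¹ ^ 2 ≠ 0 := by
    have : 1 - x⁻¹ ^ 2 = -(1 - x ^ 2) / x ^ 2 := by field_simp; ring
    rw [this]
    exact div_ne_zero (neg_ne_zero.mpr hx1) (pow_ne_zero _ hx)
  have h2' : x ^ 2 - t.q ≠ 0 := fun h => hx2 (by linear_combination -h)
  have h3' : x⁻¹ ^ 2 - t.q ≠ 0 := by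
    have : x⁻¹ ^ 2 - t.q = (1 - t.q * x ^ 2) / x ^ 2 := by field_simp
    rw [this]
    exact div_ne_zero hx3 (pow_ne_zero _ hx)
  have h := congrArg (evalLin x) (T₁_T₀_sym ht m)
  rw [map_add, map_smul, map_smul, evalLin_T₁ ht hx hx1, evalLin_T₀ ht hx h2',
    evalLin_T₀ ht (inv_ne_zero hx) h3', inv_inv, evalLin_inv_sym ht, smul_eq_mul, smul_eq_mul,
    ← evalLin_inv_sym ht m (t.q * x⁻¹), show (t.q * x⁻¹)⁻¹ = x / t.q by field_simp] at h
  have e := coeff₁_add ht hx hx1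
  have e1 : awCoeff t.q t.a t.b t.c t.d x = t.k₀ * t.k₁ * (t.coeff₁ x * t.coeff₀ x⁻¹) := by
    simp only [awCoeff, Param.coeff₁, Param.coeff₀, inv_inv]
    field_simp
  have e2 : awCoeff t.q t.a t.b t.c t.d x⁻¹ = t.k₀ * t.k₁ * (t.coeff₁ x⁻¹ * t.coeff₀ x) := by
    simp only [awCoeff, Param.coeff₁, Param.coeff₀]
    field_simp
  -- Multiplication by `k₀ k₁` turns the eigenvalue of `Y + Y⁻¹` into that of the Askey-Wilson
  -- operator, up to the additive constant `κ + 1`.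
  have hs : t.k₀ * t.k₁ * (spec t m + (spec t m)⁻¹) =
      awEigen t.q ((t.k₀ * t.k₁) ^ 2) m + (t.k₀ * t.k₁) ^ 2 + 1 := by
    rw [spec_natCast, awEigen]
    field_simp
    ring
  rw [e1, e2]
  have e' : t.coeff₁ x⁻¹ = t.k₁ + t.k₁⁻¹ - t.coeff₁ x := by linear_combination e
  rw [e']
  have hk : t.k₀ * t.k₀⁻¹ = 1 := mul_inv_cancel₀ k0
  have hk' : t.k₁ * t.k₁⁻¹ = 1 := mul_inv_cancel₀ k1
  linear_combination (t.k₀ * t.k₁) * h + evalLin x (sym t m) * hs -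
    t.k₁ * t.k₁⁻¹ * evalLin x (sym t m) * hk - evalLin x (sym t m) * hk'

end

/-! ### Expansion in shifted factorials -/

/-- The coefficient functional of `x^k`. -/
noncomputable def coeffLin (k : ℤ) : ℂ[T;T⁻¹] →ₗ[ℂ] ℂ where
  toFun f := f.coeff k
  map_add' f g := by simp
  map_smul' c f := by simp

@[simp] lemma coeffLin_T (k n : ℤ) : coeffLin k (T n) = if n = k then 1 else 0 :=
  LaurentPolynomial.T_apply k n

lemma coeffLin_ext {f g : ℂ[T;T⁻¹]} (h : ∀ k, coeffLin k f = coeffLin k g) : f = g :=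
  LaurentPolynomial.ext h

lemma coeffLin_eq_zero_of_mem {r k : ℤ} (hk : r ≤ rank k) {f : ℂ[T;T⁻¹]} (hf : f ∈ lowerSpan r) :
    coeffLin k f = 0 := by
  have : lowerSpan r ≤ LinearMap.ker (coeffLin k) := by
    refine Submodule.span_le.mpr ?_
    rintro _ ⟨n, hn, rfl⟩
    have hn' : rank n < r := hn
    simp only [SetLike.mem_coe, LinearMap.mem_ker, coeffLin_T]
    rw [if_neg]
    rintro rfl
    omega
  exact this hf

lemma coeffLin_T_mul (k n : ℤ) (f : ℂ[T;T⁻¹]) : coeffLin k (T n * f) = coeffLin (k - n) f := by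
  refine congrArg (fun F => F f)
    (?_ : (coeffLin k).comp (LinearMap.mulLeft ℂ (T n : ℂ[T;T⁻¹])) = coeffLin (k - n))
  refine linearMap_ext_T fun m => ?_
  rw [LinearMap.comp_apply, LinearMap.mulLeft_apply, ← LaurentPolynomial.T_add, coeffLin_T,
    coeffLin_T]
  congr 1
  exact propext ⟨fun h => by omega, fun h => by omega⟩

lemma coeffLin_s₁ (k : ℤ) (f : ℂ[T;T⁻¹]) : coeffLin k (s₁ f) = coeffLin (-k) f := by
  refine congrArg (fun F => F f) (?_ : (coeffLin k).comp s₁ = coeffLin (-k))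
  refine linearMap_ext_T fun m => ?_
  rw [LinearMap.comp_apply, s₁, linExt_T, coeffLin_T, coeffLin_T]
  congr 1
  exact propext ⟨fun h => by omega, fun h => by omega⟩

/-- The Laurent polynomial `(ax, a/x; q)_j`. -/
noncomputable def symFactL (q a : ℂ) (j : ℕ) : ℂ[T;T⁻¹] :=
  ∏ i ∈ Finset.range j, ((1 + (a * q ^ i) ^ 2) • 1 - (a * q ^ i) • (T 1 + T (-1)))

lemma symFactL_succ (q a : ℂ) (j : ℕ) : symFactL q a (j + 1) =
    (1 + (a * q ^ j) ^ 2) • symFactL q a j -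
      (a * q ^ j) • (T 1 * symFactL q a j + T (-1) * symFactL q a j) := by
  rw [symFactL, Finset.prod_range_succ, ← symFactL, mul_sub, mul_smul_comm, mul_smul_comm, mul_one,
    mul_add, mul_comm _ (T 1), mul_comm _ (T (-1))]

lemma evalLin_symFactL (q a : ℂ) (j : ℕ) {x : ℂ} (hx : x ≠ 0) :
    evalLin x (symFactL q a j) = symFact q a j x := by
  induction j with
  | zero => simp [symFactL, symFact_zero]
  | succ j ih =>
    rw [symFactL_succ, symFact_succ, ← ih]
    simp only [map_sub, map_smul, map_add, evalLin_mul hx, evalLin_T, smul_eq_mul, zpow_one,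
      zpow_neg_one]
    linear_combination (-(a * q ^ j) ^ 2 * evalLin x (symFactL q a j)) * mul_inv_cancel₀ hx

lemma coeffLin_symFactL_succ (q a : ℂ) (j : ℕ) (k : ℤ) : coeffLin k (symFactL q a (j + 1)) =
    (1 + (a * q ^ j) ^ 2) * coeffLin k (symFactL q a j) -
      (a * q ^ j) * (coeffLin (k - 1) (symFactL q a j) + coeffLin (k + 1) (symFactL q a j)) := by
  rw [symFactL_succ, map_sub, map_smul, map_smul, map_add, coeffLin_T_mul, coeffLin_T_mul,
    sub_neg_eq_add, smul_eq_mul, smul_eq_mul]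

lemma coeffLin_symFactL_neg (q a : ℂ) (j : ℕ) (k : ℤ) :
    coeffLin (-k) (symFactL q a j) = coeffLin k (symFactL q a j) := by
  induction j generalizing k with
  | zero =>
    rw [symFactL, Finset.prod_range_zero, ← LaurentPolynomial.T_zero, coeffLin_T, coeffLin_T]
    congr 1
    exact propext ⟨fun h => by omega, fun h => by omega⟩
  | succ j ih =>
    rw [coeffLin_symFactL_succ, coeffLin_symFactL_succ, ih, show -k - 1 = -(k + 1) by ring,
      show -k + 1 = -(k - 1) by ring, ih, ih]
    ring

lemma coeffLin_symFactL_of_lt (q a : ℂ) {j : ℕ} {k : ℤ} (hk : (j : ℤ) < k) :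
    coeffLin k (symFactL q a j) = 0 := by
  induction j generalizing k with
  | zero =>
    rw [symFactL, Finset.prod_range_zero, ← LaurentPolynomial.T_zero, coeffLin_T, if_neg]
    push_cast at hk; omega
  | succ j ih =>
    push_cast at hk
    rw [coeffLin_symFactL_succ, ih (by omega), ih (by omega), ih (by omega)]
    ring

lemma coeffLin_symFactL_self (q a : ℂ) (j : ℕ) :
    coeffLin j (symFactL q a j) = ∏ i ∈ Finset.range j, -(a * q ^ i) := by
  induction j with
  | zero => simp [symFactL, ← LaurentPolynomial.T_zero, coeffLin_T]
  | succ j ih =>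
    rw [coeffLin_symFactL_succ, Finset.prod_range_succ, ← ih,
      coeffLin_symFactL_of_lt q a (k := ((j + 1 : ℕ) : ℤ)) (by push_cast; omega),
      coeffLin_symFactL_of_lt q a (k := ((j + 1 : ℕ) : ℤ) + 1) (by push_cast; omega),
      show ((j + 1 : ℕ) : ℤ) - 1 = j by push_cast; ring]
    ring

lemma coeffLin_symFactL_self_ne_zero {q a : ℂ} (hq : q ≠ 0) (ha : a ≠ 0) (j : ℕ) :
    coeffLin j (symFactL q a j) ≠ 0 := by
  rw [coeffLin_symFactL_self]
  exact Finset.prod_ne_zero_iff.mpr fun i _ => neg_ne_zero.mpr (mul_ne_zero ha (pow_ne_zero _ hq))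

/-- Elimination of the top coefficient: `(ax, a/x; q)_j` is symmetric with nonzero coefficient at
`x^j` and nothing beyond. -/
lemma exists_eq_sum_symFactL {q a : ℂ} (hq : q ≠ 0) (ha : a ≠ 0) (M : ℕ) (f : ℂ[T;T⁻¹])
    (hs : ∀ k, coeffLin (-k) f = coeffLin k f) (hM : ∀ k : ℤ, (M : ℤ) ≤ k → coeffLin k f = 0) :
    ∃ A : ℕ → ℂ, f = ∑ j ∈ Finset.range M, A j • symFactL q a j := by
  induction M generalizing f with
  | zero =>
    refine ⟨0, ?_⟩
    rw [Finset.sum_range_zero]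
    refine coeffLin_ext fun k => ?_
    rw [map_zero]
    rcases le_total 0 k with h | h
    · exact hM k (by push_cast; exact h)
    · rw [← hs]; exact hM (-k) (by push_cast; omega)
  | succ M ih =>
    have hne := coeffLin_symFactL_self_ne_zero hq ha M
    set e := coeffLin M f / coeffLin M (symFactL q a M) with he
    obtain ⟨A, hA⟩ := ih (f - e • symFactL q a M)
      (fun k => by simp only [map_sub, map_smul, hs, coeffLin_symFactL_neg])
      (fun k hk => by
        rw [map_sub, map_smul, smul_eq_mul]
        rcases hk.eq_or_lt with rfl | hk
        · rw [he, div_mul_cancel₀ _ hne, sub_self]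
        · rw [hM k (by push_cast; omega), coeffLin_symFactL_of_lt q a hk, mul_zero, sub_zero])
    refine ⟨Function.update A M e, ?_⟩
    rw [Finset.sum_range_succ, Function.update_self, ← sub_eq_iff_eq_add, hA]
    refine Finset.sum_congr rfl fun j hj => ?_
    rw [Function.update_of_ne (Finset.mem_range.mp hj).ne]

lemma coeffLin_sum_symFactL (q a : ℂ) (M : ℕ) (A : ℕ → ℂ) :
    coeffLin M (∑ j ∈ Finset.range (M + 1), A j • symFactL q a j) =
      A M * coeffLin M (symFactL q a M) := by
  rw [Finset.sum_range_succ, map_add, map_sum, Finset.sum_eq_zero, zero_add, map_smul, smul_eq_mul]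
  intro j hj
  rw [map_smul, coeffLin_symFactL_of_lt q a (by exact_mod_cast Finset.mem_range.mp hj), smul_zero]

lemma eq_zero_of_sum_symFactL_eq_zero {q a : ℂ} (hq : q ≠ 0) (ha : a ≠ 0) (M : ℕ) (A : ℕ → ℂ)
    (h : ∑ j ∈ Finset.range M, A j • symFactL q a j = 0) : ∀ j < M, A j = 0 := by
  induction M with
  | zero => intro j hj; omega
  | succ M ih =>
    have h1 := coeffLin_sum_symFactL q a M A
    rw [h, map_zero] at h1
    have h2 : A M = 0 :=
      (mul_eq_zero.mp h1.symm).resolve_right (coeffLin_symFactL_self_ne_zero hq ha M)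
    rw [Finset.sum_range_succ, h2, zero_smul, add_zero] at h
    intro j hj
    rcases (Nat.lt_succ_iff_lt_or_eq.mp hj) with hj | rfl
    · exact ih h j hj
    · exact h2

/-- Under `x ↦ qx` all but the boundary factors of the two shifted factorials cancel; the prefactor
`1 - ax` completes the missing one. -/
lemma symFact_shift_up {q a x : ℂ} (hq : q ≠ 0) (hx : x ≠ 0) (j : ℕ) :
    (1 - a * x) * (symFact q a (j + 1) (q * x) - symFact q a (j + 1) x) =
      symFact q a j x * (1 - a * q ^ j * x) *
        (-a * (1 - q ^ (j + 1)) * (1 - q * x ^ 2) / (q * x)) := by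
  have h1 : (1 - a * x) * qFact q (a * (q * x)) (j + 1) =
      qFact q (a * x) j * (1 - a * x * q ^ j) * (1 - a * x * q ^ (j + 1)) := by
    rw [show a * (q * x) = a * x * q by ring, ← qFact_succ', qFact_succ, qFact_succ]
  have h2 : qFact q (a * (q * x)⁻¹) (j + 1) = (1 - a * (q * x)⁻¹) * qFact q (a * x⁻¹) j := by
    rw [qFact_succ', show a * (q * x)⁻¹ * q = a * x⁻¹ by field_simp]
  have e : (1 - a * x) * symFact q a (j + 1) (q * x) = symFact q a j x *
      ((1 - a * x * q ^ j) * (1 - a * x * q ^ (j + 1)) * (1 - a * (q * x)⁻¹)) := by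
    simp only [symFact]
    rw [← mul_assoc, h1, h2]; ring
  rw [mul_sub, e, symFact_succ]
  field_simp
  ring

/-- The action of the Askey-Wilson operator on shifted factorials. -/
lemma awOperator_symFact {q a b c d κ x : ℂ} (hq : q ≠ 0) (hx : x ≠ 0) (hκ : a * b * c * d = q * κ)
    (hx1 : 1 - x ^ 2 ≠ 0) (hx2 : q - x ^ 2 ≠ 0) (hx3 : 1 - q * x ^ 2 ≠ 0) (j : ℕ) :
    awCoeff q a b c d x * (symFact q a (j + 1) (q * x) - symFact q a (j + 1) x) +
      awCoeff q a b c d x⁻¹ * (symFact q a (j + 1) (x / q) - symFact q a (j + 1) x) =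
    awEigen q κ (j + 1) * symFact q a (j + 1) x + awLower q a b c d (j + 1) * symFact q a j x := by
  have hinv : ∀ k y, symFact q a k y⁻¹ = symFact q a k y := fun k y => by
    simp only [symFact, inv_inv]; ring
  have h1 := symFact_shift_up (a := a) hq hx j
  have h2 := symFact_shift_up (a := a) hq (inv_ne_zero hx) j
  rw [hinv, hinv, ← hinv (j + 1) (q * x⁻¹), show (q * x⁻¹)⁻¹ = x / q by field_simp] at h2
  have hx1' : 1 - x⁻¹ ^ 2 = -(1 - x ^ 2) / x ^ 2 := by field_simp; ring
  have hx2' : 1 - q * x⁻¹ ^ 2 ≠ 0 := by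
    have : 1 - q * x⁻¹ ^ 2 = -(q - x ^ 2) / x ^ 2 := by field_simp; ring
    rw [this]
    exact div_ne_zero (neg_ne_zero.mpr hx2) (pow_ne_zero _ hx)
  have hcancel : ∀ u v w z y D : ℂ, D ≠ 0 →
      u / (v * D) * (w * (z * D / y)) = u * w * z / (v * y) := by
    intro u v w z y D hD
    rw [mul_div_assoc', div_mul_div_comm, show u * (w * (z * D)) = u * w * z * D by ring,
      show v * D * y = v * y * D by ring, mul_div_mul_right _ _ hD]
  have hκ' : κ = a * b * c * d / q := by rw [hκ]; field_simp
  have e1 : awCoeff q a b c d x * (symFact q a (j + 1) (q * x) - symFact q a (j + 1) x) =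
      (1 - b * x) * (1 - c * x) * (1 - d * x) / ((1 - x ^ 2) * (1 - q * x ^ 2)) *
        ((1 - a * x) * (symFact q a (j + 1) (q * x) - symFact q a (j + 1) x)) := by
    rw [awCoeff]; ring
  have e2 : awCoeff q a b c d x⁻¹ * (symFact q a (j + 1) (x / q) - symFact q a (j + 1) x) =
      (1 - b * x⁻¹) * (1 - c * x⁻¹) * (1 - d * x⁻¹) / ((1 - x⁻¹ ^ 2) * (1 - q * x⁻¹ ^ 2)) *
        ((1 - a * x⁻¹) * (symFact q a (j + 1) (x / q) - symFact q a (j + 1) x)) := by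
    rw [awCoeff]; ring
  rw [e1, e2, h1, h2, hcancel _ _ _ _ _ _ hx3, hcancel _ _ _ _ _ _ hx2', symFact_succ, hx1',
    awEigen, awLower, hκ']
  generalize symFact q a j x = F
  have hJ : q ^ j ≠ 0 := pow_ne_zero _ hq
  rw [pow_succ q j]
  clear h1 h2
  generalize q ^ j = J at *
  field_simp
  ring

/-- A symmetric monic eigenfunction of the Askey-Wilson operator, expanded in shifted
factorials. -/
lemma exists_expansion {q a b c d κ : ℂ} (hq0 : q ≠ 0) (hq : ‖q‖ < 1) (ha : a ≠ 0)
    (hκ : a * b * c * d = q * κ) (hab : ∀ n : ℕ, 1 - a * b * q ^ n ≠ 0)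
    (hac : ∀ n : ℕ, 1 - a * c * q ^ n ≠ 0) (had : ∀ n : ℕ, 1 - a * d * q ^ n ≠ 0)
    {m : ℕ} {p : ℂ[T;T⁻¹]} (hs : ∀ k, coeffLin (-k) p = coeffLin k p)
    (hdeg : ∀ k : ℤ, (m : ℤ) < k → coeffLin k p = 0) (hmonic : coeffLin m p = 1)
    (heig : ∀ x : ℂ, x ≠ 0 → 1 - x ^ 2 ≠ 0 → q - x ^ 2 ≠ 0 → 1 - q * x ^ 2 ≠ 0 →
      awCoeff q a b c d x * (evalLin (q * x) p - evalLin x p) +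
        awCoeff q a b c d x⁻¹ * (evalLin (x / q) p - evalLin x p) =
      awEigen q κ m * evalLin x p) :
    ∃ A : ℕ → ℂ, p = ∑ j ∈ Finset.range (m + 1), A j • symFactL q a j ∧
      (∀ j < m, A (j + 1) * awLower q a b c d (j + 1) = (awEigen q κ m - awEigen q κ j) * A j) ∧
      A m * ∏ i ∈ Finset.range m, -(a * q ^ i) = 1 ∧ A 0 ≠ 0 := by
  obtain ⟨A, hA⟩ := exists_eq_sum_symFactL hq0 ha (m + 1) p hs
    fun k hk => hdeg k (by push_cast at hk; omega)
  have hlead : A m * ∏ i ∈ Finset.range m, -(a * q ^ i) = 1 := by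
    rw [← coeffLin_symFactL_self, ← coeffLin_sum_symFactL, ← hA, hmonic]
  have hrec : ∀ j < m, A (j + 1) * awLower q a b c d (j + 1) =
      (awEigen q κ m - awEigen q κ j) * A j := by
    -- The eigenvalue equation with the lowering terms reindexed. The conditional records that no
    -- term lowers into degree `m`; linear independence of the `symFactL` then gives the recurrence.
    have hz : ∑ j ∈ Finset.range (m + 1), (A j * (awEigen q κ j - awEigen q κ m) +
        if j < m then A (j + 1) * awLower q a b c d (j + 1) else 0) • symFactL q a j = 0 := by
      refine eq_of_evalLin_eq (((finite_sq_eq 1).union (finite_sq_eq q)).union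
        (finite_sq_eq q⁻¹)) fun x hx hx0 => ?_
      simp only [mem_union, mem_ofPred_eq, not_or] at hx
      obtain ⟨⟨h1, h2⟩, h3⟩ := hx
      have h3' : 1 - q * x ^ 2 ≠ 0 := fun h => h3 (by field_simp; linear_combination h)
      have h := heig x hx0 h1 h2 h3'
      have hev : ∀ y : ℂ, y ≠ 0 → evalLin y p =
          ∑ j ∈ Finset.range (m + 1), A j * symFact q a j y := fun y hy => by
        conv_lhs => rw [hA]
        simp only [map_sum, map_smul, evalLin_symFactL q a _ hy, smul_eq_mul]
      rw [hev x hx0, hev _ (mul_ne_zero hq0 hx0), hev _ (div_ne_zero hx0 hq0),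
        ← Finset.sum_sub_distrib, ← Finset.sum_sub_distrib, Finset.mul_sum, Finset.mul_sum,
        ← Finset.sum_add_distrib, Finset.mul_sum] at h
      have hop : ∀ j, awCoeff q a b c d x * (A j * symFact q a j (q * x) - A j * symFact q a j x) +
          awCoeff q a b c d x⁻¹ * (A j * symFact q a j (x / q) - A j * symFact q a j x) =
          A j * awEigen q κ j * symFact q a j x +
            A j * awLower q a b c d j * symFact q a (j - 1) x := by
        intro j
        cases j with
        | zero => simp [symFact_zero, awLower_zero, awEigen]
        | succ j =>
          have := awOperator_symFact hq0 hx0 hκ h1 h2 h3' j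
          rw [Nat.add_sub_cancel]
          linear_combination A (j + 1) * this
      rw [Finset.sum_congr rfl fun j _ => hop j, Finset.sum_add_distrib,
        Finset.sum_range_succ' (fun j => A j * awLower q a b c d j * symFact q a (j - 1) x),
        awLower_zero, mul_zero, zero_mul, add_zero] at h
      simp only [map_sum, map_smul, evalLin_symFactL q a _ hx0, smul_eq_mul, map_zero, add_mul,
        ite_mul, zero_mul, Finset.sum_add_distrib]
      have hif : ∑ j ∈ Finset.range (m + 1), (if j < m then
          A (j + 1) * awLower q a b c d (j + 1) * symFact q a j x else 0) =
          ∑ j ∈ Finset.range m, A (j + 1) * awLower q a b c d (j + 1) * symFact q a j x := by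
        rw [Finset.sum_range_succ, if_neg (lt_irrefl m), add_zero]
        exact Finset.sum_congr rfl fun j hj => if_pos (Finset.mem_range.mp hj)
      rw [hif]
      simp only [Nat.add_sub_cancel] at h
      have hd : ∑ j ∈ Finset.range (m + 1), A j * (awEigen q κ j - awEigen q κ m) *
          symFact q a j x = ∑ j ∈ Finset.range (m + 1), A j * awEigen q κ j * symFact q a j x -
          ∑ j ∈ Finset.range (m + 1), awEigen q κ m * (A j * symFact q a j x) := by
        rw [← Finset.sum_sub_distrib]
        exact Finset.sum_congr rfl fun j _ => by ring
      rw [hd]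
      linear_combination h
    intro j hj
    have := eq_zero_of_sum_symFactL_eq_zero hq0 ha (m + 1) _ hz j (by omega)
    rw [if_pos hj] at this
    linear_combination this
  refine ⟨A, hA, hrec, hlead, ?_⟩
  -- A zero coefficient propagates upward, because the lowering coefficients do not vanish when
  -- `ab`, `ac`, `ad` avoid the powers of `q`. This would contradict the leading coefficient.
  have hdesc : ∀ j ≤ m, A j = 0 → A m = 0 := by
    intro j hj
    induction hj using Nat.decreasingInduction with
    | self => exact id
    | of_succ j hj ih =>
      intro h0
      refine ih ?_
      have := hrec j hj
      rw [h0, mul_zero] at this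
      refine (mul_eq_zero.mp this).resolve_right ?_
      have hpow : ∀ e : ℂ, a * e * q ^ (j + 1) / q = a * e * q ^ j := fun e => by
        rw [pow_succ]; field_simp
      rw [awLower, hpow, hpow, hpow]
      refine mul_ne_zero (mul_ne_zero (mul_ne_zero (neg_ne_zero.mpr ?_) (hab j)) (hac j)) (had j)
      rw [inv_eq_one_div, div_sub_one (pow_ne_zero _ hq0)]
      exact div_ne_zero (one_sub_pow_ne_zero hq j) (pow_ne_zero _ hq0)
  intro h0
  rw [hdesc 0 (Nat.zero_le m) h0, zero_mul] at hlead
  exact zero_ne_one hlead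

/-! ### Residues at simple poles -/

/-- `f` has at most a simple pole at `z`, with residue `r`. -/
def HasSimplePole (f : ℂ → ℂ) (z r : ℂ) : Prop :=
  ∃ h : ℂ → ℂ, AnalyticAt ℂ h z ∧ h z = r ∧ ∀ᶠ y in 𝓝[≠] z, f y = h y / (y - z)

/-- Cauchy's formula on small circles: the normalized integral is already constant for small radii.
-/
lemma HasSimplePole.residue_eq {f : ℂ → ℂ} {z r : ℂ} (hf : HasSimplePole f z r) :
    residue f z = r := by
  obtain ⟨h, ha, hr, he⟩ := hf
  have h1 : ∀ᶠ y in 𝓝 z, AnalyticAt ℂ h y ∧ (y ≠ z → f y = h y / (y - z)) :=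
    ha.eventually_analyticAt.and (eventually_nhdsWithin_iff.mp he)
  obtain ⟨ε, hε, hball⟩ := Metric.eventually_nhds_iff_ball.mp h1
  refine Tendsto.limUnder_eq (tendsto_const_nhds.congr' ?_)
  filter_upwards [Ioo_mem_nhdsGT hε] with ρ hρ
  have hsub : Metric.closedBall z ρ ⊆ Metric.ball z ε := Metric.closedBall_subset_ball hρ.2
  have hc : ∮ y in C(z, ρ), f y = ∮ y in C(z, ρ), (y - z)⁻¹ • h y := by
    refine circleIntegral.integral_congr hρ.1.le fun y hy => ?_
    have hne : y ≠ z := by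
      rintro rfl
      rw [mem_sphere_iff_norm, sub_self, norm_zero] at hy
      exact hρ.1.ne hy
    change f y = (y - z)⁻¹ • h y
    rw [(hball y (hsub (Metric.sphere_subset_closedBall hy))).2 hne, smul_eq_mul, div_eq_inv_mul]
  have hd : DifferentiableOn ℂ h (Metric.closedBall z ρ) := fun y hy =>
    (hball y (hsub hy)).1.differentiableAt.differentiableWithinAt
  rw [hc, (hd.diffContOnCl_ball subset_rfl).circleIntegral_sub_inv_smul
    (Metric.mem_ball_self hρ.1), hr, smul_eq_mul, inv_mul_cancel_left₀ Complex.two_pi_I_ne_zero]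

/-- Pulling back a simple pole along a dilation. -/
lemma HasSimplePole.of_dilation {f s : ℂ → ℂ} {q z r : ℂ} (hq : q ≠ 0)
    (hf : HasSimplePole f (q * z) r) (hs : AnalyticAt ℂ s z)
    (h : ∀ᶠ y in 𝓝 z, f y = q * s y * f (q * y)) : HasSimplePole f z (s z * r) := by
  obtain ⟨g, ha, hr, he⟩ := hf
  have hmul : AnalyticAt ℂ (fun y => q * y) z := analyticAt_const.mul analyticAt_id
  refine ⟨fun y => s y * g (q * y), hs.mul (ha.fun_comp hmul), by simp only [hr], ?_⟩
  have ht : Tendsto (fun y => q * y) (𝓝[≠] z) (𝓝[≠] (q * z)) :=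
    tendsto_nhdsWithin_of_tendsto_nhds_of_eventually_within _
      (hmul.continuousAt.tendsto.mono_left nhdsWithin_le_nhds)
      (eventually_nhdsWithin_of_forall fun y hy => fun h => hy (mul_left_cancel₀ hq h))
  filter_upwards [ht.eventually he, h.filter_mono nhdsWithin_le_nhds] with y h1 h2
  rw [h2, h1, ← mul_sub]
  field_simp

/-- Pulling back a simple pole along an inversion. -/
lemma HasSimplePole.of_inv {f : ℂ → ℂ} {z r : ℂ} (hz : z ≠ 0) (hf : HasSimplePole f z r)
    (h : ∀ y, y ≠ 0 → f y = f y⁻¹ / y ^ 2) : HasSimplePole f z⁻¹ (-r) := by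
  obtain ⟨g, ha, hr, he⟩ := hf
  have hinv : AnalyticAt ℂ (fun y : ℂ => y⁻¹) z⁻¹ := analyticAt_inv (inv_ne_zero hz)
  refine ⟨fun y => -(g y⁻¹ / (z * y)), ?_, ?_, ?_⟩
  · refine ((AnalyticAt.fun_comp (by rwa [inv_inv]) hinv).div
      (analyticAt_const.mul analyticAt_id) ?_).neg
    simp [hz]
  · simp [hz, hr]
  have ht : Tendsto (fun y : ℂ => y⁻¹) (𝓝[≠] z⁻¹) (𝓝[≠] z) := by
    refine tendsto_nhdsWithin_of_tendsto_nhds_of_eventually_within _ ?_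
      (eventually_nhdsWithin_of_forall fun y hy h => hy ?_)
    · have := hinv.continuousAt.tendsto
      rw [inv_inv] at this
      exact this.mono_left nhdsWithin_le_nhds
    · rw [mem_singleton_iff] at h ⊢
      rw [← h, inv_inv]
  filter_upwards [ht.eventually he, self_mem_nhdsWithin,
    (eventually_ne_nhds (inv_ne_zero hz)).filter_mono nhdsWithin_le_nhds] with y h1 hy hy0
  have hne : 1 - z * y ≠ 0 := fun h => hy (by
    rw [mem_singleton_iff]; field_simp; linear_combination -h)
  have hne' : y - z⁻¹ ≠ 0 := sub_ne_zero.mpr hy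
  have e1 : y⁻¹ - z = (1 - z * y) / y := by field_simp
  have e2 : y - z⁻¹ = -(1 - z * y) / z := by field_simp; ring
  rw [h y hy0, h1, e1, e2]
  field_simp

/-! ### Shift and poles of the Askey-Wilson weight -/

section Weight

variable {q a b c d : ℂ}

lemma analyticAt_qPoch_comp (hq : ‖q‖ < 1) {g : ℂ → ℂ} {z : ℂ} (hg : AnalyticAt ℂ g z) :
    AnalyticAt ℂ (fun y => qPoch q (g y)) z :=
  AnalyticAt.fun_comp ((differentiable_qPoch hq).analyticAt _) hg

lemma awWeight_inv (q a b c d x : ℂ) : awWeight q a b c d x⁻¹ = awWeight q a b c d x := by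
  simp only [awWeight, inv_inv]
  ring

/-- The quotient of the weight function at `x` and `q x`. -/
noncomputable def awShift (q a b c d x : ℂ) : ℂ :=
  (1 - x ^ 2) * (1 - q * x ^ 2) * ((1 - a * (q * x)⁻¹) * (1 - b * (q * x)⁻¹) *
    (1 - c * (q * x)⁻¹) * (1 - d * (q * x)⁻¹)) /
  ((1 - (q * x)⁻¹ ^ 2) * (1 - q * (q * x)⁻¹ ^ 2) *
    ((1 - a * x) * (1 - b * x) * (1 - c * x) * (1 - d * x)))

lemma awWeight_eq_shift_mul (hq0 : q ≠ 0) (hq : ‖q‖ < 1) {x : ℂ} (hx : x ≠ 0)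
    (h1 : 1 - (q * x)⁻¹ ^ 2 ≠ 0) (h2 : 1 - q * (q * x)⁻¹ ^ 2 ≠ 0)
    (h3 : ∀ e ∈ ({a, b, c, d} : Set ℂ), 1 - e * (q * x)⁻¹ ≠ 0) :
    awWeight q a b c d x = awShift q a b c d x * awWeight q a b c d (q * x) := by
  have ha := h3 a (by simp)
  have hb := h3 b (by simp)
  have hc := h3 c (by simp)
  have hd := h3 d (by simp)
  have e1 : qPoch q (x ^ 2) = (1 - x ^ 2) * (1 - q * x ^ 2) * qPoch q ((q * x) ^ 2) := by
    rw [qPoch_eq_mul hq, qPoch_eq_mul hq (x ^ 2 * q), show x ^ 2 * q * q = (q * x) ^ 2 by ring]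
    ring
  have e2 : qPoch q ((q * x)⁻¹ ^ 2) =
      (1 - (q * x)⁻¹ ^ 2) * (1 - q * (q * x)⁻¹ ^ 2) * qPoch q (x⁻¹ ^ 2) := by
    rw [qPoch_eq_mul hq, qPoch_eq_mul hq ((q * x)⁻¹ ^ 2 * q),
      show (q * x)⁻¹ ^ 2 * q * q = x⁻¹ ^ 2 by field_simp]
    ring
  have e3 : ∀ e, qPoch q (e * x) = (1 - e * x) * qPoch q (e * (q * x)) := fun e => by
    rw [qPoch_eq_mul hq, show e * x * q = e * (q * x) by ring]
  have e4 : ∀ e, qPoch q (e * (q * x)⁻¹) = (1 - e * (q * x)⁻¹) * qPoch q (e * x⁻¹) := fun e => by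
    rw [qPoch_eq_mul hq, show e * (q * x)⁻¹ * q = e * x⁻¹ by field_simp]
  simp only [awWeight, awShift, e1, e2, e3, e4]
  generalize qPoch q ((q * x) ^ 2) = P1 at *
  generalize qPoch q (x⁻¹ ^ 2) = P2 at *
  generalize (q * x)⁻¹ = v at *
  simp only [div_eq_mul_inv, mul_inv]
  have ca := mul_inv_cancel₀ ha
  have cb := mul_inv_cancel₀ hb
  have cc := mul_inv_cancel₀ hc
  have cd := mul_inv_cancel₀ hd
  have c1 := mul_inv_cancel₀ h1
  have c2 := mul_inv_cancel₀ h2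
  generalize (1 - a * v)⁻¹ = a' at *
  generalize (1 - b * v)⁻¹ = b' at *
  generalize (1 - c * v)⁻¹ = c' at *
  generalize (1 - d * v)⁻¹ = d' at *
  generalize (1 - v ^ 2)⁻¹ = m1 at *
  generalize (1 - q * v ^ 2)⁻¹ = m2 at *
  generalize 1 - a * v = a'' at *
  generalize 1 - b * v = b'' at *
  generalize 1 - c * v = c'' at *
  generalize 1 - d * v = d'' at *
  generalize 1 - v ^ 2 = n1 at *
  generalize 1 - q * v ^ 2 = n2 at *
  -- Only the factors known to be nonzero are cancelled. The remaining inverses occur on both sides,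
  -- so the identity persists where they are inverses of zero, in particular at poles of the weight.
  trans (a'' * a') * (b'' * b') * (c'' * c') * (d'' * d') * (n1 * m1) * (n2 * m2) *
    ((1 - x ^ 2) * (1 - q * x ^ 2) * P1 * P2 *
      ((1 - a * x)⁻¹ * (qPoch q (a * (q * x)))⁻¹ * (qPoch q (a * x⁻¹))⁻¹ *
        ((1 - b * x)⁻¹ * (qPoch q (b * (q * x)))⁻¹) * (qPoch q (b * x⁻¹))⁻¹ *
        ((1 - c * x)⁻¹ * (qPoch q (c * (q * x)))⁻¹) * (qPoch q (c * x⁻¹))⁻¹ *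
        ((1 - d * x)⁻¹ * (qPoch q (d * (q * x)))⁻¹) * (qPoch q (d * x⁻¹))⁻¹))
  · rw [ca, cb, cc, cd, c1, c2]; ring
  · ring

/-- The residue of the weight function at `a⁻¹`. -/
noncomputable def awBaseResidue (q a b c d : ℂ) : ℂ :=
  -(qPoch q (a⁻¹ ^ 2) * qPoch q (a ^ 2) /
    (qPoch q q * qPoch q (a * a) * (qPoch q (b * a⁻¹) * qPoch q (b * a)) *
      (qPoch q (c * a⁻¹) * qPoch q (c * a)) * (qPoch q (d * a⁻¹) * qPoch q (d * a))))

/-- The pole comes from the first factor `1 - ay = -a(y - a⁻¹)` of `(ay; q)_∞`; the hypotheses say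
that every other factor of the denominator is nonzero at `a⁻¹`. -/
lemma hasSimplePole_awWeight (hq : ‖q‖ < 1) (ha : a ≠ 0)
    (hqq : qPoch q q ≠ 0) (haa : qPoch q (a * a) ≠ 0)
    (h : ∀ e ∈ ({b, c, d} : Set ℂ), qPoch q (e * a⁻¹) ≠ 0 ∧ qPoch q (e * a) ≠ 0) :
    HasSimplePole (fun y => awWeight q a b c d y / y) a⁻¹ (awBaseResidue q a b c d) := by
  have ha' := inv_ne_zero ha
  obtain ⟨hb1, hb2⟩ := h b (by simp)
  obtain ⟨hc1, hc2⟩ := h c (by simp)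
  obtain ⟨hd1, hd2⟩ := h d (by simp)
  have hid : AnalyticAt ℂ (fun y : ℂ => y) a⁻¹ := analyticAt_id
  have hinv : AnalyticAt ℂ (fun y : ℂ => y⁻¹) a⁻¹ := analyticAt_inv ha'
  have hP : ∀ {g : ℂ → ℂ}, AnalyticAt ℂ g a⁻¹ → AnalyticAt ℂ (fun y => qPoch q (g y)) a⁻¹ :=
    fun hg => analyticAt_qPoch_comp hq hg
  have hm : ∀ e : ℂ, AnalyticAt ℂ (fun y => qPoch q (e * y)) a⁻¹ := fun e =>
    hP (analyticAt_const.mul hid)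
  have hmi : ∀ e : ℂ, AnalyticAt ℂ (fun y => qPoch q (e * y⁻¹)) a⁻¹ := fun e =>
    hP (analyticAt_const.mul hinv)
  refine ⟨fun y => -(qPoch q (y ^ 2) * qPoch q (y⁻¹ ^ 2) /
    (qPoch q (a * q * y) * qPoch q (a * y⁻¹) * (qPoch q (b * y) * qPoch q (b * y⁻¹)) *
      (qPoch q (c * y) * qPoch q (c * y⁻¹)) * (qPoch q (d * y) * qPoch q (d * y⁻¹)) * (a * y))),
    ?_, ?_, ?_⟩
  · refine (((hP (hid.pow 2)).mul (hP (hinv.pow 2))).div ((((((hm _).mul (hmi _)).mul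
      ((hm _).mul (hmi _))).mul ((hm _).mul (hmi _))).mul ((hm _).mul (hmi _))).mul
      (analyticAt_const.mul hid)) ?_).neg
    change qPoch q (a * q * a⁻¹) * qPoch q (a * a⁻¹⁻¹) *
      (qPoch q (b * a⁻¹) * qPoch q (b * a⁻¹⁻¹)) * (qPoch q (c * a⁻¹) * qPoch q (c * a⁻¹⁻¹)) *
      (qPoch q (d * a⁻¹) * qPoch q (d * a⁻¹⁻¹)) * (a * a⁻¹) ≠ 0
    rw [inv_inv, show a * q * a⁻¹ = q by field_simp, mul_inv_cancel₀ ha, mul_one]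
    simp only [ne_eq, mul_eq_zero, not_or]
    exact ⟨⟨⟨⟨hqq, haa⟩, hb1, hb2⟩, hc1, hc2⟩, hd1, hd2⟩
  · simp only [inv_inv, show a * q * a⁻¹ = q by field_simp, mul_inv_cancel₀ ha, mul_one,
      awBaseResidue]
  · filter_upwards [self_mem_nhdsWithin] with y hy
    have hne' : y - a⁻¹ ≠ 0 := sub_ne_zero.mpr hy
    have e : qPoch q (a * y) = -(a * (y - a⁻¹)) * qPoch q (a * q * y) := by
      rw [qPoch_eq_mul hq, show a * y * q = a * q * y by ring, mul_sub, mul_inv_cancel₀ ha]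
      ring
    simp only [awWeight, e, div_eq_mul_inv, mul_inv, inv_neg, neg_mul, mul_neg]
    ring

end Weight

section

variable {t : Param}

/-! ### The dual weights -/

lemma one_sub_mul_pow_ne_zero (ht : t.Generic) {x : ℂ} (h : ∀ n : ℤ, x ≠ t.q ^ n) (n : ℕ) :
    1 - x * t.q ^ n ≠ 0 := fun h0 => h (-n) (by
  have := pow_ne_zero n ht.q_ne
  rw [zpow_neg, zpow_natCast]
  field_simp
  linear_combination -h0)

lemma qPoch_ne_zero_of_ne_zpow (ht : t.Generic) {x : ℂ} (h : ∀ n : ℤ, x ≠ t.q ^ n) :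
    qPoch t.q x ≠ 0 :=
  qPoch_ne_zero ht.q_lt (one_sub_mul_pow_ne_zero ht h)

lemma rq_ne_zero (ht : t.Generic) : t.rq ≠ 0 := fun h => ht.q_ne (by simp [Param.q, h])

lemma dual_a_ne_zero (ht : t.Generic) : t.dual.a ≠ 0 := mul_ne_zero ht.k₁_ne ht.k₀_ne

lemma dual_a_eq (t : Param) : t.dual.a = t.k₀ * t.k₁ := mul_comm _ _

/-- The ratios of the dual parameters are not powers of `q`. -/
lemma dual_ratio_ne (ht : t.Generic) : ∀ e ∈ ({t.dual.b, t.dual.c, t.dual.d} : Set ℂ),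
    ∀ n : ℤ, e * t.dual.a⁻¹ ≠ t.q ^ n := by
  have k0 := ht.k₀_ne
  have k1 := ht.k₁_ne
  have u0 := ht.u₀_ne
  have u1 := ht.u₁_ne
  have q0 := ht.q_ne
  have hr := rq_ne_zero ht
  intro e he n h
  simp only [mem_insert_iff, mem_singleton_iff] at he
  -- The quotient of the second dual parameter by the first is `-k₀⁻²`, excluded by the condition on
  -- `k₀²`. The quotients of the third and fourth by the first are `q/(bd)` and `q/(bc)`, excluded
  -- by separation of the original parameters.
  have key : ∀ {f g : ℂ}, f ∈ ({t.a, t.b, t.c, t.d} : Set ℂ) → g ∈ ({t.a, t.b, t.c, t.d} : Set ℂ) →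
      f * g * (e * t.dual.a⁻¹) = t.q → False := by
    intro f g hf hg hfg
    refine ht.sep f hf g hg (1 - n) ?_
    rw [zpow_sub₀ q0, zpow_one, eq_div_iff (zpow_ne_zero _ q0), ← h, hfg]
  rcases he with rfl | rfl | rfl
  · refine (ht.k₀_sq (-n)).2 ?_
    rw [zpow_neg, ← h]
    simp only [Param.a, Param.b, Param.dual]
    field_simp
  · refine key (f := t.b) (g := t.d) (by simp) (by simp) ?_
    simp only [Param.a, Param.b, Param.c, Param.d, Param.dual, Param.q]
    field_simp
  · refine key (f := t.b) (g := t.c) (by simp) (by simp) ?_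
    simp only [Param.a, Param.b, Param.c, Param.d, Param.dual, Param.q]
    field_simp

lemma dual_mul_ne (ht : t.Generic) : ∀ e ∈ ({t.dual.a, t.dual.b, t.dual.c, t.dual.d} : Set ℂ),
    ∀ n : ℤ, e * t.dual.a ≠ t.q ^ n := fun e he n =>
  ht.sep_dual e he t.dual.a (by simp) n

/-- The residues of the dual weight function at the inverse spectral points. -/
noncomputable def dualResidue (t : Param) : ℕ → ℂ
  | 0 => awBaseResidue t.q t.dual.a t.dual.b t.dual.c t.dual.d
  | m + 1 => awShift t.q t.dual.a t.dual.b t.dual.c t.dual.d (spec t (m + 1 : ℕ))⁻¹ *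
      dualResidue t m

lemma q_mul_inv_spec (ht : t.Generic) (m : ℕ) :
    t.q * (spec t (m + 1 : ℕ))⁻¹ = (spec t m)⁻¹ := by
  have := ht.q_ne
  have := spec_ne_zero ht m
  rw [spec_natCast, spec_natCast, pow_succ] at *
  field_simp

lemma spec_sq (t : Param) (m : ℕ) : spec t m ^ 2 = t.dual.a * t.dual.a * t.q ^ (2 * m) := by
  rw [spec_natCast, dual_a_eq]; ring

lemma one_sub_spec_sq_ne (ht : t.Generic) (m : ℕ) : 1 - spec t m ^ 2 ≠ 0 := by
  rw [spec_sq]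
  exact one_sub_mul_pow_ne_zero ht (dual_mul_ne ht _ (by simp)) _

lemma one_sub_q_spec_sq_ne (ht : t.Generic) (m : ℕ) : 1 - t.q * spec t m ^ 2 ≠ 0 := by
  have := one_sub_mul_pow_ne_zero ht (dual_mul_ne ht t.dual.a (by simp)) (2 * m + 1)
  rw [spec_sq]
  convert! this using 2
  ring

lemma one_sub_mul_spec_ne (ht : t.Generic) {e : ℂ}
    (he : e ∈ ({t.dual.a, t.dual.b, t.dual.c, t.dual.d} : Set ℂ)) (m : ℕ) :
    1 - e * spec t m ≠ 0 := by
  have := one_sub_mul_pow_ne_zero ht (dual_mul_ne ht e he) m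
  rw [spec_natCast, ← dual_a_eq]
  convert! this using 2
  ring

lemma one_sub_mul_inv_spec_ne (ht : t.Generic) {e : ℂ}
    (he : e ∈ ({t.dual.a, t.dual.b, t.dual.c, t.dual.d} : Set ℂ)) (m : ℕ) :
    1 - e * (spec t (m + 1 : ℕ))⁻¹ ≠ 0 := by
  have hK := dual_a_ne_zero ht
  have hQ := pow_ne_zero (m + 1) ht.q_ne
  -- Only `e = t.dual.a` gives a power of `q`, namely `q^0`; the index `m + 1` in the statement
  -- excludes it.
  have hr : ∀ n : ℤ, e * t.dual.a⁻¹ = t.q ^ n → n = 0 := by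
    intro n hn
    rcases he with rfl | he
    · rw [mul_inv_cancel₀ hK] at hn
      by_contra h
      exact q_zpow_ne_one ht h hn.symm
    · exact (dual_ratio_ne ht e he n hn).elim
  intro h
  have h1 : e * t.dual.a⁻¹ = t.q ^ ((m + 1 : ℕ) : ℤ) := by
    rw [spec_natCast, ← dual_a_eq] at h
    rw [zpow_natCast]
    field_simp at h ⊢
    linear_combination -h
  have := hr _ h1
  omega

/-- Starting from the pole at `t.dual.a⁻¹`, the dilation `y ↦ qy` moves `γ_{m+1}⁻¹` to `γ_m⁻¹`, and
the ratio `awShift` is analytic there. This avoids isolating the vanishing factor in each infinite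
product separately. -/
lemma hasSimplePole_dual (ht : t.Generic) (m : ℕ) :
    HasSimplePole (fun y => weightPlus t.dual y / y) (spec t m)⁻¹ (dualResidue t m) := by
  have q0 := ht.q_ne
  have hK := dual_a_ne_zero ht
  induction m with
  | zero =>
    have e : (spec t (0 : ℕ))⁻¹ = t.dual.a⁻¹ := by rw [spec_natCast, pow_zero, mul_one, dual_a_eq]
    rw [e]
    refine hasSimplePole_awWeight ht.q_lt hK (qPoch_ne_zero ht.q_lt fun k => ?_)
      (qPoch_ne_zero_of_ne_zpow ht (dual_mul_ne ht _ (by simp))) fun e he => ⟨?_, ?_⟩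
    · rw [← pow_succ']; exact one_sub_pow_ne_zero ht.q_lt k
    · exact qPoch_ne_zero_of_ne_zpow ht (dual_ratio_ne ht e he)
    · exact qPoch_ne_zero_of_ne_zpow ht (dual_mul_ne ht e (by simp at he ⊢; tauto))
  | succ m ih =>
    have hs := spec_ne_zero ht (m + 1 : ℕ)
    have hs' := inv_ne_zero hs
    have hqy := q_mul_inv_spec ht m
    have hqy' : (t.q * (spec t (m + 1 : ℕ))⁻¹)⁻¹ = spec t m := by rw [hqy, inv_inv]
    rw [← hqy] at ih
    have hid : AnalyticAt ℂ (fun y : ℂ => y) (spec t (m + 1 : ℕ))⁻¹ := analyticAt_id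
    have hc : ∀ c : ℂ, AnalyticAt ℂ (fun _ : ℂ => c) (spec t (m + 1 : ℕ))⁻¹ :=
      fun _ => analyticAt_const
    have hinv : AnalyticAt ℂ (fun y : ℂ => (t.q * y)⁻¹) (spec t (m + 1 : ℕ))⁻¹ :=
      ((hc _).mul hid).inv (mul_ne_zero q0 hs')
    refine ih.of_dilation q0 (s := awShift t.q t.dual.a t.dual.b t.dual.c t.dual.d) ?_ ?_
    · have n1 : ∀ e, AnalyticAt ℂ (fun y : ℂ => 1 - e * y) (spec t (m + 1 : ℕ))⁻¹ :=
        fun e => (hc 1).sub ((hc e).mul hid)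
      have n2 : ∀ e, AnalyticAt ℂ (fun y : ℂ => 1 - e * (t.q * y)⁻¹) (spec t (m + 1 : ℕ))⁻¹ :=
        fun e => (hc 1).sub ((hc e).mul hinv)
      refine ((((hc 1).sub (hid.pow 2)).mul ((hc 1).sub ((hc _).mul (hid.pow 2)))).mul
        ((((n2 _).mul (n2 _)).mul (n2 _)).mul (n2 _))).div
        ((((hc 1).sub (hinv.pow 2)).mul ((hc 1).sub ((hc _).mul (hinv.pow 2)))).mul
        ((((n1 _).mul (n1 _)).mul (n1 _)).mul (n1 _))) ?_
      change (1 - (t.q * (spec t (m + 1 : ℕ))⁻¹)⁻¹ ^ 2) *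
        (1 - t.q * (t.q * (spec t (m + 1 : ℕ))⁻¹)⁻¹ ^ 2) *
        ((1 - t.dual.a * (spec t (m + 1 : ℕ))⁻¹) * (1 - t.dual.b * (spec t (m + 1 : ℕ))⁻¹) *
        (1 - t.dual.c * (spec t (m + 1 : ℕ))⁻¹) * (1 - t.dual.d * (spec t (m + 1 : ℕ))⁻¹)) ≠ 0
      rw [hqy']
      have n3 := fun e he => one_sub_mul_inv_spec_ne ht (e := e) he m
      exact mul_ne_zero (mul_ne_zero (one_sub_spec_sq_ne ht m) (one_sub_q_spec_sq_ne ht m))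
        (mul_ne_zero (mul_ne_zero (mul_ne_zero (n3 _ (by simp)) (n3 _ (by simp)))
          (n3 _ (by simp))) (n3 _ (by simp)))
    · have hev : ∀ {g : ℂ → ℂ}, AnalyticAt ℂ g (spec t (m + 1 : ℕ))⁻¹ →
          g (spec t (m + 1 : ℕ))⁻¹ ≠ 0 → ∀ᶠ y in 𝓝 (spec t (m + 1 : ℕ))⁻¹, g y ≠ 0 :=
        fun hg h0 => hg.continuousAt.eventually_ne h0
      have n2 : ∀ e ∈ ({t.dual.a, t.dual.b, t.dual.c, t.dual.d} : Set ℂ),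
          ∀ᶠ y in 𝓝 (spec t (m + 1 : ℕ))⁻¹, 1 - e * (t.q * y)⁻¹ ≠ 0 := fun e he =>
        hev (g := fun y => 1 - e * (t.q * y)⁻¹) ((hc 1).sub ((hc e).mul hinv)) (by
          simp only [hqy']; exact one_sub_mul_spec_ne ht he m)
      filter_upwards [hev hid hs',
        hev (g := fun y => 1 - (t.q * y)⁻¹ ^ 2) ((hc 1).sub (hinv.pow 2))
          (by simp only [hqy']; exact one_sub_spec_sq_ne ht m),
        hev (g := fun y => 1 - t.q * (t.q * y)⁻¹ ^ 2) ((hc 1).sub ((hc _).mul (hinv.pow 2)))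
          (by simp only [hqy']; exact one_sub_q_spec_sq_ne ht m),
        n2 t.dual.a (by simp), n2 t.dual.b (by simp), n2 t.dual.c (by simp), n2 t.dual.d (by simp)]
        with y h0 h1 h2 ha hb hc hd
      have := awWeight_eq_shift_mul (a := t.dual.a) (b := t.dual.b) (c := t.dual.c)
        (d := t.dual.d) q0 ht.q_lt h0 h1 h2 (by
          intro e he
          simp only [mem_insert_iff, mem_singleton_iff] at he
          rcases he with rfl | rfl | rfl | rfl <;> assumption)
      change awWeight t.q t.dual.a t.dual.b t.dual.c t.dual.d y / y = t.q * _ *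
        (awWeight t.q t.dual.a t.dual.b t.dual.c t.dual.d (t.q * y) / (t.q * y))
      rw [this]
      field_simp

lemma dualResidue_ne_zero (ht : t.Generic) (m : ℕ) : dualResidue t m ≠ 0 := by
  have q0 := ht.q_ne
  have hK := dual_a_ne_zero ht
  induction m with
  | zero =>
    have hr := dual_ratio_ne ht
    have hm := dual_mul_ne ht
    have P := fun {x} => qPoch_ne_zero_of_ne_zpow ht (x := x)
    have hqq : qPoch t.q t.q ≠ 0 := qPoch_ne_zero ht.q_lt fun k => by
      rw [← pow_succ']; exact one_sub_pow_ne_zero ht.q_lt k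
    have h2 : ∀ n : ℤ, t.dual.a⁻¹ ^ 2 ≠ t.q ^ n := fun n h => hm t.dual.a (by simp) (-n) (by
      rw [zpow_neg, ← h]; field_simp)
    refine neg_ne_zero.mpr (div_ne_zero (mul_ne_zero (P h2) ?_) ?_)
    · rw [sq]; exact P (hm _ (by simp))
    · exact mul_ne_zero (mul_ne_zero (mul_ne_zero (mul_ne_zero hqq (P (hm _ (by simp))))
        (mul_ne_zero (P (hr _ (by simp))) (P (hm _ (by simp)))))
        (mul_ne_zero (P (hr _ (by simp))) (P (hm _ (by simp)))))
        (mul_ne_zero (P (hr _ (by simp))) (P (hm _ (by simp))))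
  | succ m ih =>
    refine mul_ne_zero ?_ ih
    have hqy' : (t.q * (spec t (m + 1 : ℕ))⁻¹)⁻¹ = spec t m := by
      rw [q_mul_inv_spec ht, inv_inv]
    have hS := spec_ne_zero ht (m + 1 : ℕ)
    have h1 : 1 - (spec t (m + 1 : ℕ))⁻¹ ^ 2 ≠ 0 := by
      have := one_sub_spec_sq_ne ht (m + 1)
      have e : 1 - (spec t (m + 1 : ℕ))⁻¹ ^ 2 =
          -(1 - spec t (m + 1 : ℕ) ^ 2) / spec t (m + 1 : ℕ) ^ 2 := by field_simp; ring
      rw [e]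
      exact div_ne_zero (neg_ne_zero.mpr this) (pow_ne_zero _ hS)
    have h2 : 1 - t.q * (spec t (m + 1 : ℕ))⁻¹ ^ 2 ≠ 0 := by
      have := one_sub_q_spec_sq_ne ht m
      have e0 : spec t (m + 1 : ℕ) = t.q * spec t m := by
        rw [spec_natCast, spec_natCast, pow_succ]; ring
      have hS' := spec_ne_zero ht m
      have e : 1 - t.q * (spec t (m + 1 : ℕ))⁻¹ ^ 2 =
          -(1 - t.q * spec t m ^ 2) / (t.q * spec t m ^ 2) := by rw [e0]; field_simp; ring
      rw [e]
      exact div_ne_zero (neg_ne_zero.mpr this) (mul_ne_zero q0 (pow_ne_zero _ hS'))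
    have n3 := fun e he => one_sub_mul_inv_spec_ne ht (e := e) he m
    have n4 := fun e he => one_sub_mul_spec_ne ht (e := e) he m
    rw [awShift, hqy']
    exact div_ne_zero (mul_ne_zero (mul_ne_zero h1 h2) (mul_ne_zero (mul_ne_zero (mul_ne_zero
      (n4 _ (by simp)) (n4 _ (by simp))) (n4 _ (by simp))) (n4 _ (by simp))))
      (mul_ne_zero (mul_ne_zero (one_sub_spec_sq_ne ht m) (one_sub_q_spec_sq_ne ht m))
        (mul_ne_zero (mul_ne_zero (mul_ne_zero (n3 _ (by simp)) (n3 _ (by simp)))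
          (n3 _ (by simp))) (n3 _ (by simp))))

lemma wPlus_natCast (ht : t.Generic) (m : ℕ) : wPlus t (spec t m)⁻¹ = dualResidue t m := by
  rw [wPlus, (hasSimplePole_dual ht m).residue_eq, sgn, if_pos ⟨m, rfl⟩, mul_one]

/-- For `n > 0` one has `γ_{-n} = γ_n⁻¹`. The weight is invariant under `y ↦ y⁻¹` whereas `dy / y`
changes sign, so the residues at reciprocal points are opposite; the factor `sgn` restores equality.
-/
lemma wPlus_spec (ht : t.Generic) (m : ℤ) : wPlus t (spec t m)⁻¹ = dualResidue t m.natAbs := by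
  obtain ⟨n, rfl | rfl⟩ := Int.eq_nat_or_neg m
  · rw [wPlus_natCast ht, Int.natAbs_natCast]
  · rw [Int.natAbs_neg, Int.natAbs_natCast]
    rcases eq_or_ne n 0 with rfl | hn
    · rw [← wPlus_natCast ht]; simp
    · have h := (hasSimplePole_dual ht n).of_inv (inv_ne_zero (spec_ne_zero ht n)) (by
        intro y hy
        change awWeight t.q t.dual.a t.dual.b t.dual.c t.dual.d y / y =
          awWeight t.q t.dual.a t.dual.b t.dual.c t.dual.d y⁻¹ / y⁻¹ / y ^ 2
        rw [awWeight_inv]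
        field_simp)
      rw [← spec_neg_natCast t hn] at h
      rw [wPlus, h.residue_eq, sgn, if_neg, neg_mul_neg, mul_one]
      rintro ⟨k, hk⟩
      have := spec_injective ht (inv_injective hk)
      omega

/-- The norms of the symmetric polynomials in terms of the dual residues. -/
lemma dualResidue_mul_awNorm (ht : t.Generic) (m : ℕ) :
    dualResidue t m * awNorm t.q t.a t.b t.c t.d ((t.k₀ * t.k₁) ^ 2) m = dualResidue t 0 := by
  have k0 := ht.k₀_ne
  have k1 := ht.k₁_ne
  have u0 := ht.u₀_ne
  have u1 := ht.u₁_ne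
  have q0 := ht.q_ne
  have hr := rq_ne_zero ht
  have hκ : ∀ n : ℕ, 1 - (t.k₀ * t.k₁) ^ 2 * t.q ^ n ≠ 0 :=
    one_sub_mul_pow_ne_zero ht (sq_k₀_mul_k₁_ne ht)
  induction m with
  | zero =>
    have := hκ 0
    simp only [pow_zero, mul_one] at this
    simp [awNorm, qFact_zero, div_self this]
  | succ m ih =>
    rw [← ih, dualResidue, mul_right_comm, mul_comm _ (dualResidue t m)]
    congr 1
    have hsep : ∀ e ∈ ({t.a, t.b, t.c, t.d} : Set ℂ), ∀ f ∈ ({t.a, t.b, t.c, t.d} : Set ℂ),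
        ∀ n : ℕ, 1 - e * f * t.q ^ n ≠ 0 := fun e he f hf =>
      one_sub_mul_pow_ne_zero ht (ht.sep e he f hf)
    have hF : ∀ e ∈ ({t.a, t.b, t.c, t.d} : Set ℂ), ∀ f ∈ ({t.a, t.b, t.c, t.d} : Set ℂ),
        qFact t.q (e * f) m ≠ 0 := fun e he f hf => qFact_ne_zero fun n _ => hsep e he f hf n
    have Fab := hF t.a (by simp) t.b (by simp)
    have Fac := hF t.a (by simp) t.c (by simp)
    have Fad := hF t.a (by simp) t.d (by simp)
    have Fbc := hF t.b (by simp) t.c (by simp)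
    have Fbd := hF t.b (by simp) t.d (by simp)
    have Fcd := hF t.c (by simp) t.d (by simp)
    have Fκ : qFact t.q ((t.k₀ * t.k₁) ^ 2) m ≠ 0 := qFact_ne_zero fun n _ => hκ n
    have gab := hsep t.a (by simp) t.b (by simp) m
    have gac := hsep t.a (by simp) t.c (by simp) m
    have gad := hsep t.a (by simp) t.d (by simp) m
    have gbc := hsep t.b (by simp) t.c (by simp) m
    have gbd := hsep t.b (by simp) t.d (by simp) m
    have gcd := hsep t.c (by simp) t.d (by simp) m
    have gκ := hκ m
    have gκ0 := hκ (2 * m)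
    have gκ1 := hκ (2 * m + 1)
    have gκ2 := hκ (2 * (m + 1))
    have gq := one_sub_pow_ne_zero ht.q_lt m
    have hQ : t.q ^ m ≠ 0 := pow_ne_zero _ q0
    have hS : spec t (m + 1 : ℕ) = t.k₀ * t.k₁ * (t.q * t.q ^ m) := by
      rw [spec_natCast, pow_succ']
    have hqy' : (t.q * (t.k₀ * t.k₁ * (t.q * t.q ^ m))⁻¹)⁻¹ = t.k₀ * t.k₁ * t.q ^ m := by
      field_simp
    -- Duality in explicit form: at `γ_{m+1}⁻¹` the dual factors become those with `q^(m+1)`, `cd`,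
    -- `bd`, `bc`, and at `γ_m` (`ra` to `rd`) those with `κ`, `ab`, `ac`, `ad`. These are precisely
    -- the factors by which `awNorm` changes from `m` to `m + 1`.
    have pa : 1 - t.dual.a * (t.k₀ * t.k₁ * (t.q * t.q ^ m))⁻¹ =
        -(1 - t.q ^ (m + 1)) / (t.q * t.q ^ m) := by
      rw [dual_a_eq, pow_succ']; field_simp; ring
    have pb : 1 - t.dual.b * (t.k₀ * t.k₁ * (t.q * t.q ^ m))⁻¹ =
        (1 - t.c * t.d * t.q ^ m) / (t.k₀ ^ 2 * (t.q * t.q ^ m)) := by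
      simp only [Param.b, Param.c, Param.d, Param.dual, Param.q]; field_simp; ring
    have pc : 1 - t.dual.c * (t.k₀ * t.k₁ * (t.q * t.q ^ m))⁻¹ =
        -(t.rq * t.u₀ * t.u₁) / (t.k₀ * t.k₁ * (t.q * t.q ^ m)) * (1 - t.b * t.d * t.q ^ m) := by
      simp only [Param.b, Param.c, Param.d, Param.dual, Param.q]; field_simp; ring
    have pd : 1 - t.dual.d * (t.k₀ * t.k₁ * (t.q * t.q ^ m))⁻¹ =
        t.rq * t.u₁ / (t.u₀ * t.k₀ * t.k₁ * (t.q * t.q ^ m)) * (1 - t.b * t.c * t.q ^ m) := by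
      simp only [Param.b, Param.c, Param.d, Param.dual, Param.q]; field_simp; ring
    have p1 : 1 - (t.k₀ * t.k₁ * (t.q * t.q ^ m))⁻¹ ^ 2 =
        -(1 - (t.k₀ * t.k₁) ^ 2 * t.q ^ (2 * (m + 1))) /
          ((t.k₀ * t.k₁) ^ 2 * (t.q * t.q ^ m) ^ 2) := by
      rw [show t.q ^ (2 * (m + 1)) = (t.q * t.q ^ m) ^ 2 by ring]; field_simp; ring
    have p2 : 1 - t.q * (t.k₀ * t.k₁ * (t.q * t.q ^ m))⁻¹ ^ 2 =
        -(1 - (t.k₀ * t.k₁) ^ 2 * t.q ^ (2 * m + 1)) /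
          ((t.k₀ * t.k₁) ^ 2 * (t.q * (t.q ^ m) ^ 2)) := by
      rw [show t.q ^ (2 * m + 1) = t.q * (t.q ^ m) ^ 2 by ring]; field_simp; ring
    have r1 : 1 - (t.k₀ * t.k₁ * t.q ^ m) ^ 2 = 1 - (t.k₀ * t.k₁) ^ 2 * t.q ^ (2 * m) := by ring
    have r2 : 1 - t.q * (t.k₀ * t.k₁ * t.q ^ m) ^ 2 =
        1 - (t.k₀ * t.k₁) ^ 2 * t.q ^ (2 * m + 1) := by ring
    have ra : 1 - t.dual.a * (t.k₀ * t.k₁ * t.q ^ m) = 1 - (t.k₀ * t.k₁) ^ 2 * t.q ^ m := by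
      rw [dual_a_eq]; ring
    have rb : 1 - t.dual.b * (t.k₀ * t.k₁ * t.q ^ m) = 1 - t.a * t.b * t.q ^ m := by
      simp only [Param.a, Param.b, Param.dual]; field_simp
    have rc : 1 - t.dual.c * (t.k₀ * t.k₁ * t.q ^ m) = 1 - t.a * t.c * t.q ^ m := by
      simp only [Param.a, Param.c, Param.dual]; ring
    have rd : 1 - t.dual.d * (t.k₀ * t.k₁ * t.q ^ m) = 1 - t.a * t.d * t.q ^ m := by
      simp only [Param.a, Param.d, Param.dual]; field_simp
    have hqq : 1 - t.q * t.q ^ m = 1 - t.q ^ (m + 1) := by rw [pow_succ']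
    have ha2 : t.a ^ (2 * (m + 1)) = t.a ^ (2 * m) * (t.k₁ * t.u₁) ^ 2 := by
      rw [mul_add, pow_add]; rfl
    rw [awShift, hS, hqy', pa, pb, pc, pd, p1, p2, r1, r2, ra, rb, rc, rd, awNorm, awNorm, ha2]
    simp only [qFact_succ, hqq]
    have hrq : t.q = t.rq ^ 2 := rfl
    generalize 1 - (t.k₀ * t.k₁) ^ 2 * t.q ^ (2 * m) = g0 at *
    generalize 1 - (t.k₀ * t.k₁) ^ 2 * t.q ^ (2 * m + 1) = g1 at *
    generalize 1 - (t.k₀ * t.k₁) ^ 2 * t.q ^ (2 * (m + 1)) = g2 at *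
    generalize 1 - (t.k₀ * t.k₁) ^ 2 * t.q ^ m = g3 at *
    generalize 1 - t.q ^ (m + 1) = g4 at *
    generalize 1 - t.a * t.b * t.q ^ m = hab at *
    generalize 1 - t.a * t.c * t.q ^ m = hac at *
    generalize 1 - t.a * t.d * t.q ^ m = had at *
    generalize 1 - t.b * t.c * t.q ^ m = hbc at *
    generalize 1 - t.b * t.d * t.q ^ m = hbd at *
    generalize 1 - t.c * t.d * t.q ^ m = hcd at *
    generalize qFact t.q (t.a * t.b) m = Gab at *
    generalize qFact t.q (t.a * t.c) m = Gac at *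
    generalize qFact t.q (t.a * t.d) m = Gad at *
    generalize qFact t.q (t.b * t.c) m = Gbc at *
    generalize qFact t.q (t.b * t.d) m = Gbd at *
    generalize qFact t.q (t.c * t.d) m = Gcd at *
    generalize qFact t.q ((t.k₀ * t.k₁) ^ 2) m = Gκ at *
    generalize qFact t.q t.q m = Gq at *
    generalize t.a ^ (2 * m) = A at *
    generalize t.q ^ m = Q at *
    generalize 1 - (t.k₀ * t.k₁) ^ 2 = g5 at *
    rw [hrq]
    field_simp

end

section

variable {t : Param} {Γ : ℝ → ℂ}

/-! ### The quadratic norms -/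

lemma isAWContour_of_isAdmissible (ht : t.Generic) (hΓ : IsAdmissible t Γ) :
    IsAWContour t.q Γ t.a t.b t.c t.d := by
  have hlip : IsClosedLipschitz Γ := ⟨hΓ.jordan.lipschitz, hΓ.jordan.closed⟩
  have k0 := ht.k₀_ne
  have k1 := ht.k₁_ne
  have u0 := ht.u₀_ne
  have u1 := ht.u₁_ne
  have hr := rq_ne_zero ht
  have hin : ∀ e ∈ ({t.a, t.b, t.c, t.d} : Set ℂ), ∀ k : ℕ, winding Γ (e * t.q ^ k) = 1 :=
    fun e he k => hΓ.ccw _ (hΓ.inside_mem e he k)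
  have hloop : IsLoop Γ := by
    refine ⟨hlip, hΓ.zero_notMem, ?_⟩
    -- The enclosed points `a q^k` accumulate at the origin, so local constancy gives winding number
    -- one there.
    have ht0 : Tendsto (fun k : ℕ => t.a * t.q ^ k) atTop (𝓝 0) := by
      have := (tendsto_pow_atTop_nhds_zero_of_norm_lt_one ht.q_lt).const_mul t.a
      rwa [mul_zero] at this
    obtain ⟨k, hk⟩ := (ht0.eventually (eventually_winding_eq hlip hΓ.zero_notMem)).exists
    rw [← hk.2, hin t.a (by simp)]
  have hE : ∀ e ∈ ({t.a, t.b, t.c, t.d} : Set ℂ), e ≠ 0 → Enclosed t.q Γ e := fun e he he0 =>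
    ⟨he0, fun k => ⟨(hΓ.inside_mem e he k).1, hin e he k, (hΓ.outside_mem e he k).1,
      winding_outside hlip (hΓ.outside_mem e he k)⟩⟩
  exact ⟨hloop, hE _ (by simp) (by simp [Param.a, *]), hE _ (by simp) (by simp [Param.b, *]),
    hE _ (by simp) (by simp [Param.c, *]), hE _ (by simp) (by simp [Param.d, *])⟩

lemma abcd_eq (ht : t.Generic) : t.a * t.b * t.c * t.d = t.q * (t.k₀ * t.k₁) ^ 2 := by
  have u0 := ht.u₀_ne
  have u1 := ht.u₁_ne
  simp only [Param.a, Param.b, Param.c, Param.d, Param.q]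
  field_simp

lemma one_sub_kappa_ne (ht : t.Generic) (n : ℕ) : 1 - (t.k₀ * t.k₁) ^ 2 * t.q ^ n ≠ 0 :=
  one_sub_mul_pow_ne_zero ht (sq_k₀_mul_k₁_ne ht) n

lemma rq_norm_lt (ht : t.Generic) : ‖t.rq‖ < 1 := by
  have h := ht.q_lt
  rw [Param.q, norm_pow] at h
  by_contra hcon
  exact absurd (one_le_pow₀ (not_lt.mp hcon) (n := 2)) (not_le.mpr h)

/-- The shift changes the product of the parameters to `q^(k+1) κ`, which still avoids the zeros of
`(z; q)_∞`. These masses are the moments with index `0` in the first slot, needed to divide when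
locating the roots of the interpolating polynomial. -/
lemma awMass_pow_ne_zero (ht : t.Generic) (hΓ : IsAdmissible t Γ) (k : ℕ) :
    awMass t.q Γ t.a (t.b * t.q ^ k) t.c t.d ≠ 0 := by
  have h := (isAWContour_of_isAdmissible ht hΓ).shift ht.q_ne 0 k 0 0
  simp only [pow_zero, mul_one] at h
  refine awMass_ne_zero (rq_ne_zero ht) (rq_norm_lt ht) h fun n => ?_
  have := one_sub_kappa_ne ht (1 + k + n)
  convert! this using 2
  have e := abcd_eq ht
  change t.a * (t.b * t.q ^ k) * t.c * t.d * t.q ^ n = _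
  rw [pow_add, pow_add, pow_one]
  linear_combination (t.q ^ k * t.q ^ n) * e

lemma pairing_one_one (t : Param) (Γ : ℝ → ℂ) :
    pairing t Γ 1 1 = awMass t.q Γ t.a t.b t.c t.d := by
  have h : ∀ x, evalAt 1 x = 1 := evalLin_one
  simp only [pairing, awMass, awInt, h, one_mul]
  rfl

lemma coeffLin_sym_neg (ht : t.Generic) (m : ℕ) (k : ℤ) :
    coeffLin (-k) (sym t m) = coeffLin k (sym t m) := by
  rw [← coeffLin_s₁, s₁_sym ht]

lemma coeffLin_sym_of_le (ht : t.Generic) (m : ℕ) {k : ℤ} (hk : (m : ℤ) ≤ k) :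
    coeffLin k (sym t m) = if k = m then 1 else 0 := by
  have h := coeffLin_eq_zero_of_mem (r := rank m) (k := k)
    (by rw [rank_pos (by omega), rank_pos (by omega)]; omega) (sym_spec ht m).2
  rw [map_sub, coeffLin_T, sub_eq_zero] at h
  rw [h]
  simp only [eq_comm]

/-- Expansion of the monic symmetric polynomial with respect to one of the parameters `a`, `b`. -/
lemma exists_sym_expansion (ht : t.Generic) (m : ℕ) {a b c d : ℂ} (ha : a ≠ 0)
    (hκ : a * b * c * d = t.q * (t.k₀ * t.k₁) ^ 2)
    (hw : ∀ x, awCoeff t.q a b c d x = awCoeff t.q t.a t.b t.c t.d x)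
    (hab : ∀ n : ℤ, a * b ≠ t.q ^ n) (hac : ∀ n : ℤ, a * c ≠ t.q ^ n)
    (had : ∀ n : ℤ, a * d ≠ t.q ^ n) :
    ∃ A : ℕ → ℂ, sym t m = ∑ j ∈ Finset.range (m + 1), A j • symFactL t.q a j ∧
      (∀ j < m, A (j + 1) * awLower t.q a b c d (j + 1) =
        (awEigen t.q ((t.k₀ * t.k₁) ^ 2) m - awEigen t.q ((t.k₀ * t.k₁) ^ 2) j) * A j) ∧
      A m * ∏ i ∈ Finset.range m, -(a * t.q ^ i) = 1 ∧ A 0 ≠ 0 := by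
  refine exists_expansion ht.q_ne ht.q_lt ha hκ (one_sub_mul_pow_ne_zero ht hab)
    (one_sub_mul_pow_ne_zero ht hac) (one_sub_mul_pow_ne_zero ht had) (coeffLin_sym_neg ht m)
    (fun k hk => ?_) ?_ fun x hx h1 h2 h3 => ?_
  · rw [coeffLin_sym_of_le ht m hk.le, if_neg hk.ne']
  · rw [coeffLin_sym_of_le ht m le_rfl, if_pos rfl]
  · rw [hw, hw]
    exact evalLin_sym_eigen ht m hx h1 h2 h3

lemma symFact_self (q : ℂ) {a : ℂ} (ha : a ≠ 0) (j : ℕ) : symFact q a (j + 1) a = 0 := by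
  rw [symFact, mul_inv_cancel₀ ha, qFact_succ' q 1, sub_self, zero_mul, mul_zero]

/-- The value at `x₀` is nonzero, and the quadratic norm of the renormalized symmetric
Askey-Wilson polynomial is given by `awNorm`. -/
lemma evalAt_sym_ne_zero_and_pairing_symE (ht : t.Generic) (hΓ : IsAdmissible t Γ) (m : ℕ) :
    evalAt (sym t m) (x₀ t) ≠ 0 ∧ pairing t Γ (symE t m) (symE t m) =
      awNorm t.q t.a t.b t.c t.d ((t.k₀ * t.k₁) ^ 2) m * awMass t.q Γ t.a t.b t.c t.d := by
  have hC := isAWContour_of_isAdmissible ht hΓ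
  have ha0 := hC.ha.1
  have hb0 := hC.hb.1
  have hκ := abcd_eq ht
  have hab := ht.sep t.a (by simp) t.b (by simp)
  have hac := ht.sep t.a (by simp) t.c (by simp)
  have had := ht.sep t.a (by simp) t.d (by simp)
  obtain ⟨A, hpA, hrec, hAm, hA0⟩ := exists_sym_expansion ht m ha0 hκ (fun _ => rfl) hab hac had
  obtain ⟨B, hpB, -, hBm, -⟩ := exists_sym_expansion ht m (a := t.b) (b := t.a) (c := t.c)
    (d := t.d) hb0 (by rw [← hκ]; ring) (fun x => by simp only [awCoeff]; ring)
    (ht.sep t.b (by simp) t.a (by simp)) (ht.sep t.b (by simp) t.c (by simp))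
    (ht.sep t.b (by simp) t.d (by simp))
  have hval : ∀ (e : ℂ) (A : ℕ → ℂ),
      sym t m = ∑ j ∈ Finset.range (m + 1), A j • symFactL t.q e j → ∀ x, x ≠ 0 →
      evalLin x (sym t m) = ∑ j ∈ Finset.range (m + 1), A j * symFact t.q e j x := by
    intro e A h x hx
    conv_lhs => rw [h]
    simp only [map_sum, map_smul, evalLin_symFactL t.q e _ hx, smul_eq_mul]
  -- The normalization point is `a`, where every `(ax, a/x; q)_j` with `j ≥ 1` contains the factor
  -- `1 - a/x = 0`.
  have hx0 : evalAt (sym t m) (x₀ t) = A 0 := by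
    change evalLin t.a (sym t m) = A 0
    rw [hval t.a A hpA _ ha0, Finset.sum_range_succ', Finset.sum_eq_zero, zero_add, symFact_zero,
      mul_one]
    intro j _
    rw [symFact_self t.q ha0, mul_zero]
  refine ⟨hx0 ▸ hA0, ?_⟩
  have hE : ∀ x, evalAt (symE t m) x = (A 0)⁻¹ * evalLin x (sym t m) := fun x => by
    rw [← evalLin_apply, symE, map_smul, hx0, smul_eq_mul]
  have hpair : pairing t Γ (symE t m) (symE t m) = awInt t.q Γ t.a t.b t.c t.d
      (fun x => (A 0)⁻¹ * evalLin x (sym t m) * ((A 0)⁻¹ * evalLin x (sym t m))) := by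
    simp only [pairing, awInt, hE, evalLin_inv_sym ht]
    rfl
  rw [hpair]
  refine awInt_sq ht.q_ne ht.q_lt hC hκ (one_sub_kappa_ne ht) (one_sub_mul_pow_ne_zero ht hab)
    (one_sub_mul_pow_ne_zero ht hac) (one_sub_mul_pow_ne_zero ht had)
    (fun k => by simpa [moment] using awMass_pow_ne_zero ht hΓ k)
    (A := fun j => (A 0)⁻¹ * A j) (B := fun j => (A 0)⁻¹ * B j)
    (p := fun x => (A 0)⁻¹ * evalLin x (sym t m))
    (fun x hx => ?_) (fun x hx => ?_) (fun j hj => ?_) (inv_mul_cancel₀ hA0) ?_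
  · simp only [hval t.a A hpA x (hC.loop.ne_zero hx), Finset.mul_sum, mul_assoc]
  · simp only [hval t.b B hpB x (hC.loop.ne_zero hx), Finset.mul_sum, mul_assoc]
  · have := hrec j hj
    linear_combination (A 0)⁻¹ * this
  -- Both expansions belong to the same monic polynomial, so their leading coefficients agree; after
  -- removal of the common powers of `q` this says `B_m b^m = A_m a^m`.
  · have hprod : ∀ e : ℂ, ∏ i ∈ Finset.range m, -(e * t.q ^ i) =
        e ^ m * ∏ i ∈ Finset.range m, -t.q ^ i := fun e => by
      simp only [neg_mul_eq_mul_neg, Finset.prod_mul_distrib, Finset.prod_const, Finset.card_range]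
    rw [hprod] at hAm hBm
    have hP : ∏ i ∈ Finset.range m, -t.q ^ i ≠ 0 := Finset.prod_ne_zero_iff.mpr fun i _ =>
      neg_ne_zero.mpr (pow_ne_zero _ ht.q_ne)
    have : B m * t.b ^ m = A m * t.a ^ m := mul_right_cancel₀ hP (by
      rw [mul_assoc, hBm, mul_assoc, hAm])
    linear_combination (A 0)⁻¹ * this

end

end AskeyWilson

theorem corollary11p7 (t : AskeyWilson.Param) (ht : t.Generic)
    (Γ : ℝ → ℂ) (hΓ : AskeyWilson.IsAdmissible t Γ) :
    AskeyWilson.pairing t Γ 1 1 ≠ 0 ∧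
    ∀ m : ℤ,
      AskeyWilson.evalAt (AskeyWilson.sym t m.natAbs) (AskeyWilson.x₀ t) ≠ 0 ∧
      AskeyWilson.wPlus t (AskeyWilson.spec t m)⁻¹ ≠ 0 ∧
      AskeyWilson.pairing t Γ (AskeyWilson.symE t m.natAbs) (AskeyWilson.symE t m.natAbs) /
          AskeyWilson.pairing t Γ 1 1 =
        AskeyWilson.wPlus t (AskeyWilson.spec t 0)⁻¹ /
          AskeyWilson.wPlus t (AskeyWilson.spec t m)⁻¹ := by
  have h0 : AskeyWilson.pairing t Γ 1 1 ≠ 0 := by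
    rw [AskeyWilson.pairing_one_one]
    simpa using AskeyWilson.awMass_pow_ne_zero ht hΓ 0
  refine ⟨h0, fun m => ?_⟩
  obtain ⟨h1, h2⟩ := AskeyWilson.evalAt_sym_ne_zero_and_pairing_symE ht hΓ m.natAbs
  have h3 := AskeyWilson.dualResidue_ne_zero ht m.natAbs
  rw [AskeyWilson.wPlus_spec ht, AskeyWilson.wPlus_spec ht]
  refine ⟨h1, h3, ?_⟩
  rw [h2, ← AskeyWilson.pairing_one_one, mul_div_cancel_right₀ _ h0, Int.natAbs_zero,
    ← AskeyWilson.dualResidue_mul_awNorm ht m.natAbs, mul_div_cancel_left₀ _ h3]
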